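/- Let $G$ be a simply connected finite-dimensional complex Lie group with Lie algebra $\mathfrak g$, let $\mathfrak l\subset\mathfrak g$ be a Lie subalgebra with basis $x_1,\dots,x_d$, and let $D$ be the formal neighborhood of $0$ in $\mathfrak l^*$, with coordinates $x_1,\dots,x_d$. Functions $D\to V$ are elements of $V[[x_1,\dots,x_d]]$, and for a 1-form $\theta=\sum_i\theta_i\,dx_i$ on $D$ with values in $V$ we write $\overline\theta=\sum_i x_i\otimes\theta_i: D\to\mathfrak l\otimes V$. For $y\in\mathfrak l$ let $\xi_y$ be the vector field $\lambda\mapsto \mathrm{ad}^*_y\lambda$ on $D$, where $(\mathrm{ad}^*_y\lambda)(x)=\lambda([x,y])$. A function $f:D\to V$ with values in a $\mathfrak g$-module is $\mathfrak l$-equivariant if $\xi_y f=y\cdot f$ for all $y\in\mathfrak l$; a formal map $g:D\to G$ (a point $g(0)\in G$ together with a formal power series expansion of $g$ in a chart at $g(0)$) is $\mathfrak l$-equivariant if its derivative along $\xi_y$ is $yg-gy$ for all $y\in\mathfrak l$. A dynamical r-matrix is an $\mathfrak l$-equivariant function $r:D\to\mathfrak g\otimes\mathfrak g$ such that $r+r^{21}$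 takes values in $(S^2\mathfrak g)^{\mathfrak g}$ and $$\mathrm{Alt}(\overline{dr})+[r^{12},r^{13}]+[r^{12},r^{23}]+[r^{13},r^{23}]=0,\qquad \mathrm{Alt}(x)=x^{123}-x^{213}+x^{312},$$ where $(a\otimes b\otimes c)^{213}=b\otimes a\otimes c$ and $(a\otimes b\otimes c)^{312}=b\otimes c\otimes a$. Let $g:D\to G$ be an $\mathfrak l$-equivariant formal map. Put $\eta_g=g^{-1}dg$ and $\tau_g(\lambda)=(\lambda\otimes1\otimes1)\bigl[\overline{\eta_g}^{12},\overline{\eta_g}^{13}\bigr](\lambda)$, and for $r:D\to\mathfrak g\otimes\mathfrak g$ put $$r^g=(g\otimes g)\bigl(r-\overline{\eta_g}+\overline{\eta_g}^{21}-\tau_g\bigr)(g^{-1}\otimes g^{-1}).$$ Proposition. $r$ is a dynamical r-matrix if and only if $r^g$ is a dynamical r-matrix. -/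

import Mathlib

open scoped TensorProduct Manifold ContDiff

noncomputable section

namespace DynR

/-! ### Formal functions on the formal neighbourhood of `0` -/

/-- The space `V[[x_1, …, x_d]]` of formal functions `D → V`, where `D` is the formal
neighbourhood of `0` in a space with coordinates `x_1, …, x_d`: `f n` is the coefficient of the
monomial `x ^ n`. -/
abbrev FormalFun (d : ℕ) (V : Type*) : Type _ := (Fin d →₀ ℕ) → V

section FormalFun

variable {d : ℕ} {U V W : Type*} [AddCommGroup U] [Module ℂ U] [AddCommGroup V] [Module ℂ V]
  [AddCommGroup W] [Module ℂ W]

/-- The constant formal function. -/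
def FormalFun.const (v : V) : FormalFun d V := fun n => if n = 0 then v else 0

/-- The formal partial derivative `∂ f / ∂ x_i`. -/
def FormalFun.pderiv (i : Fin d) (f : FormalFun d V) : FormalFun d V :=
  fun n => ((n i : ℂ) + 1) • f (n + Finsupp.single i 1)

/-- Multiplication by the coordinate `x_i`. -/
def FormalFun.mulX (i : Fin d) (f : FormalFun d V) : FormalFun d V :=
  fun n => if n i = 0 then 0 else f (n - Finsupp.single i 1)

/-- Application of a linear map to the values. -/
def FormalFun.map (L : V →ₗ[ℂ] W) (f : FormalFun d V) : FormalFun d W := fun n => L (f n)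

/-- The formal function `λ ↦ B (f λ) (g λ)` for a bilinear map `B`. -/
def FormalFun.map₂ (B : U →ₗ[ℂ] V →ₗ[ℂ] W) (f : FormalFun d U) (g : FormalFun d V) :
    FormalFun d W :=
  fun n => ∑ p ∈ Finset.HasAntidiagonal.antidiagonal n, B (f p.1) (g p.2)

end FormalFun

/-! ### The dynamical Yang-Baxter equation -/

section Algebra

variable {𝔤 : Type*} [LieRing 𝔤] [LieAlgebra ℂ 𝔤]

/-- The operation `[p ^ 12, q ^ 13] ∈ L ⊗ V ⊗ V` for `p, q ∈ L ⊗ V`: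
`(a ⊗ u, b ⊗ v) ↦ [a, b] ⊗ u ⊗ v`. -/
def bracket12_13 (L V : Type*) [LieRing L] [LieAlgebra ℂ L] [AddCommGroup V] [Module ℂ V] :
    (L ⊗[ℂ] V) →ₗ[ℂ] (L ⊗[ℂ] V) →ₗ[ℂ] L ⊗[ℂ] (V ⊗[ℂ] V) :=
  TensorProduct.curry
    ((LinearMap.rTensor (V ⊗[ℂ] V) (LieModule.toModuleHom ℂ L L : L ⊗[ℂ] L →ₗ[ℂ] L)) ∘ₗ
      (TensorProduct.tensorTensorTensorComm ℂ L V L V).toLinearMap)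

/-- The operation `[p ^ 12, q ^ 23]`: `(a ⊗ b, c ⊗ e) ↦ a ⊗ [b, c] ⊗ e`. -/
def bracket12_23 (L : Type*) [LieRing L] [LieAlgebra ℂ L] :
    (L ⊗[ℂ] L) →ₗ[ℂ] (L ⊗[ℂ] L) →ₗ[ℂ] L ⊗[ℂ] (L ⊗[ℂ] L) :=
  TensorProduct.curry
    (LinearMap.lTensor L
        (LinearMap.rTensor L (LieModule.toModuleHom ℂ L L : L ⊗[ℂ] L →ₗ[ℂ] L) ∘ₗ
          (TensorProduct.assoc ℂ L L L).symm.toLinearMap) ∘ₗ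
      (TensorProduct.assoc ℂ L L (L ⊗[ℂ] L)).toLinearMap)

/-- The operation `[p ^ 13, q ^ 23]`: `(a ⊗ b, c ⊗ e) ↦ a ⊗ c ⊗ [b, e]`. -/
def bracket13_23 (L : Type*) [LieRing L] [LieAlgebra ℂ L] :
    (L ⊗[ℂ] L) →ₗ[ℂ] (L ⊗[ℂ] L) →ₗ[ℂ] L ⊗[ℂ] (L ⊗[ℂ] L) :=
  TensorProduct.curry
    ((TensorProduct.assoc ℂ L L L).toLinearMap ∘ₗ
      LinearMap.lTensor (L ⊗[ℂ] L) (LieModule.toModuleHom ℂ L L : L ⊗[ℂ] L →ₗ[ℂ] L) ∘ₗ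
      (TensorProduct.tensorTensorTensorComm ℂ L L L L).toLinearMap)

/-- `CYB(r) = [r ^ 12, r ^ 13] + [r ^ 12, r ^ 23] + [r ^ 13, r ^ 23]` for a formal function `r`
with values in `𝔤 ⊗ 𝔤`. -/
def CYB {d : ℕ} (r : FormalFun d (𝔤 ⊗[ℂ] 𝔤)) : FormalFun d (𝔤 ⊗[ℂ] (𝔤 ⊗[ℂ] 𝔤)) :=
  FormalFun.map₂ (bracket12_13 𝔤 𝔤) r r + FormalFun.map₂ (bracket12_23 𝔤) r r +
    FormalFun.map₂ (bracket13_23 𝔤) r r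

/-- `x ^ 213`: `a ⊗ b ⊗ c ↦ b ⊗ a ⊗ c`. -/
def perm213 (V : Type*) [AddCommGroup V] [Module ℂ V] :
    V ⊗[ℂ] (V ⊗[ℂ] V) →ₗ[ℂ] V ⊗[ℂ] (V ⊗[ℂ] V) :=
  (TensorProduct.leftComm ℂ V V V).toLinearMap

/-- `x ^ 312` (first factor in position 3, second in position 1, third in position 2):
`a ⊗ b ⊗ c ↦ b ⊗ c ⊗ a`. -/
def perm312 (V : Type*) [AddCommGroup V] [Module ℂ V] :
    V ⊗[ℂ] (V ⊗[ℂ] V) →ₗ[ℂ] V ⊗[ℂ] (V ⊗[ℂ] V) :=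
  (TensorProduct.assoc ℂ V V V).toLinearMap ∘ₗ
    (TensorProduct.comm ℂ V (V ⊗[ℂ] V)).toLinearMap

/-- `Alt(x) = x ^ 123 - x ^ 213 + x ^ 312`. -/
def Alt (V : Type*) [AddCommGroup V] [Module ℂ V] :
    V ⊗[ℂ] (V ⊗[ℂ] V) →ₗ[ℂ] V ⊗[ℂ] (V ⊗[ℂ] V) :=
  LinearMap.id - perm213 V + perm312 V

/-- The flip `x ↦ x ^ 21` on `𝔤 ⊗ 𝔤`. -/
def flip (V : Type*) [AddCommGroup V] [Module ℂ V] : V ⊗[ℂ] V →ₗ[ℂ] V ⊗[ℂ] V :=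
  (TensorProduct.comm ℂ V V).toLinearMap

/-- A map `𝔩 ⊗ V → 𝔤 ⊗ V` induced by the inclusion `𝔩 ⊆ 𝔤`. -/
def inclTensor (𝔩 : LieSubalgebra ℂ 𝔤) (V : Type*) [AddCommGroup V] [Module ℂ V] :
    (𝔩 ⊗[ℂ] V) →ₗ[ℂ] 𝔤 ⊗[ℂ] V :=
  LinearMap.rTensor V 𝔩.toSubmodule.subtype

variable {𝔩 : LieSubalgebra ℂ 𝔤} {d : ℕ} (b : Module.Basis (Fin d) ℂ 𝔩)
  {V : Type*} [AddCommGroup V] [Module ℂ V]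

/-- Multiplication of a formal function on `D ⊆ 𝔩*` by the linear function
`λ ↦ λ(z)` attached to `z ∈ 𝔩`; the basis elements `x_i = b i` are the coordinates of `D`. -/
def mulLin (z : 𝔩) (f : FormalFun d V) : FormalFun d V :=
  ∑ i, b.repr z i • FormalFun.mulX i f

/-- The contraction `λ ↦ (∑ i, θ_i dx_i)(ξ_y(λ))` of a 1-form with the vector field
`ξ_y(λ) = ad*_y λ` of the coadjoint action of `y ∈ 𝔩` on `𝔩*`, whose coordinates are
`(ad*_y λ)(x_i) = λ([x_i, y])`. -/
def contractCoad (y : 𝔩) (θ : Fin d → FormalFun d V) : FormalFun d V :=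
  ∑ i, mulLin b ⁅b i, y⁆ (θ i)

/-- The differential `df = ∑ i, ∂_i f dx_i`, as the family of its components. -/
def differential (f : FormalFun d V) : Fin d → FormalFun d V := fun i => FormalFun.pderiv i f

/-- `𝔩`-equivariance of a formal function `f : D → V` with values in a `𝔤`-module: the derivative
of `f` along the coadjoint vector field of `y` is `y · f`, for all `y ∈ 𝔩`. -/
def IsEquivariant [LieRingModule 𝔤 V] (f : FormalFun d V) : Prop :=
  ∀ y : 𝔩, contractCoad b y (differential f) = fun n => ⁅(y : 𝔤), f n⁆

/-- The function `θ̄ = ∑ i, x_i ⊗ θ_i : D → 𝔩 ⊗ V` associated with the 1-form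
`θ = ∑ i, θ_i dx_i`. -/
def bar (θ : Fin d → FormalFun d V) : FormalFun d (𝔩 ⊗[ℂ] V) :=
  ∑ i, FormalFun.map (TensorProduct.mk ℂ 𝔩 V (b i)) (θ i)

/-- The function `λ ↦ (λ ⊗ 1)(f(λ))` for `f : D → 𝔩 ⊗ V`. -/
def evalFirst (f : FormalFun d (𝔩 ⊗[ℂ] V)) : FormalFun d V :=
  ∑ i, FormalFun.mulX i
    (FormalFun.map ((TensorProduct.lid ℂ V).toLinearMap ∘ₗ LinearMap.rTensor V (b.coord i)) f)

/-- The classical dynamical Yang-Baxter equation `Alt(dr̄) + CYB(r) = 0`. -/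
def CDYBE (r : FormalFun d (𝔤 ⊗[ℂ] 𝔤)) : Prop :=
  FormalFun.map (Alt 𝔤 ∘ₗ inclTensor 𝔩 (𝔤 ⊗[ℂ] 𝔤)) (bar b (differential r)) + CYB r = 0

/-- Quasi-unitarity: `r + r ^ 21 = Ω` takes values in `(S²𝔤)^𝔤`. -/
def IsQuasiUnitary (r : FormalFun d (𝔤 ⊗[ℂ] 𝔤)) : Prop :=
  ∃ Ω : FormalFun d (𝔤 ⊗[ℂ] 𝔤), r + FormalFun.map (flip 𝔤) r = Ω ∧
    ∀ n, flip 𝔤 (Ω n) = Ω n ∧ ∀ z : 𝔤, ⁅z, Ω n⁆ = 0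

/-- A dynamical r-matrix: an `𝔩`-equivariant quasi-unitary solution of the classical dynamical
Yang-Baxter equation. -/
structure IsDynamicalRMatrix (r : FormalFun d (𝔤 ⊗[ℂ] 𝔤)) : Prop where
  equivariant : IsEquivariant b r
  cdybe : CDYBE b r
  quasiUnitary : IsQuasiUnitary r

/-- The function `τ(λ) = (λ ⊗ 1 ⊗ 1)[η̄ ^ 12, η̄ ^ 13]` attached to a `𝔤`-valued 1-form `η`. -/
def tau (η : Fin d → FormalFun d 𝔤) : FormalFun d (𝔤 ⊗[ℂ] 𝔤) :=
  evalFirst b (FormalFun.map₂ (bracket12_13 𝔩 𝔤) (bar b η) (bar b η))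

/-- `(A ⊗ A)(r - η̄ + η̄ ^ 21 - τ)` for a formal function `A : D → End 𝔤` and a `𝔤`-valued
1-form `η`. -/
def gaugeOf (A : FormalFun d (𝔤 →ₗ[ℂ] 𝔤)) (η : Fin d → FormalFun d 𝔤)
    (r : FormalFun d (𝔤 ⊗[ℂ] 𝔤)) : FormalFun d (𝔤 ⊗[ℂ] 𝔤) :=
  FormalFun.map₂ LinearMap.id
    (FormalFun.map₂ (TensorProduct.mapBilinear (.id ℂ) 𝔤 𝔤 𝔤 𝔤) A A)
    (r - FormalFun.map (inclTensor 𝔩 𝔤) (bar b η)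
      + FormalFun.map (flip 𝔤 ∘ₗ inclTensor 𝔩 𝔤) (bar b η) - tau b η)

end Algebra

/-! ### Formal maps into a complex Lie group -/

/-- The coefficient of `x ^ n` in the Taylor series at `0` of a function of `d` complex
variables: `(∂ ^ n F)(0) / n!`. -/
def taylorCoeff {d : ℕ} {V : Type*} [NormedAddCommGroup V] [NormedSpace ℂ V]
    (F : (Fin d → ℂ) → V) (n : Fin d →₀ ℕ) : V :=
  (∏ i, ((n i).factorial : ℂ))⁻¹ •
    iteratedFDeriv ℂ (Finsupp.toMultiset n).toList.length F 0
      (fun j => Pi.single ((Finsupp.toMultiset n).toList.get j) (1 : ℂ))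

section Group

variable (d : ℕ) (E : Type*) [NormedAddCommGroup E] [NormedSpace ℂ E]
  (G : Type*) [TopologicalSpace G] [ChartedSpace E G]

/-- A formal map from the formal neighbourhood `D` of `0` (with coordinates `x_1, …, x_d`) to the
complex manifold `G`: a point `g(0)` of `G`, and the power series expansion of `g` in the
preferred chart at `g(0)`. -/
structure FormalMap where
  base : G
  coeff : FormalFun d E
  coeff_zero : coeff 0 = extChartAt 𝓘(ℂ, E) base base

variable {d E G}

/-- The germ at `0` of a holomorphic map to `G` which, in the chart at `g(0)`, is the truncation
of the formal map `g` at degree `N`. It agrees with `g` up to order `N`. -/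
def FormalMap.approx (g : FormalMap d E G) (N : ℕ) (x : Fin d → ℂ) : G :=
  (extChartAt 𝓘(ℂ, E) g.base).symm
    (∑ k ∈ Finset.range (N + 1),
      ∑ m ∈ Finset.finsuppAntidiag (Finset.univ : Finset (Fin d)) k,
        (∏ i, x i ^ m i) • g.coeff m)

variable [Group G]

/-- The adjoint action `Ad h` on the Lie algebra `T_1 G`: the derivative at `1` of
`x ↦ h x h⁻¹`. -/
def Ad (h : G) : E →L[ℂ] E :=
  (mfderiv 𝓘(ℂ, E) 𝓘(ℂ, E) (fun x : G => h * x * h⁻¹) 1 :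
    GroupLieAlgebra 𝓘(ℂ, E) G →L[ℂ] TangentSpace 𝓘(ℂ, E) (h * 1 * h⁻¹))

/-- The component along `dx_i` of the 1-form `f⁻¹ df`, with values in `T_1 G`, for a map `f` from
an open subset of `ℂ ^ d` to `G`: the left translate by `f(x)⁻¹` of the partial derivative
`∂_i f(x) ∈ T_{f(x)} G`. -/
def leftLogDeriv (f : (Fin d → ℂ) → G) (i : Fin d) (x : Fin d → ℂ) : E :=
  (mfderiv 𝓘(ℂ, E) 𝓘(ℂ, E) (fun h : G => (f x)⁻¹ * h) (f x) :
      TangentSpace 𝓘(ℂ, E) (f x) →L[ℂ] TangentSpace 𝓘(ℂ, E) ((f x)⁻¹ * f x))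
    (mfderiv 𝓘(ℂ, Fin d → ℂ) 𝓘(ℂ, E) f x (Pi.single i (1 : ℂ) : Fin d → ℂ))

/-- The left translate to `T_1 G` of the velocity at `h` of the conjugation action of `y ∈ T_1 G`
on `G`, i.e. `h⁻¹ (y h - h y)`: the derivative at `1` of `x ↦ h⁻¹ (x h x⁻¹)`, applied to `y`. -/
def conjVelocity (y : GroupLieAlgebra 𝓘(ℂ, E) G) (h : G) : E :=
  (mfderiv 𝓘(ℂ, E) 𝓘(ℂ, E) (fun x : G => h⁻¹ * (x * h * x⁻¹)) 1 :
    GroupLieAlgebra 𝓘(ℂ, E) G →L[ℂ] TangentSpace 𝓘(ℂ, E) (h⁻¹ * (1 * h * 1⁻¹))) y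

/-- The formal function `Ad g : D → End 𝔤`; its coefficients of degree `N` depend only on `g` up to
order `N`. -/
def FormalMap.formalAd (g : FormalMap d E G) :
    FormalFun d (GroupLieAlgebra 𝓘(ℂ, E) G →ₗ[ℂ] GroupLieAlgebra 𝓘(ℂ, E) G) :=
  fun n => (taylorCoeff (fun x => (Ad (g.approx n.degree x) : E →L[ℂ] E)) n).toLinearMap

/-- The formal 1-form `η_g = g⁻¹ dg` on `D` with values in `𝔤 = T_1 G`, as the family of its
components; its coefficients of degree `N` depend only on `g` up to order `N + 1`. -/
def FormalMap.eta (g : FormalMap d E G) :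
    Fin d → FormalFun d (GroupLieAlgebra 𝓘(ℂ, E) G) :=
  fun i n => (taylorCoeff (leftLogDeriv (E := E) (g.approx (n.degree + 1)) i) n : E)

/-- The formal function `D → 𝔤` obtained by composing `h ↦ h⁻¹ (y h - h y)` with `g`. -/
def FormalMap.formalConjVelocity (g : FormalMap d E G) (y : GroupLieAlgebra 𝓘(ℂ, E) G) :
    FormalFun d (GroupLieAlgebra 𝓘(ℂ, E) G) :=
  fun n => (taylorCoeff (fun x => (conjVelocity y (g.approx n.degree x) : E)) n : E)

variable [CompleteSpace E] [LieGroup 𝓘(ℂ, E) ω G]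
  {𝔩 : LieSubalgebra ℂ (GroupLieAlgebra 𝓘(ℂ, E) G)} (b : Module.Basis (Fin d) ℂ 𝔩)

/-- `𝔩`-equivariance of a formal map `g : D → G`, for the coadjoint action on `D ⊆ 𝔩*` and the
conjugation action on `G`: for all `y ∈ 𝔩`, the derivative of `g` along the coadjoint vector field
of `y` is `y g - g y`. Both sides are sections of `g^* TG`, compared after left translation to
the identity. -/
def FormalMap.IsEquivariant (g : FormalMap d E G) : Prop :=
  ∀ y : 𝔩, contractCoad b y g.eta = g.formalConjVelocity (y : GroupLieAlgebra 𝓘(ℂ, E) G)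

/-- The gauge transform
`r ^ g = (g ⊗ g) (r - η̄_g + η̄_g ^ 21 - τ_g) (g⁻¹ ⊗ g⁻¹)`. -/
def gauge (g : FormalMap d E G)
    (r : FormalFun d (GroupLieAlgebra 𝓘(ℂ, E) G ⊗[ℂ] GroupLieAlgebra 𝓘(ℂ, E) G)) :
    FormalFun d (GroupLieAlgebra 𝓘(ℂ, E) G ⊗[ℂ] GroupLieAlgebra 𝓘(ℂ, E) G) :=
  gaugeOf b g.formalAd g.eta r

end Group

end DynR

end

noncomputable section

namespace DynR

/-! ### Formal functions as modules over the ring of formal power series. -/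

namespace FormalFun

open Finset.HasAntidiagonal (antidiagonal mem_antidiagonal)

variable {d : ℕ} {U V W X Y Z : Type*} [AddCommGroup U] [Module ℂ U] [AddCommGroup V] [Module ℂ V]
  [AddCommGroup W] [Module ℂ W] [AddCommGroup X] [Module ℂ X] [AddCommGroup Y] [Module ℂ Y]
  [AddCommGroup Z] [Module ℂ Z]

/-! Write A = Ad g, B = Ad g⁻¹, η = g⁻¹dg and σ = η̄ - η̄²¹ + τ, so that r^g = (A ⊗ A)(r - σ). The
argument needs only the properties of the group collected in `GaugeData`: A is an automorphism of 𝔤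
with inverse B, dA = A ∘ ad η, η is flat, and, by equivariance of g, contracting η with ξ_y gives By
- y.

Apply the last property to one index of τ = ∑ λ([x_i, x_j]) η_i ⊗ η_j. Depending on the index, σ
becomes ∑ (Bx_j ⊗ η_j - η_j ⊗ x_j) or ∑ (x_j ⊗ η_j - η_j ⊗ Bx_j) (`sigma_eq`, `sigma_eq'`).
Comparing the two forms shows that σ is antisymmetric. It is also equivariant (`coadDeriv_sigma`),
and it solves the dynamical Yang-Baxter equation itself (`cdybe_sigma`): flatness removes the
derivatives of η, and what is left is a Jacobi sum.

For equivariant s, differentiating (A ⊗ A)s produces, besides d̄s, an action of σ on s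
(`dbar_app₂`). After Alt this correction is the polarised form CYB(σ, s) + CYB(s, σ)
(`alt_secondAct_of_flip`). For s = r - σ the cross terms complete the square, so the Yang-Baxter
expression of r^g is A⊗A⊗A applied to that of r minus that of σ, and the latter vanishes
(`cdybe_app₂_iff`). Equivariance transfers because A ⊗ A carries the equivariance defect of s to
that of its image. Quasi-unitarity transfers because subtracting σ leaves r + r²¹ unchanged and
automorphisms preserve invariance. All these maps are invertible, hence the equivalence.

It remains to produce the gauge data from g (`FormalMap.gaugeData`). The polynomial truncations of g
in a chart are holomorphic germs. For germs, multiplicativity of Ad, d(Ad f) = Ad f ∘ ad(f⁻¹df) and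
the Maurer-Cartan equation follow by calculus in the chart at 1, where the Lie bracket is the
antisymmetrised mixed second derivative of the multiplication (`lieE_eq`). Taylor coefficients up to
order N of Ad g see only the N-jet of g, and those of η only the (N+1)-jet, so identities of germs
become identities of formal series. -/

theorem map₂_assoc (B : U →ₗ[ℂ] V →ₗ[ℂ] X) (C : X →ₗ[ℂ] W →ₗ[ℂ] Z)
    (B' : V →ₗ[ℂ] W →ₗ[ℂ] Y) (C' : U →ₗ[ℂ] Y →ₗ[ℂ] Z)
    (h : ∀ u v w, C (B u v) w = C' u (B' v w))
    (f : FormalFun d U) (g : FormalFun d V) (k : FormalFun d W) :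
    map₂ C (map₂ B f g) k = map₂ C' f (map₂ B' g k) := by
  funext n
  simp only [map₂, map_sum, LinearMap.sum_apply, Finset.sum_sigma']
  refine Finset.sum_nbij' (fun x => ⟨(x.2.1, x.2.2 + x.1.2), (x.2.2, x.1.2)⟩)
    (fun x => ⟨(x.1.1 + x.2.1, x.2.2), (x.1.1, x.2.1)⟩) ?_ ?_ ?_ ?_ ?_
  · rintro ⟨⟨a, b⟩, ⟨c, e⟩⟩ h
    simp only [Finset.mem_sigma, mem_antidiagonal] at h ⊢
    rw [← h.1, ← h.2, add_assoc]; simp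
  · rintro ⟨⟨a, b⟩, ⟨c, e⟩⟩ h
    simp only [Finset.mem_sigma, mem_antidiagonal] at h ⊢
    rw [← h.1, ← h.2, add_assoc]; simp
  · rintro ⟨⟨a, b⟩, ⟨c, e⟩⟩ h
    simp only [Finset.mem_sigma, mem_antidiagonal] at h ⊢
    simp [h.2]
  · rintro ⟨⟨a, b⟩, ⟨c, e⟩⟩ h
    simp only [Finset.mem_sigma, mem_antidiagonal] at h ⊢
    simp [h.2]
  · rintro ⟨⟨a, b⟩, ⟨c, e⟩⟩ -
    exact h _ _ _

theorem map₂_flip (B : U →ₗ[ℂ] V →ₗ[ℂ] W) (f : FormalFun d U) (g : FormalFun d V) :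
    map₂ B.flip g f = map₂ B f g := by
  funext n
  simp only [map₂]
  exact Finset.sum_nbij' Prod.swap Prod.swap (by simp [add_comm]) (by simp [add_comm]) (by simp)
    (by simp) (by simp)

@[simp] theorem map₂_add_left (B : U →ₗ[ℂ] V →ₗ[ℂ] W) (f f' : FormalFun d U) (g : FormalFun d V) :
    map₂ B (f + f') g = map₂ B f g + map₂ B f' g := by
  funext n; simp [map₂, Finset.sum_add_distrib]

@[simp] theorem map₂_add_right (B : U →ₗ[ℂ] V →ₗ[ℂ] W) (f : FormalFun d U) (g g' : FormalFun d V) :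
    map₂ B f (g + g') = map₂ B f g + map₂ B f g' := by
  funext n; simp [map₂, Finset.sum_add_distrib]

theorem map₂_const_left (B : U →ₗ[ℂ] V →ₗ[ℂ] W) (u : U) (g : FormalFun d V) :
    map₂ B (const u) g = map (B u) g := by
  funext n
  rw [map₂, Finset.sum_eq_single (0, n)]
  · simp [const, map]
  · rintro ⟨a, b⟩ h h'
    have : a ≠ 0 := by
      rintro rfl
      simp_all
    simp [const, this]
  · simp

theorem map₂_const_right (B : U →ₗ[ℂ] V →ₗ[ℂ] W) (f : FormalFun d U) (v : V) :
    map₂ B f (const v) = map (B.flip v) f := by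
  rw [← map₂_flip, map₂_const_left]

@[simp] theorem map_const (L : U →ₗ[ℂ] V) (u : U) :
    map L (const u : FormalFun d U) = const (L u) := by
  funext n; simp only [map, const]; split_ifs <;> simp

@[simp] theorem map₂_const (B : U →ₗ[ℂ] V →ₗ[ℂ] W) (u : U) (v : V) :
    map₂ B (const u : FormalFun d U) (const v) = const (B u v) := by
  rw [map₂_const_left, map_const]

theorem const_add (u v : V) : (const (u + v) : FormalFun d V) = const u + const v := by
  funext n; simp only [const, Pi.add_apply]; split_ifs <;> simp

theorem map_map₂ (L : W →ₗ[ℂ] X) (B : U →ₗ[ℂ] V →ₗ[ℂ] W) (f : FormalFun d U) (g : FormalFun d V) :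
    map L (map₂ B f g) = map₂ (B.compr₂ L) f g := by
  funext n; simp [map, map₂]

/-- Multiplication of a formal function by a formal power series. -/
instance instSMul : SMul (MvPowerSeries (Fin d) ℂ) (FormalFun d V) where
  smul c f := map₂ (LinearMap.lsmul ℂ V) (show FormalFun d ℂ from c) f

theorem smul_eq_map₂ (c : MvPowerSeries (Fin d) ℂ) (f : FormalFun d V) :
    c • f = map₂ (LinearMap.lsmul ℂ V) (show FormalFun d ℂ from c) f := rfl

theorem one_eq_const :
    (show FormalFun d ℂ from (1 : MvPowerSeries (Fin d) ℂ)) = const 1 := by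
  classical
  funext n
  exact MvPowerSeries.coeff_one n

theorem mul_eq_map₂ (a c : MvPowerSeries (Fin d) ℂ) :
    (show FormalFun d ℂ from a * c) = map₂ (LinearMap.mul ℂ ℂ) (show FormalFun d ℂ from a)
      (show FormalFun d ℂ from c) := by
  funext n
  exact MvPowerSeries.coeff_mul n a c

/-- Formal functions form a module over the ring of formal power series. -/
instance instModule : Module (MvPowerSeries (Fin d) ℂ) (FormalFun d V) where
  one_smul f := by
    rw [smul_eq_map₂, one_eq_const, map₂_const_left]
    funext n; simp [map]
  mul_smul a c f := by
    rw [smul_eq_map₂, smul_eq_map₂, smul_eq_map₂, mul_eq_map₂]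
    exact map₂_assoc _ _ _ _ (fun u v w => mul_smul u v w) _ _ _
  smul_zero a := by
    rw [smul_eq_map₂]
    funext n
    simp [map₂]
  smul_add a f g := by
    rw [smul_eq_map₂, map₂_add_right]; rfl
  add_smul a c f := by
    exact map₂_add_left (LinearMap.lsmul ℂ V) (show FormalFun d ℂ from a)
      (show FormalFun d ℂ from c) f
  zero_smul f := by
    rw [smul_eq_map₂]
    funext n
    refine Finset.sum_eq_zero fun p _ => ?_
    exact zero_smul ℂ _

theorem map₂_smul_left (B : U →ₗ[ℂ] V →ₗ[ℂ] W) (c : MvPowerSeries (Fin d) ℂ) (f : FormalFun d U)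
    (g : FormalFun d V) : map₂ B (c • f) g = c • map₂ B f g :=
  map₂_assoc _ _ _ _ (fun u v w => by simp) _ _ _

theorem map₂_smul_right (B : U →ₗ[ℂ] V →ₗ[ℂ] W) (c : MvPowerSeries (Fin d) ℂ) (f : FormalFun d U)
    (g : FormalFun d V) : map₂ B f (c • g) = c • map₂ B f g := by
  rw [← map₂_flip, map₂_smul_left, map₂_flip]

/-- `map₂` as a bilinear map over formal power series. -/
def bilin (d : ℕ) (B : U →ₗ[ℂ] V →ₗ[ℂ] W) :
    FormalFun d U →ₗ[MvPowerSeries (Fin d) ℂ] FormalFun d V →ₗ[MvPowerSeries (Fin d) ℂ]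
      FormalFun d W :=
  LinearMap.mk₂ _ (map₂ B) (map₂_add_left B) (map₂_smul_left B) (map₂_add_right B)
    (map₂_smul_right B)

/-- `map` as a linear map over formal power series. -/
def lin (d : ℕ) (L : U →ₗ[ℂ] V) :
    FormalFun d U →ₗ[MvPowerSeries (Fin d) ℂ] FormalFun d V where
  toFun := map L
  map_add' f g := by funext n; simp [map]
  map_smul' c f := by
    simp only [smul_eq_map₂, map_map₂, RingHom.id_apply]
    funext n; simp [map, map₂]

theorem lin_apply (L : U →ₗ[ℂ] V) (f : FormalFun d U) : lin d L f = map L f := rfl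

@[simp] theorem lin_const (L : U →ₗ[ℂ] V) (u : U) :
    lin d L (const u) = (const (L u) : FormalFun d V) := map_const L u

@[simp] theorem bilin_const (B : U →ₗ[ℂ] V →ₗ[ℂ] W) (u : U) (v : V) :
    bilin d B (const u) (const v) = (const (B u v) : FormalFun d W) := map₂_const B u v

theorem bilin_const_left (B : U →ₗ[ℂ] V →ₗ[ℂ] W) (u : U) (g : FormalFun d V) :
    bilin d B (const u) g = lin d (B u) g := map₂_const_left B u g

theorem bilin_const_right (B : U →ₗ[ℂ] V →ₗ[ℂ] W) (f : FormalFun d U) (v : V) :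
    bilin d B f (const v) = lin d (B.flip v) f := map₂_const_right B f v

theorem const_smul (a : ℂ) (v : V) : (const (a • v) : FormalFun d V) = a • const v := by
  funext n; simp only [const, Pi.smul_apply]; split_ifs <;> simp

theorem const_zero : (const (0 : V) : FormalFun d V) = 0 := by
  funext n; simp [const]

theorem const_neg (v : V) : (const (-v) : FormalFun d V) = -const v := by
  funext n; simp only [const, Pi.neg_apply]; split_ifs <;> simp

theorem const_sub (v w : V) : (const (v - w) : FormalFun d V) = const v - const w := by
  rw [sub_eq_add_neg, const_add, const_neg, sub_eq_add_neg]

theorem const_sum {ι : Type*} (s : Finset ι) (v : ι → V) :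
    (const (∑ i ∈ s, v i) : FormalFun d V) = ∑ i ∈ s, const (v i) := by
  classical
  induction s using Finset.induction_on with
  | empty => simp [const_zero]
  | insert a s ha ih => simp [Finset.sum_insert ha, const_add, ih]

/-- Linear maps over formal power series that agree on constants are equal. -/
theorem hom_ext [FiniteDimensional ℂ V] {M : Type*} [AddCommGroup M]
    [Module (MvPowerSeries (Fin d) ℂ) M]
    {Φ Ψ : FormalFun d V →ₗ[MvPowerSeries (Fin d) ℂ] M} (h : ∀ v, Φ (const v) = Ψ (const v)) :
    Φ = Ψ := by
  ext f
  let e := Module.finBasis ℂ V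
  let c (i) : MvPowerSeries (Fin d) ℂ := map (e.coord i) f
  have hf : f = ∑ i, c i • const (e i) := by
    funext n
    rw [Finset.sum_apply]
    have hc (i) : (c i • (const (e i) : FormalFun d V)) n = e.coord i (f n) • e i := by
      rw [smul_eq_map₂, map₂_const_right]; rfl
    simp [hc]
  rw [hf]
  simp only [map_sum, map_smul, h]

/-- The tensor product of formal functions. -/
abbrev tens : FormalFun d U →ₗ[MvPowerSeries (Fin d) ℂ]
    FormalFun d V →ₗ[MvPowerSeries (Fin d) ℂ] FormalFun d (U ⊗[ℂ] V) :=
  bilin d (TensorProduct.mk ℂ U V)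

/-! ### Derivatives and multiplication by coordinates -/

@[simp] theorem pderiv_add (i : Fin d) (f g : FormalFun d V) :
    pderiv i (f + g) = pderiv i f + pderiv i g := by
  funext n; simp [pderiv]

@[simp] theorem pderiv_sub (i : Fin d) (f g : FormalFun d V) :
    pderiv i (f - g) = pderiv i f - pderiv i g := by
  funext n; simp [pderiv, smul_sub]

@[simp] theorem pderiv_sum {ι : Type*} (s : Finset ι) (i : Fin d) (f : ι → FormalFun d V) :
    pderiv i (∑ j ∈ s, f j) = ∑ j ∈ s, pderiv i (f j) := by
  funext n; simp [pderiv, Finset.sum_apply, Finset.smul_sum]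

@[simp] theorem pderiv_smul (i : Fin d) (a : ℂ) (f : FormalFun d V) :
    pderiv i (a • f) = a • pderiv i f := by
  funext n; simp only [pderiv, Pi.smul_apply]; rw [smul_comm]

@[simp] theorem pderiv_const (i : Fin d) (v : V) : pderiv i (const v : FormalFun d V) = 0 := by
  funext n
  have : n + Finsupp.single i 1 ≠ 0 := by
    intro h
    have := DFunLike.congr_fun h i
    simp at this
  simp [pderiv, const, this]

/-- In the Leibniz rule the summand at (p, q) carries the factor p_i, so pairs with p_i = 0 drop out
and the others are shifts of the antidiagonal of n. -/
theorem sum_antidiagonal_add_single {M : Type*} [AddCommMonoid M] (n : Fin d →₀ ℕ) (i : Fin d)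
    (F : (Fin d →₀ ℕ) → (Fin d →₀ ℕ) → M) (h : ∀ p q, p i = 0 → F p q = 0) :
    ∑ p ∈ antidiagonal (n + Finsupp.single i 1), F p.1 p.2
      = ∑ p ∈ antidiagonal n, F (p.1 + Finsupp.single i 1) p.2 := by
  symm
  refine Finset.sum_of_injOn (fun p => (p.1 + Finsupp.single i 1, p.2)) ?_ ?_ ?_ ?_
  · rintro ⟨a, b⟩ - ⟨c, e⟩ - h
    simpa using h
  · rintro ⟨a, b⟩ h
    simp only [Finset.mem_coe, mem_antidiagonal] at h ⊢
    rw [← h]; abel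
  · rintro ⟨a, b⟩ hp h'
    refine h _ _ ?_
    by_contra ha
    refine h' ⟨(a - Finsupp.single i 1, b), ?_, ?_⟩
    · have h1 : Finsupp.single i 1 ≤ a := by simpa using Nat.one_le_iff_ne_zero.2 ha
      simp only [Finset.mem_coe, mem_antidiagonal] at hp ⊢
      rw [← add_left_inj (Finsupp.single i 1), ← hp]
      rw [add_right_comm, tsub_add_cancel_of_le h1]
    · have h1 : Finsupp.single i 1 ≤ a := by simpa using Nat.one_le_iff_ne_zero.2 ha
      simp [tsub_add_cancel_of_le h1]
  · intros; rfl

/-- On the antidiagonal of n + e_i the factor n_i + 1 splits as p_i + q_i; each half differentiates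
one argument. -/
theorem pderiv_map₂ (i : Fin d) (B : U →ₗ[ℂ] V →ₗ[ℂ] W) (f : FormalFun d U) (g : FormalFun d V) :
    pderiv i (map₂ B f g) = map₂ B (pderiv i f) g + map₂ B f (pderiv i g) := by
  have key (f : FormalFun d U) (n : Fin d →₀ ℕ) :
      ∑ p ∈ antidiagonal (n + Finsupp.single i 1), ((p : (Fin d →₀ ℕ) × (Fin d →₀ ℕ)).1 i : ℂ) • B (f p.1) (g p.2) =
        ∑ p ∈ antidiagonal n, B (pderiv i f p.1) (g p.2) := by
    rw [sum_antidiagonal_add_single n i fun p q => (p i : ℂ) • B (f p) (g q)]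
    · simp [pderiv]
    · intro p q h; simp [h]
  have key' (n : Fin d →₀ ℕ) :
      ∑ p ∈ antidiagonal (n + Finsupp.single i 1), ((p : (Fin d →₀ ℕ) × (Fin d →₀ ℕ)).2 i : ℂ) • B (f p.1) (g p.2) =
        ∑ p ∈ antidiagonal n, B (f p.1) (pderiv i g p.2) := by
    have hs (m : Fin d →₀ ℕ) (F : (Fin d →₀ ℕ) → (Fin d →₀ ℕ) → W) :
        ∑ p ∈ antidiagonal m, F p.1 p.2 = ∑ p ∈ antidiagonal m, F p.2 p.1 :=
      Finset.sum_nbij' Prod.swap Prod.swap (by simp [add_comm]) (by simp [add_comm]) (by simp)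
        (by simp) (by simp)
    rw [hs _ fun p q => (q i : ℂ) • B (f p) (g q), hs _ fun p q => B (f p) (pderiv i g q),
      sum_antidiagonal_add_single n i fun p q => (p i : ℂ) • B (f q) (g p)]
    · simp [pderiv]
    · intro p q h; simp [h]
  funext n
  rw [Pi.add_apply, map₂, map₂, ← key, ← key', ← Finset.sum_add_distrib, pderiv, map₂,
    Finset.smul_sum]
  refine Finset.sum_congr rfl fun p hp => ?_
  rw [mem_antidiagonal] at hp
  rw [← add_smul]
  congr 1
  have := DFunLike.congr_fun hp i
  simp at this
  exact_mod_cast this.symm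

@[simp] theorem pderiv_bilin (i : Fin d) (B : U →ₗ[ℂ] V →ₗ[ℂ] W) (f : FormalFun d U)
    (g : FormalFun d V) :
    pderiv i (bilin d B f g) = bilin d B (pderiv i f) g + bilin d B f (pderiv i g) :=
  pderiv_map₂ i B f g

theorem mulX_eq_smul (i : Fin d) (f : FormalFun d V) :
    mulX i f = (MvPowerSeries.X i : MvPowerSeries (Fin d) ℂ) • f := by
  classical
  funext n
  rw [smul_eq_map₂, map₂, mulX]
  have hX (p : Fin d →₀ ℕ) : (MvPowerSeries.X i : MvPowerSeries (Fin d) ℂ) p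
      = if p = Finsupp.single i 1 then 1 else 0 := MvPowerSeries.coeff_X p i
  split_ifs with h
  · symm
    refine Finset.sum_eq_zero fun p hp => ?_
    rw [mem_antidiagonal] at hp
    have : p.1 ≠ Finsupp.single i 1 := by
      intro h'
      rw [← hp, h'] at h
      simp at h
    simp [hX, this]
  · have h1 : Finsupp.single i 1 ≤ n := by simpa using Nat.one_le_iff_ne_zero.2 h
    rw [Finset.sum_eq_single (Finsupp.single i 1, n - Finsupp.single i 1)]
    · simp [hX]
    · rintro ⟨a, b⟩ hp hne
      rw [mem_antidiagonal] at hp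
      have : a ≠ Finsupp.single i 1 := by
        rintro rfl
        apply hne
        rw [← hp]; simp
      simp [hX, this]
    · intro h'
      exact absurd (by simpa [mem_antidiagonal] using add_tsub_cancel_of_le h1) h'

theorem pderiv_mulX (i j : Fin d) (f : FormalFun d V) :
    pderiv i (mulX j f) = mulX j (pderiv i f) + if i = j then f else 0 := by
  rw [mulX_eq_smul, mulX_eq_smul, smul_eq_map₂, pderiv_map₂, add_comm]
  congr 1
  have : pderiv i (show FormalFun d ℂ from (MvPowerSeries.X j : MvPowerSeries (Fin d) ℂ))
      = const (if i = j then 1 else 0) := by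
    classical
    have hX (p : Fin d →₀ ℕ) : (MvPowerSeries.X j : MvPowerSeries (Fin d) ℂ) p
      = if p = Finsupp.single j 1 then 1 else 0 := MvPowerSeries.coeff_X p j
    funext n
    simp only [pderiv, hX, const]
    by_cases hn : n = 0
    · subst hn
      by_cases hij : i = j
      · simp [hij]
      · simp [hij, Finsupp.single_left_inj]
    · rw [if_neg hn]
      have : ¬ (n + Finsupp.single i 1 = Finsupp.single j 1) := by
        intro h
        apply hn
        have h2 := congrArg Finsupp.degree h
        simp at h2
        exact (Finsupp.degree_eq_zero_iff n).1 (by simpa using h2)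
      simp [this]
  rw [this, map₂_const_left]
  funext n
  split_ifs <;> simp [map]

end FormalFun

open FormalFun

/-! ### Reduction to constants, and formal families of linear maps. -/

section Multilinear

variable {d : ℕ} {U V W X : Type*} [AddCommGroup U] [Module ℂ U] [AddCommGroup V] [Module ℂ V]
  [AddCommGroup W] [Module ℂ W] [AddCommGroup X] [Module ℂ X]
  [FiniteDimensional ℂ U] [FiniteDimensional ℂ V]

/-- Formal functions with values in a finite-dimensional space are spanned by the constants. -/
@[elab_as_elim]
theorem FormalFun.const_induction {P : FormalFun d V → Prop} (f : FormalFun d V)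
    (const : ∀ v, P (const v)) (add : ∀ f g, P f → P g → P (f + g))
    (smul : ∀ (c : MvPowerSeries (Fin d) ℂ) f, P f → P (c • f)) : P f := by
  let S : Submodule (MvPowerSeries (Fin d) ℂ) (FormalFun d V) :=
    { carrier := {f | P f}
      add_mem' := fun {a b} => add a b
      zero_mem' := by
        have := const 0
        rwa [const_zero] at this
      smul_mem' := fun c f => smul c f }
  -- The quotient map kills all constants, hence vanishes by `hom_ext`, so the submodule is
  -- everything.
  have h : S.mkQ = 0 := hom_ext fun v => by
    simpa using (show FormalFun.const v ∈ S from const v)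
  have : f ∈ S := by
    rw [← Submodule.Quotient.mk_eq_zero, ← Submodule.mkQ_apply, h]; rfl
  exact this

/-- Formal functions with values in a tensor product are spanned by the pure tensors. -/
@[elab_as_elim]
theorem FormalFun.tens_induction {P : FormalFun d (U ⊗[ℂ] V) → Prop} (f : FormalFun d (U ⊗[ℂ] V))
    (tens : ∀ u v, P (tens u v)) (add : ∀ f g, P f → P g → P (f + g))
    (smul : ∀ (c : MvPowerSeries (Fin d) ℂ) f, P f → P (c • f)) : P f := by
  induction f using FormalFun.const_induction with
  | add f g hf hg => exact add f g hf hg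
  | smul c f hf => exact smul c f hf
  | const t =>
    induction t with
    | zero => simpa [const_zero] using tens 0 0
    | add x y hx hy => rw [const_add]; exact add _ _ hx hy
    | tmul u v => simpa using tens (const u) (const v)

/-- Application of a formal family of linear maps to a formal function. -/
def app (A : FormalFun d (U →ₗ[ℂ] V)) :
    FormalFun d U →ₗ[MvPowerSeries (Fin d) ℂ] FormalFun d V :=
  bilin d LinearMap.id A

@[simp] theorem app_add (A A' : FormalFun d (U →ₗ[ℂ] V)) : app (A + A') = app A + app A' :=
  map_add _ _ _

@[simp] theorem app_smul (c : MvPowerSeries (Fin d) ℂ) (A : FormalFun d (U →ₗ[ℂ] V)) :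
    app (c • A) = c • app A :=
  map_smul _ _ _

@[simp] theorem app_const (L : U →ₗ[ℂ] V) : app (const L : FormalFun d (U →ₗ[ℂ] V)) = lin d L := by
  ext f : 1
  exact bilin_const_left _ _ _

/-- The tensor product of two formal families of linear maps. -/
abbrev tensHom : FormalFun d (U →ₗ[ℂ] W) →ₗ[MvPowerSeries (Fin d) ℂ]
    FormalFun d (V →ₗ[ℂ] X) →ₗ[MvPowerSeries (Fin d) ℂ]
      FormalFun d (U ⊗[ℂ] V →ₗ[ℂ] W ⊗[ℂ] X) :=
  bilin d (TensorProduct.mapBilinear (.id ℂ) U V W X)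

/-- Both sides are multilinear over the power series ring, so it suffices to compare constants. The
same reduction proves the tensor identities that follow. -/
theorem app_tensHom [FiniteDimensional ℂ W] [FiniteDimensional ℂ X]
    (A : FormalFun d (U →ₗ[ℂ] W)) (A' : FormalFun d (V →ₗ[ℂ] X))
    (u : FormalFun d U) (v : FormalFun d V) :
    app (tensHom A A') (tens u v) = tens (app A u) (app A' v) := by
  induction A using FormalFun.const_induction with
  | add => simp_all
  | smul => simp_all
  | const A =>
  induction A' using FormalFun.const_induction with
  | add => simp_all
  | smul => simp_all
  | const A' =>
  induction u using FormalFun.const_induction with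
  | add => simp_all
  | smul => simp_all
  | const u =>
  induction v using FormalFun.const_induction with
  | add => simp_all
  | smul => simp_all
  | const v => simp

end Multilinear

/-! ### Tensor operations and the polarised Yang-Baxter form. -/

section Lie

variable {𝔤 : Type*} [LieRing 𝔤] [LieAlgebra ℂ 𝔤] {d : ℕ}

/-- The bracket of formal functions with values in a Lie algebra. -/
abbrev br : FormalFun d 𝔤 →ₗ[MvPowerSeries (Fin d) ℂ] FormalFun d 𝔤 →ₗ[MvPowerSeries (Fin d) ℂ]
    FormalFun d 𝔤 :=
  bilin d (LieModule.toEnd ℂ 𝔤 𝔤 : 𝔤 →ₗ[ℂ] 𝔤 →ₗ[ℂ] 𝔤)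

/-- The action of formal functions with values in a Lie algebra on formal functions with values in
its tensor square. -/
abbrev act : FormalFun d 𝔤 →ₗ[MvPowerSeries (Fin d) ℂ]
    FormalFun d (𝔤 ⊗[ℂ] 𝔤) →ₗ[MvPowerSeries (Fin d) ℂ] FormalFun d (𝔤 ⊗[ℂ] 𝔤) :=
  bilin d (LieModule.toEnd ℂ 𝔤 (𝔤 ⊗[ℂ] 𝔤) : 𝔤 →ₗ[ℂ] 𝔤 ⊗[ℂ] 𝔤 →ₗ[ℂ] 𝔤 ⊗[ℂ] 𝔤)

/-- The operation `(a ⊗ b, q) ↦ a ⊗ [b ⊗ 1 + 1 ⊗ b, q]`. -/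
def secondAct (𝔤 : Type*) [LieRing 𝔤] [LieAlgebra ℂ 𝔤] :
    (𝔤 ⊗[ℂ] 𝔤) →ₗ[ℂ] (𝔤 ⊗[ℂ] 𝔤) →ₗ[ℂ] 𝔤 ⊗[ℂ] (𝔤 ⊗[ℂ] 𝔤) :=
  TensorProduct.curry
    (LinearMap.lTensor 𝔤 (LieModule.toModuleHom ℂ 𝔤 (𝔤 ⊗[ℂ] 𝔤) : 𝔤 ⊗[ℂ] (𝔤 ⊗[ℂ] 𝔤) →ₗ[ℂ] 𝔤 ⊗[ℂ] 𝔤) ∘ₗ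
      (TensorProduct.assoc ℂ 𝔤 𝔤 (𝔤 ⊗[ℂ] 𝔤)).toLinearMap)

variable [FiniteDimensional ℂ 𝔤]

theorem br_skew (u v : FormalFun d 𝔤) : br u v = -br v u := by
  induction u using FormalFun.const_induction with
  | add => simp_all; abel
  | smul => simp_all
  | const u =>
  induction v using FormalFun.const_induction with
  | add => simp_all; abel
  | smul => simp_all
  | const v =>
    simp only [bilin_const, ← const_neg]
    simp

theorem act_tens (u v w : FormalFun d 𝔤) :
    act u (tens v w) = tens (br u v) w + tens v (br u w) := by
  induction u using FormalFun.const_induction with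
  | add => simp_all; abel
  | smul => simp_all
  | const u =>
  induction v using FormalFun.const_induction with
  | add => simp_all; abel
  | smul => simp_all
  | const v =>
  induction w using FormalFun.const_induction with
  | add => simp_all; abel
  | smul => simp_all
  | const w =>
    simp only [bilin_const, ← const_add]
    simp

theorem bracket12_13_tens {L V : Type*} [LieRing L] [LieAlgebra ℂ L] [FiniteDimensional ℂ L]
    [AddCommGroup V] [Module ℂ V] [FiniteDimensional ℂ V] (u w : FormalFun d L)
    (v z : FormalFun d V) :
    bilin d (bracket12_13 L V) (tens u v) (tens w z) = tens (br u w) (tens v z) := by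
  induction u using FormalFun.const_induction with
  | add => simp_all
  | smul => simp_all
  | const u =>
  induction v using FormalFun.const_induction with
  | add => simp_all
  | smul => simp_all
  | const v =>
  induction w using FormalFun.const_induction with
  | add => simp_all
  | smul => simp_all
  | const w =>
  induction z using FormalFun.const_induction with
  | add => simp_all
  | smul => simp_all
  | const z => simp [bracket12_13]

theorem bracket12_23_tens (u v w z : FormalFun d 𝔤) :
    bilin d (bracket12_23 𝔤) (tens u v) (tens w z) = tens u (tens (br v w) z) := by
  induction u using FormalFun.const_induction with
  | add => simp_all
  | smul => simp_all
  | const u =>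
  induction v using FormalFun.const_induction with
  | add => simp_all
  | smul => simp_all
  | const v =>
  induction w using FormalFun.const_induction with
  | add => simp_all
  | smul => simp_all
  | const w =>
  induction z using FormalFun.const_induction with
  | add => simp_all
  | smul => simp_all
  | const z => simp [bracket12_23]

theorem bracket13_23_tens (u v w z : FormalFun d 𝔤) :
    bilin d (bracket13_23 𝔤) (tens u v) (tens w z) = tens u (tens w (br v z)) := by
  induction u using FormalFun.const_induction with
  | add => simp_all
  | smul => simp_all
  | const u =>
  induction v using FormalFun.const_induction with
  | add => simp_all
  | smul => simp_all
  | const v =>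
  induction w using FormalFun.const_induction with
  | add => simp_all
  | smul => simp_all
  | const w =>
  induction z using FormalFun.const_induction with
  | add => simp_all
  | smul => simp_all
  | const z => simp [bracket13_23]

theorem secondAct_tens (u v : FormalFun d 𝔤) (q : FormalFun d (𝔤 ⊗[ℂ] 𝔤)) :
    bilin d (secondAct 𝔤) (tens u v) q = tens u (act v q) := by
  induction u using FormalFun.const_induction with
  | add => simp_all
  | smul => simp_all
  | const u =>
  induction v using FormalFun.const_induction with
  | add => simp_all
  | smul => simp_all
  | const v =>
  induction q using FormalFun.const_induction with
  | add => simp_all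
  | smul => simp_all
  | const q => simp [secondAct]

theorem flip_tens (u v : FormalFun d 𝔤) : lin d (flip 𝔤) (tens u v) = tens v u := by
  induction u using FormalFun.const_induction with
  | add => simp_all
  | smul => simp_all
  | const u =>
  induction v using FormalFun.const_induction with
  | add => simp_all
  | smul => simp_all
  | const v => simp [flip]

theorem alt_tens (u v w : FormalFun d 𝔤) :
    lin d (Alt 𝔤) (tens u (tens v w)) =
      tens u (tens v w) - tens v (tens u w) + tens v (tens w u) := by
  induction u using FormalFun.const_induction with
  | add => simp_all; abel
  | smul => simp_all [smul_sub]
  | const u =>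
  induction v using FormalFun.const_induction with
  | add => simp_all; abel
  | smul => simp_all [smul_sub]
  | const v =>
  induction w using FormalFun.const_induction with
  | add => simp_all; abel
  | smul => simp_all [smul_sub]
  | const w =>
    simp only [bilin_const, lin_const, ← const_add, ← const_sub]
    simp [Alt, perm213, perm312]

/-- The bilinear form of the left-hand side of the classical Yang-Baxter equation. -/
def cybBilin (p q : FormalFun d (𝔤 ⊗[ℂ] 𝔤)) : FormalFun d (𝔤 ⊗[ℂ] (𝔤 ⊗[ℂ] 𝔤)) :=
  bilin d (bracket12_13 𝔤 𝔤) p q + bilin d (bracket12_23 𝔤) p q + bilin d (bracket13_23 𝔤) p q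

theorem CYB_eq (r : FormalFun d (𝔤 ⊗[ℂ] 𝔤)) : CYB r = cybBilin r r := rfl

/-- On pure tensors, Alt turns the two terms u ⊗ [v, w] ⊗ z and u ⊗ w ⊗ [v, z] into six. Three of
them keep the legs of p in order, while the other three see p with its legs exchanged. -/
theorem alt_secondAct (p q : FormalFun d (𝔤 ⊗[ℂ] 𝔤)) :
    lin d (Alt 𝔤) (bilin d (secondAct 𝔤) p q) =
      bilin d (bracket12_23 𝔤) p q + bilin d (bracket13_23 𝔤) p q
      - bilin d (bracket12_13 𝔤 𝔤) (lin d (flip 𝔤) p) q + bilin d (bracket13_23 𝔤) q p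
      - bilin d (bracket12_13 𝔤 𝔤) q (lin d (flip 𝔤) p)
      - bilin d (bracket12_23 𝔤) q (lin d (flip 𝔤) p) := by
  induction p using FormalFun.tens_induction with
  | add => simp_all; abel
  | smul => simp_all [smul_sub, smul_add]
  | tens u v =>
  induction q using FormalFun.tens_induction with
  | add => simp_all; abel
  | smul => simp_all [smul_sub, smul_add]
  | tens w z =>
    simp only [secondAct_tens, act_tens, map_add, alt_tens, bracket12_23_tens, bracket12_13_tens,
      bracket13_23_tens, flip_tens]
    rw [br_skew v w, br_skew v z]
    simp only [map_neg, LinearMap.neg_apply]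
    abel

/-- For antisymmetric p the six terms reassemble into the cross terms of CYB(p + q), which is what
completes the square in `cdybe_app₂_iff`. -/
theorem alt_secondAct_of_flip {p : FormalFun d (𝔤 ⊗[ℂ] 𝔤)} (hp : lin d (flip 𝔤) p = -p)
    (q : FormalFun d (𝔤 ⊗[ℂ] 𝔤)) :
    lin d (Alt 𝔤) (bilin d (secondAct 𝔤) p q) = cybBilin p q + cybBilin q p := by
  rw [alt_secondAct, hp, cybBilin, cybBilin]
  simp only [map_neg, LinearMap.neg_apply]
  abel

end Lie

instance FormalFun.instIsScalarTower {d : ℕ} {V : Type*} [AddCommGroup V] [Module ℂ V] :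
    IsScalarTower ℂ (MvPowerSeries (Fin d) ℂ) (FormalFun d V) where
  smul_assoc a c f := by
    rw [smul_eq_map₂, smul_eq_map₂]
    funext n
    simp only [map₂, Pi.smul_apply, Finset.smul_sum]
    refine Finset.sum_congr rfl fun p _ => ?_
    exact smul_assoc a _ _

section Tens

variable {d : ℕ} {U V W : Type*} [AddCommGroup U] [Module ℂ U] [AddCommGroup V] [Module ℂ V]
  [AddCommGroup W] [Module ℂ W] (β : U →ₗ[ℂ] V →ₗ[ℂ] W)

theorem smul_bilin (c : MvPowerSeries (Fin d) ℂ) (u : FormalFun d U) (v : FormalFun d V) :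
    c • bilin d β u v = bilin d β (c • u) v := by
  rw [map_smul, LinearMap.smul_apply]

theorem sum_bilin {ι : Type*} (s : Finset ι) (u : ι → FormalFun d U) (v : FormalFun d V) :
    ∑ i ∈ s, bilin d β (u i) v = bilin d β (∑ i ∈ s, u i) v := by
  rw [map_sum, LinearMap.sum_apply]

end Tens

/-! ### Linear functions on 𝔩* and abstract gauge data. -/

section LinearFunctions

variable {𝔤 : Type*} [LieRing 𝔤] [LieAlgebra ℂ 𝔤] {𝔩 : LieSubalgebra ℂ 𝔤} {d : ℕ}
  (b : Module.Basis (Fin d) ℂ 𝔩) {V : Type*} [AddCommGroup V] [Module ℂ V]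

/-- The linear function attached to `z ∈ 𝔩`, as a formal power series. -/
def linFun : 𝔩 →ₗ[ℂ] MvPowerSeries (Fin d) ℂ := b.constr ℂ fun i => MvPowerSeries.X i

theorem mulLin_eq (z : 𝔩) (f : FormalFun d V) : mulLin b z f = linFun b z • f := by
  rw [mulLin, linFun, Module.Basis.constr_apply_fintype, Finset.sum_smul]
  refine Finset.sum_congr rfl fun i _ => ?_
  rw [mulX_eq_smul, smul_assoc, Module.Basis.equivFun_apply]

theorem pderiv_linFun_smul (k : Fin d) (z : 𝔩) (f : FormalFun d V) :
    pderiv k (linFun b z • f) = linFun b z • pderiv k f + b.repr z k • f := by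
  rw [← mulLin_eq, ← mulLin_eq, mulLin, mulLin]
  simp only [pderiv_sum, pderiv_smul, pderiv_mulX, smul_add, Finset.sum_add_distrib]
  congr 1
  simp [apply_ite]

theorem contractCoad_eq (y : 𝔩) (θ : Fin d → FormalFun d V) :
    contractCoad b y θ = ∑ i, linFun b ⁅b i, y⁆ • θ i := by
  simp only [contractCoad, mulLin_eq]

/-- The constant formal function with value `y ∈ 𝔩`. -/
abbrev cst (d : ℕ) (y : 𝔩) : FormalFun d 𝔤 := const (y : 𝔤)

theorem cst_smul (a : ℂ) (y : 𝔩) : cst d (a • y) = a • cst d y := const_smul _ _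

theorem cst_sum {ι : Type*} (s : Finset ι) (y : ι → 𝔩) :
    cst d (∑ i ∈ s, y i) = ∑ i ∈ s, cst d (y i) := by
  rw [cst, ← const_sum]; simp

theorem sum_repr_smul_cst (y : 𝔩) : ∑ k, b.repr y k • cst d (b k) = cst d y := by
  simp only [← cst_smul, ← cst_sum, b.sum_repr]

theorem br_cst [FiniteDimensional ℂ 𝔤] (y z : 𝔩) : br (cst d y) (cst d z) = cst d ⁅y, z⁆ := by
  simp [cst]

/-- Evaluation of the first leg is linear over power series and sends a constant leg z to
multiplication by λ(z); here z = [x_i, x_j]. -/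
theorem tau_eq [FiniteDimensional ℂ 𝔤] (η : Fin d → FormalFun d 𝔤) :
    tau b η = ∑ i, ∑ j, linFun b ⁅b i, b j⁆ • tens (η i) (η j) := by
  have : FiniteDimensional ℂ 𝔩 := b.finiteDimensional_of_finite
  have hbar : bar b η = ∑ i, tens (const (b i)) (η i) := by
    simp only [bar, bilin_const_left, lin_apply]
  let E : FormalFun d (𝔩 ⊗[ℂ] (𝔤 ⊗[ℂ] 𝔤)) →ₗ[MvPowerSeries (Fin d) ℂ] FormalFun d (𝔤 ⊗[ℂ] 𝔤) :=
    ∑ k, (MvPowerSeries.X k : MvPowerSeries (Fin d) ℂ) •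
      lin d ((TensorProduct.lid ℂ _).toLinearMap ∘ₗ LinearMap.rTensor (𝔤 ⊗[ℂ] 𝔤) (b.coord k))
  have hev (f : FormalFun d (𝔩 ⊗[ℂ] (𝔤 ⊗[ℂ] 𝔤))) : evalFirst b f = E f := by
    simp only [evalFirst, mulX_eq_smul, E, LinearMap.sum_apply, LinearMap.smul_apply, lin_apply]
  have hm : map₂ (bracket12_13 𝔩 𝔤) (bar b η) (bar b η)
      = bilin d (bracket12_13 𝔩 𝔤) (bar b η) (bar b η) := rfl
  have hE (z : 𝔩) (w : FormalFun d (𝔤 ⊗[ℂ] 𝔤)) : E (tens (const z) w) = linFun b z • w := by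
    have hz (k : Fin d) : lin d ((TensorProduct.lid ℂ _).toLinearMap ∘ₗ
        LinearMap.rTensor (𝔤 ⊗[ℂ] 𝔤) (b.coord k)) (tens (const z) w) = b.repr z k • w := by
      rw [bilin_const_left]
      funext n
      simp [lin_apply, map]
    simp only [E, LinearMap.sum_apply, LinearMap.smul_apply, hz, linFun,
      Module.Basis.constr_apply_fintype, Finset.sum_smul, Module.Basis.equivFun_apply]
    refine Finset.sum_congr rfl fun k _ => ?_
    rw [smul_assoc, smul_comm]
  rw [tau, hm, hbar, hev]
  simp only [map_sum, LinearMap.sum_apply, bracket12_13_tens, bilin_const,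
    LieHom.coe_toLinearMap, LieModule.toEnd_apply_apply, hE]
  rw [Finset.sum_comm]

/-- The adjoint action of a formal map to a group and its logarithmic derivative: a formal family
`A` of automorphisms of `𝔤` with inverse `B`, and a flat connection `η` with `dA = A ∘ ad η`, such
that `η` contracts with the coadjoint vector field of `y` to `B y - y`. -/
structure GaugeData (A B : FormalFun d (𝔤 →ₗ[ℂ] 𝔤)) (η : Fin d → FormalFun d 𝔤) : Prop where
  left_inv : ∀ u, app B (app A u) = u
  right_inv : ∀ u, app A (app B u) = u
  app_br : ∀ u v, app A (br u v) = br (app A u) (app A v)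
  pderiv_app : ∀ i u, pderiv i (app A u) = app A (pderiv i u + br (η i) u)
  flat : ∀ i j, pderiv i (η j) - pderiv j (η i) + br (η i) (η j) = 0
  contract : ∀ y : 𝔩, contractCoad b y η = app B (cst d y) - cst d y

end LinearFunctions

/-! ### The function σ and its derivatives. -/

section Sigma

variable {𝔤 : Type*} [LieRing 𝔤] [LieAlgebra ℂ 𝔤] {𝔩 : LieSubalgebra ℂ 𝔤} {d : ℕ}
  {b : Module.Basis (Fin d) ℂ 𝔩} {A B : FormalFun d (𝔤 →ₗ[ℂ] 𝔤)} {η : Fin d → FormalFun d 𝔤}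

/-- The function `η̄ - η̄ ^ 21 + τ`. -/
def sigma (b : Module.Basis (Fin d) ℂ 𝔩) (η : Fin d → FormalFun d 𝔤) : FormalFun d (𝔤 ⊗[ℂ] 𝔤) :=
  ∑ i, tens (cst d (b i)) (η i) - ∑ i, tens (η i) (cst d (b i)) + tau b η

/-- The function `d̄s = ∑ k, x_k ⊗ ∂_k s`. -/
def dbar (b : Module.Basis (Fin d) ℂ 𝔩) (s : FormalFun d (𝔤 ⊗[ℂ] 𝔤)) :
    FormalFun d (𝔤 ⊗[ℂ] (𝔤 ⊗[ℂ] 𝔤)) :=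
  ∑ k, tens (cst d (b k)) (pderiv k s)

variable [FiniteDimensional ℂ 𝔤]

namespace GaugeData

variable (h : GaugeData b A B η)
include h

theorem app_inv_br (u v : FormalFun d 𝔤) : app B (br u v) = br (app B u) (app B v) := by
  rw [← h.left_inv (br (app B u) (app B v)), h.app_br, h.right_inv, h.right_inv]

/-- This is dA = A ∘ ad η applied to A(Bu) = u. -/
theorem pderiv_app_inv (i : Fin d) (u : FormalFun d 𝔤) :
    pderiv i (app B u) = app B (pderiv i u) - br (η i) (app B u) := by
  have h1 := h.pderiv_app i (app B u)
  rw [h.right_inv] at h1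
  rw [h1, h.left_inv, add_sub_cancel_right]

theorem pderiv_app_inv_cst (i : Fin d) (y : 𝔩) :
    pderiv i (app B (cst d y)) = - br (η i) (app B (cst d y)) := by
  rw [h.pderiv_app_inv, pderiv_const, map_zero, zero_sub]

theorem br_app_inv_cst (y z : 𝔩) :
    br (app B (cst d y)) (app B (cst d z)) = app B (cst d ⁅y, z⁆) := by
  rw [← h.app_inv_br, br_cst]

/-- The form in which equivariance of g is used: it collapses one summation whenever λ([x_i, y]) is
paired with η_i. -/
theorem sum_linFun_smul (y : 𝔩) :
    ∑ i, linFun b ⁅b i, y⁆ • η i = app B (cst d y) - cst d y := by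
  rw [← contractCoad_eq, h.contract]

theorem sum_linFun_smul' (y : 𝔩) :
    ∑ i, linFun b ⁅y, b i⁆ • η i = cst d y - app B (cst d y) := by
  rw [← neg_sub, ← h.sum_linFun_smul, ← Finset.sum_neg_distrib]
  refine Finset.sum_congr rfl fun i _ => ?_
  rw [← lie_skew, map_neg, neg_smul]

/-- Differentiating the contraction identity also differentiates the linear coefficients, which
contributes the structure constants of 𝔩. -/
theorem sum_linFun_smul_pderiv (y : 𝔩) (k : Fin d) :
    ∑ i, linFun b ⁅b i, y⁆ • pderiv k (η i)
      = -br (η k) (app B (cst d y)) - ∑ i, b.repr ⁅b i, y⁆ k • η i := by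
  have h1 := congrArg (pderiv k) (h.sum_linFun_smul y)
  simp only [pderiv_sum, pderiv_linFun_smul, Finset.sum_add_distrib, pderiv_sub, pderiv_const,
    sub_zero] at h1
  rw [h.pderiv_app_inv_cst] at h1
  rw [← h1, add_sub_cancel_right]

theorem sum_linFun_smul_pderiv' (y : 𝔩) (k : Fin d) :
    ∑ i, linFun b ⁅y, b i⁆ • pderiv k (η i)
      = br (η k) (app B (cst d y)) - ∑ i, b.repr ⁅y, b i⁆ k • η i := by
  have (i : Fin d) : ⁅y, b i⁆ = - ⁅b i, y⁆ := (lie_skew _ _).symm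
  simp only [this, map_neg, neg_smul, Finset.sum_neg_distrib, h.sum_linFun_smul_pderiv,
    Finsupp.neg_apply]
  abel

/-- Here τ is contracted over its first index; `sigma_eq'` contracts over the second. -/
theorem sigma_eq : sigma b η =
    ∑ j, (tens (app B (cst d (b j))) (η j) - tens (η j) (cst d (b j))) := by
  rw [sigma, tau_eq, Finset.sum_comm]
  simp only [smul_bilin, sum_bilin,
    h.sum_linFun_smul]
  rw [Finset.sum_sub_distrib]
  simp only [map_sub, LinearMap.sub_apply, Finset.sum_sub_distrib]
  abel

theorem sigma_eq' : sigma b η =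
    ∑ j, (tens (cst d (b j)) (η j) - tens (η j) (app B (cst d (b j)))) := by
  rw [sigma, tau_eq]
  simp only [← map_smul, ← map_sum, h.sum_linFun_smul']
  rw [Finset.sum_sub_distrib]
  simp only [map_sub, Finset.sum_sub_distrib]
  abel

/-- The flip exchanges the two closed forms of σ up to sign. -/
theorem flip_sigma : lin d (flip 𝔤) (sigma b η) = -sigma b η := by
  rw [h.sigma_eq, map_sum]
  simp only [map_sub, flip_tens]
  rw [← h.sigma_eq, h.sigma_eq', ← Finset.sum_neg_distrib]
  simp

/-- The structure-constant sum appears three times in the derivative of τ: once positively from the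
coefficients λ([x_i, x_j]), and once negatively from each of the factors η_i and η_j. One negative
copy survives. -/
theorem pderiv_sigma (k : Fin d) : pderiv k (sigma b η) =
    ∑ j, (tens (cst d (b j)) (pderiv k (η j)) - tens (pderiv k (η j)) (cst d (b j))
      - tens (br (η k) (app B (cst d (b j)))) (η j) + tens (η j) (br (η k) (app B (cst d (b j)))))
    - ∑ i, ∑ j, b.repr ⁅b i, b j⁆ k • tens (η i) (η j) := by
  have h1 : ∑ i, ∑ j, linFun b ⁅b i, b j⁆ • tens (pderiv k (η i)) (η j)
      = -∑ j, tens (br (η k) (app B (cst d (b j)))) (η j)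
        - ∑ i, ∑ j, b.repr ⁅b i, b j⁆ k • tens (η i) (η j) := by
    rw [Finset.sum_comm]
    simp only [smul_bilin, sum_bilin,
      h.sum_linFun_smul_pderiv]
    simp only [map_sub, map_neg, LinearMap.sub_apply, LinearMap.neg_apply, Finset.sum_sub_distrib,
      Finset.sum_neg_distrib, map_sum, LinearMap.sum_apply]
    congr 1
    rw [Finset.sum_comm]
    simp only [LinearMap.map_smul_of_tower, LinearMap.smul_apply]
  have h2 : ∑ i, ∑ j, linFun b ⁅b i, b j⁆ • tens (η i) (pderiv k (η j))
      = ∑ j, tens (η j) (br (η k) (app B (cst d (b j))))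
        - ∑ i, ∑ j, b.repr ⁅b i, b j⁆ k • tens (η i) (η j) := by
    simp only [← map_smul, ← map_sum, h.sum_linFun_smul_pderiv']
    simp only [map_sub, Finset.sum_sub_distrib, map_sum, LinearMap.map_smul_of_tower]
  rw [sigma, tau_eq]
  simp only [pderiv_add, pderiv_sub, pderiv_sum, pderiv_bilin, pderiv_linFun_smul, smul_add,
    Finset.sum_add_distrib, Finset.sum_sub_distrib, h1, h2, pderiv_const, map_zero,
    LinearMap.zero_apply, zero_add, add_zero, Finset.sum_const_zero]
  abel

end GaugeData

end Sigma

/-! ### Expansion of both Yang-Baxter terms for arbitrary families. -/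

section Families

variable {𝔤 : Type*} [LieRing 𝔤] [LieAlgebra ℂ 𝔤] [FiniteDimensional ℂ 𝔤] {d : ℕ}

/-- The tensor product of three formal functions. -/
abbrev tens₃ (u v w : FormalFun d 𝔤) : FormalFun d (𝔤 ⊗[ℂ] (𝔤 ⊗[ℂ] 𝔤)) := tens u (tens v w)

/-- Bookkeeping for Alt(d̄σ): the families stand for X_j = x_j, H_kj = ∂_k η_j, Q_kj = [η_k, Bx_j],
f the structure constants and Z_ij = [x_i, x_j]. -/
theorem alt_sum_tens (X η : Fin d → FormalFun d 𝔤) (H Q : Fin d → Fin d → FormalFun d 𝔤)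
    (f : Fin d → Fin d → Fin d → ℂ) (Z : Fin d → Fin d → FormalFun d 𝔤)
    (hZ : ∀ i j, ∑ k, f i j k • X k = Z i j) :
    lin d (Alt 𝔤) (∑ k, tens (X k) (∑ j, (tens (X j) (H k j) - tens (H k j) (X j)
      - tens (Q k j) (η j) + tens (η j) (Q k j)) - ∑ i, ∑ j, f i j k • tens (η i) (η j))) =
    ∑ k, ∑ j, ((tens₃ (X k) (X j) (H k j) - tens₃ (X j) (X k) (H k j) + tens₃ (X j) (H k j) (X k))
        - (tens₃ (X k) (H k j) (X j) - tens₃ (H k j) (X k) (X j) + tens₃ (H k j) (X j) (X k))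
        - (tens₃ (X k) (Q k j) (η j) - tens₃ (Q k j) (X k) (η j) + tens₃ (Q k j) (η j) (X k))
        + (tens₃ (X k) (η j) (Q k j) - tens₃ (η j) (X k) (Q k j) + tens₃ (η j) (Q k j) (X k)))
      - ∑ i, ∑ j, (tens₃ (Z i j) (η i) (η j) - tens₃ (η i) (Z i j) (η j)
          + tens₃ (η i) (η j) (Z i j)) := by
  have h1 : ∑ k, tens (X k) (∑ i, ∑ j, f i j k • tens (η i) (η j))
      = ∑ i, ∑ j, tens₃ (Z i j) (η i) (η j) := by
    simp only [tens₃, map_sum, ← hZ, LinearMap.sum_apply, LinearMap.map_smul_of_tower,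
      LinearMap.smul_apply]
    rw [Finset.sum_comm]
    refine Finset.sum_congr rfl fun i _ => ?_
    rw [Finset.sum_comm]
  simp only [map_sub (tens (X _)), Finset.sum_sub_distrib]
  rw [h1]
  simp only [map_sum, map_sub, map_add, alt_tens, Finset.sum_sub_distrib, Finset.sum_add_distrib]

/-- Here X_j = x_j and Y_j = Bx_j, and the hypothesis equates the two closed forms of σ. -/
theorem cyb_sum_tens (X Y η : Fin d → FormalFun d 𝔤)
    (h : ∑ j, (tens (Y j) (η j) - tens (η j) (X j)) = ∑ j, (tens (X j) (η j) - tens (η j) (Y j))) :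
    cybBilin (∑ j, (tens (Y j) (η j) - tens (η j) (X j)))
        (∑ j, (tens (Y j) (η j) - tens (η j) (X j))) =
      ∑ j, ∑ i, ((tens₃ (br (Y i) (Y j)) (η i) (η j) - tens₃ (br (Y i) (η j)) (η i) (X j)
          - (tens₃ (br (η i) (Y j)) (X i) (η j) - tens₃ (br (η i) (η j)) (X i) (X j)))
        + (tens₃ (X i) (br (η i) (Y j)) (η j) - tens₃ (X i) (br (η i) (η j)) (X j)
          - (tens₃ (η i) (br (Y i) (Y j)) (η j) - tens₃ (η i) (br (Y i) (η j)) (X j)))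
        + (tens₃ (X i) (X j) (br (η i) (η j)) - tens₃ (X i) (η j) (br (η i) (Y j))
          - (tens₃ (η i) (X j) (br (Y i) (η j)) - tens₃ (η i) (η j) (br (Y i) (Y j))))) := by
  rw [cybBilin]
  -- The closed form is chosen leg by leg so that only Y and η enter brackets, never X: the first
  -- form twice in the 12-13 term, second then first in the 12-23 term, the second twice in the
  -- 13-23 term. Brackets of Y and η are those that the gauge data control.
  conv_lhs =>
    congr
    · congr
      · skip
      · rw [LinearMap.congr_arg (f := bilin d (bracket12_23 𝔤)) h]
    · rw [h]
  simp only [map_sum, map_sub, LinearMap.sum_apply, LinearMap.sub_apply, bracket12_13_tens,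
    bracket12_23_tens, bracket13_23_tens, Finset.sum_sub_distrib, Finset.sum_add_distrib, tens₃]
  abel

end Families

/-! ### The dynamical Yang-Baxter equation for σ. -/

section Sigma

variable {𝔤 : Type*} [LieRing 𝔤] [LieAlgebra ℂ 𝔤] [FiniteDimensional ℂ 𝔤]
  {𝔩 : LieSubalgebra ℂ 𝔤} {d : ℕ}
  {b : Module.Basis (Fin d) ℂ 𝔩} {A B : FormalFun d (𝔤 →ₗ[ℂ] 𝔤)} {η : Fin d → FormalFun d 𝔤}

/-- After relabelling, all three sums carry t(η_i, η_j, η_k), and the total coefficient is λ of a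
Jacobi sum. In the application Z_ij = B[x_i, x_j] - [x_i, x_j]. -/
theorem sum_linFun_jacobi {M : Type*} [AddCommGroup M] [Module (MvPowerSeries (Fin d) ℂ) M]
    (η : Fin d → M)
    (t : M →ₗ[MvPowerSeries (Fin d) ℂ] M →ₗ[MvPowerSeries (Fin d) ℂ] M →ₗ[MvPowerSeries (Fin d) ℂ]
      FormalFun d (𝔤 ⊗[ℂ] (𝔤 ⊗[ℂ] 𝔤)))
    (Z : Fin d → Fin d → M) (hZ : ∀ i j, Z i j = ∑ l, linFun b ⁅b l, ⁅b i, b j⁆⁆ • η l) :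
    ∑ i, ∑ j, (t (Z i j) (η i) (η j) - t (η i) (Z i j) (η j) + t (η i) (η j) (Z i j)) = 0 := by
  have h1 : ∑ i, ∑ j, t (Z i j) (η i) (η j)
      = ∑ i, ∑ j, ∑ k, linFun b ⁅b i, ⁅b j, b k⁆⁆ • t (η i) (η j) (η k) := by
    simp only [hZ, map_sum, map_smul, LinearMap.sum_apply, LinearMap.smul_apply]
    rw [Finset.sum_congr rfl fun i _ => Finset.sum_comm, Finset.sum_comm]
  have h2 : ∑ i, ∑ j, t (η i) (Z i j) (η j)
      = ∑ i, ∑ j, ∑ k, linFun b ⁅b j, ⁅b i, b k⁆⁆ • t (η i) (η j) (η k) := by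
    simp only [hZ, map_sum, map_smul, LinearMap.sum_apply, LinearMap.smul_apply]
    exact Finset.sum_congr rfl fun i _ => Finset.sum_comm
  have h3 : ∑ i, ∑ j, t (η i) (η j) (Z i j)
      = ∑ i, ∑ j, ∑ k, linFun b ⁅b k, ⁅b i, b j⁆⁆ • t (η i) (η j) (η k) := by
    simp only [hZ, map_sum, map_smul]
  simp only [Finset.sum_add_distrib, Finset.sum_sub_distrib, h1, h2, h3]
  simp only [← Finset.sum_add_distrib, ← Finset.sum_sub_distrib, ← sub_smul, ← add_smul,
    ← map_sub, ← map_add]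
  refine Finset.sum_eq_zero fun i _ => Finset.sum_eq_zero fun j _ => Finset.sum_eq_zero fun k _ => ?_
  have : ⁅b i, ⁅b j, b k⁆⁆ - ⁅b j, ⁅b i, b k⁆⁆ + ⁅b k, ⁅b i, b j⁆⁆ = 0 := by
    rw [leibniz_lie (b i) (b j) (b k), ← lie_skew (b k) ⁅b i, b j⁆]
    abel
  rw [this, map_zero, zero_smul]

namespace GaugeData

variable (h : GaugeData b A B η)
include h

/-- The terms in [η, Bx] cancel between the two expansions. Flatness turns [η_i, η_j] into
derivatives of η, which cancel those in d̄σ. The remaining terms contain B[x_i, x_j] or [x_i, x_j]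
next to two factors η, and form the Jacobi sum. -/
theorem cdybe_sigma : lin d (Alt 𝔤) (dbar b (sigma b η)) + cybBilin (sigma b η) (sigma b η) = 0 := by
  have e1 := alt_sum_tens (fun j => cst d (b j)) η (fun k j => pderiv k (η j))
      (fun k j => br (η k) (app B (cst d (b j)))) (fun i j k => b.repr ⁅b i, b j⁆ k)
      (fun i j => cst d ⁅b i, b j⁆) (fun i j => sum_repr_smul_cst b _)
  have e2 := cyb_sum_tens (fun j => cst d (b j)) (fun j => app B (cst d (b j))) η
    (by rw [← h.sigma_eq, ← h.sigma_eq'])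
  rw [← h.sigma_eq] at e2
  simp only [← h.pderiv_sigma] at e1
  rw [dbar, e1, e2]
  have e3 := sum_linFun_jacobi (b := b) η
    (LinearMap.mk₂ _ (fun u v => (tens u : _ →ₗ[MvPowerSeries (Fin d) ℂ] _) ∘ₗ tens v)
      (by intros; ext1; simp) (by intros; ext1; simp) (by intros; ext1; simp)
      (by intros; ext1; simp)) (fun i j => app B (cst d ⁅b i, b j⁆) - cst d ⁅b i, b j⁆)
      (fun i j => (h.sum_linFun_smul _).symm)
  simp only [LinearMap.mk₂_apply, LinearMap.comp_apply] at e3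
  have hf (i j : Fin d) : br (η i) (η j) = pderiv j (η i) - pderiv i (η j) := by
    rw [← sub_eq_zero, ← h.flat i j]; abel
  simp only [h.br_app_inv_cst, hf, br_skew (app B _) (η _)]
  simp only [tens₃, map_sub, map_neg, LinearMap.sub_apply, LinearMap.neg_apply,
    Finset.sum_sub_distrib, Finset.sum_add_distrib, Finset.sum_neg_distrib] at e3 ⊢
  -- The remaining double sums agree only up to exchanging the summation indices; one order is fixed
  -- for each before cancelling.
  have sw (T : Fin d → Fin d → FormalFun d (𝔤 ⊗[ℂ] (𝔤 ⊗[ℂ] 𝔤))) :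
      ∑ x, ∑ y, T y x = ∑ x, ∑ y, T x y := Finset.sum_comm
  have s1 := sw fun i j => tens (app B (cst d ⁅b i, b j⁆)) (tens (η i) (η j))
  have s2 := sw fun i j => tens (η i) (tens (app B (cst d ⁅b i, b j⁆)) (η j))
  have s3 := sw fun i j => tens (η i) (tens (η j) (app B (cst d ⁅b i, b j⁆)))
  have s4 := sw fun i j => tens (br (η i) (app B (cst d (b j)))) (tens (cst d (b i)) (η j))
  have s5 := sw fun i j => tens (cst d (b i)) (tens (br (η i) (app B (cst d (b j)))) (η j))
  have s6 := sw fun i j => tens (cst d (b i)) (tens (η j) (br (η i) (app B (cst d (b j)))))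
  have s7 := sw fun i j => tens (pderiv i (η j)) (tens (cst d (b i)) (cst d (b j)))
  have s8 := sw fun i j => tens (cst d (b i)) (tens (pderiv i (η j)) (cst d (b j)))
  have s9 := sw fun i j => tens (cst d (b i)) (tens (cst d (b j)) (pderiv i (η j)))
  simp only [s1, s2, s3, s4, s5, s6, s7, s8, s9]
  rw [← e3]
  abel

end GaugeData
end Sigma

/-! ### The derivative along coadjoint vector fields. -/

section CoadjointDerivative

variable {𝔤 : Type*} [LieRing 𝔤] [LieAlgebra ℂ 𝔤] {𝔩 : LieSubalgebra ℂ 𝔤} {d : ℕ}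
  (b : Module.Basis (Fin d) ℂ 𝔩) {U V W : Type*} [AddCommGroup U] [Module ℂ U] [AddCommGroup V]
  [Module ℂ V] [AddCommGroup W] [Module ℂ W]

/-- The partial derivative of a formal power series. -/
def powerSeriesDeriv (i : Fin d) (c : MvPowerSeries (Fin d) ℂ) : MvPowerSeries (Fin d) ℂ :=
  pderiv i (show FormalFun d ℂ from c)

theorem pderiv_powerSeries_smul (i : Fin d) (c : MvPowerSeries (Fin d) ℂ)
    (f : FormalFun d V) :
    pderiv i (c • f) = powerSeriesDeriv i c • f + c • pderiv i f := by
  rw [smul_eq_map₂, pderiv_map₂]; rfl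

/-- The derivative along the coadjoint vector field of `y`. -/
def coadDeriv (y : 𝔩) (f : FormalFun d V) : FormalFun d V := contractCoad b y (differential f)

theorem coadDeriv_eq (y : 𝔩) (f : FormalFun d V) :
    coadDeriv b y f = ∑ i, linFun b ⁅b i, y⁆ • pderiv i f :=
  contractCoad_eq b y _

theorem coadDeriv_sub (y : 𝔩) (f g : FormalFun d V) :
    coadDeriv b y (f - g) = coadDeriv b y f - coadDeriv b y g := by
  simp only [coadDeriv_eq, pderiv_sub, smul_sub, Finset.sum_sub_distrib]

theorem coadDeriv_sum {ι : Type*} (s : Finset ι) (y : 𝔩) (f : ι → FormalFun d V) :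
    coadDeriv b y (∑ j ∈ s, f j) = ∑ j ∈ s, coadDeriv b y (f j) := by
  simp only [coadDeriv_eq, pderiv_sum, Finset.smul_sum]
  exact Finset.sum_comm

theorem coadDeriv_const (y : 𝔩) (v : V) : coadDeriv b y (const v : FormalFun d V) = 0 := by
  simp [coadDeriv_eq]

theorem coadDeriv_bilin (y : 𝔩) (β : U →ₗ[ℂ] V →ₗ[ℂ] W) (f : FormalFun d U) (g : FormalFun d V) :
    coadDeriv b y (bilin d β f g) =
      bilin d β (coadDeriv b y f) g + bilin d β f (coadDeriv b y g) := by
  simp only [coadDeriv_eq, pderiv_bilin, smul_add, Finset.sum_add_distrib, map_sum, map_smul,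
    LinearMap.sum_apply, LinearMap.smul_apply]

theorem isEquivariant_iff (f : FormalFun d (𝔤 ⊗[ℂ] 𝔤)) :
    IsEquivariant b f ↔ ∀ y : 𝔩, coadDeriv b y f = act (cst d y) f := by
  refine forall_congr' fun y => ?_
  rw [bilin_const_left]
  rfl

end CoadjointDerivative

/-! ### Transfer of the three axioms under a gauge transformation. -/

section Gauge

variable {𝔤 : Type*} [LieRing 𝔤] [LieAlgebra ℂ 𝔤] [FiniteDimensional ℂ 𝔤]
  {𝔩 : LieSubalgebra ℂ 𝔤} {d : ℕ}
  {b : Module.Basis (Fin d) ℂ 𝔩} {A B : FormalFun d (𝔤 →ₗ[ℂ] 𝔤)} {η : Fin d → FormalFun d 𝔤}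

/-- The diagonal action on the tensor square. -/
abbrev app₂ (A : FormalFun d (𝔤 →ₗ[ℂ] 𝔤)) :
    FormalFun d (𝔤 ⊗[ℂ] 𝔤) →ₗ[MvPowerSeries (Fin d) ℂ] FormalFun d (𝔤 ⊗[ℂ] 𝔤) :=
  app (tensHom A A)

/-- The diagonal action on the tensor cube. -/
abbrev app₃ (A : FormalFun d (𝔤 →ₗ[ℂ] 𝔤)) :
    FormalFun d (𝔤 ⊗[ℂ] (𝔤 ⊗[ℂ] 𝔤)) →ₗ[MvPowerSeries (Fin d) ℂ]
      FormalFun d (𝔤 ⊗[ℂ] (𝔤 ⊗[ℂ] 𝔤)) :=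
  app (tensHom A (tensHom A A))

theorem app₂_flip (s : FormalFun d (𝔤 ⊗[ℂ] 𝔤)) :
    app₂ A (lin d (flip 𝔤) s) = lin d (flip 𝔤) (app₂ A s) := by
  induction s using FormalFun.tens_induction with
  | add f g hf hg => simp only [map_add, hf, hg]
  | smul c f hf => simp only [map_smul, hf]
  | tens u v => simp only [flip_tens, app_tensHom]

theorem app₃_alt (p : FormalFun d (𝔤 ⊗[ℂ] (𝔤 ⊗[ℂ] 𝔤))) :
    app₃ A (lin d (Alt 𝔤) p) = lin d (Alt 𝔤) (app₃ A p) := by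
  induction p using FormalFun.tens_induction with
  | add f g hf hg => simp only [map_add, hf, hg]
  | smul c f hf => simp only [map_smul, hf]
  | tens u q =>
  induction q using FormalFun.tens_induction with
  | add f g hf hg => simp only [map_add, hf, hg]
  | smul c f hf => simp only [map_smul, hf]
  | tens v w => simp only [alt_tens, app_tensHom, map_add, map_sub]

namespace GaugeData

variable (h : GaugeData b A B η)
include h

/-- Contracting d(Bz) = -[η, Bz] with ξ_y gives -[By - y, Bz], and B preserves brackets. -/
theorem coadDeriv_app_inv_cst (y z : 𝔩) :
    coadDeriv b y (app B (cst d z)) = br (cst d y) (app B (cst d z)) - app B (cst d ⁅y, z⁆) := by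
  rw [coadDeriv_eq]
  simp only [h.pderiv_app_inv_cst, smul_neg, Finset.sum_neg_distrib, smul_bilin,
    sum_bilin]
  rw [h.sum_linFun_smul, map_sub, LinearMap.sub_apply,
    h.br_app_inv_cst]
  abel

/-- A form of Cartan's formula: flatness trades ∂_i η_j for ∂_j η_i, whose contraction is known, and
the two brackets of By with η_j cancel. -/
theorem coadDeriv_eta (y : 𝔩) (j : Fin d) :
    coadDeriv b y (η j) = br (cst d y) (η j) - ∑ i, b.repr ⁅b i, y⁆ j • η i := by
  have hf (i : Fin d) : pderiv i (η j) = pderiv j (η i) - br (η i) (η j) := by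
    rw [← sub_eq_zero, ← h.flat i j]; abel
  rw [coadDeriv_eq]
  simp only [hf, smul_sub, Finset.sum_sub_distrib, h.sum_linFun_smul_pderiv,
    smul_bilin, sum_bilin]
  rw [h.sum_linFun_smul, map_sub, LinearMap.sub_apply,
    br_skew (η j)]
  abel

theorem sum_repr_smul_app_inv_cst (y : 𝔩) :
    ∑ k, b.repr y k • app B (cst d (b k)) = app B (cst d y) := by
  simp only [← LinearMap.map_smul_of_tower, ← map_sum, sum_repr_smul_cst]

theorem coadDeriv_sigma (y : 𝔩) : coadDeriv b y (sigma b η) = act (cst d y) (sigma b η) := by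
  -- The x_j and the components η_j transform by dual matrices; moving the matrix of ad y from one
  -- tensor factor to the other makes the two contributions cancel.
  have key (Z : 𝔩 → FormalFun d 𝔤) (hZ : ∀ y, ∑ k, b.repr y k • Z (b k) = Z y) :
      ∑ j, tens (Z (b j)) (∑ i, b.repr ⁅b i, y⁆ j • η i) = ∑ j, tens (Z ⁅b j, y⁆) (η j) := by
    simp only [← hZ ⁅b _, y⁆, map_sum, LinearMap.sum_apply, LinearMap.map_smul_of_tower,
      LinearMap.smul_apply]
    exact Finset.sum_comm
  have key' (Z : 𝔩 → FormalFun d 𝔤) (hZ : ∀ y, ∑ k, b.repr y k • Z (b k) = Z y) :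
      ∑ j, tens (∑ i, b.repr ⁅b i, y⁆ j • η i) (Z (b j)) = ∑ j, tens (η j) (Z ⁅b j, y⁆) := by
    simp only [← hZ ⁅b _, y⁆, map_sum, LinearMap.sum_apply, LinearMap.map_smul_of_tower,
      LinearMap.smul_apply]
    exact Finset.sum_comm
  have k1 := key (fun y => app B (cst d y)) h.sum_repr_smul_app_inv_cst
  have k2 := key' (fun y => cst d y) (sum_repr_smul_cst b)
  have hn (j : Fin d) : cst d ⁅b j, y⁆ = -cst d ⁅y, b j⁆ := by
    rw [← lie_skew, cst, NegMemClass.coe_neg, const_neg]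
  have hX (j : Fin d) : br (cst d y) (cst d (b j)) = -cst d ⁅b j, y⁆ := by
    rw [br_cst, hn, neg_neg]
  have hn' (j : Fin d) : cst d ⁅y, b j⁆ = -cst d ⁅b j, y⁆ := by rw [hn, neg_neg]
  rw [h.sigma_eq]
  simp only [coadDeriv_sum, coadDeriv_sub, coadDeriv_bilin, h.coadDeriv_app_inv_cst,
    coadDeriv_const, h.coadDeriv_eta, map_zero, add_zero, map_sub, LinearMap.sub_apply,
    act_tens, map_sum (act _), hX, hn', map_neg, LinearMap.neg_apply, Finset.sum_sub_distrib,
    Finset.sum_add_distrib, Finset.sum_neg_distrib]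
  rw [k1, k2]
  abel

theorem app₂_inv (s : FormalFun d (𝔤 ⊗[ℂ] 𝔤)) : app₂ B (app₂ A s) = s := by
  induction s using FormalFun.tens_induction with
  | add f g hf hg => simp only [map_add, hf, hg]
  | smul c f hf => simp only [map_smul, hf]
  | tens u v => simp only [app_tensHom, h.left_inv]

theorem app₃_inv (p : FormalFun d (𝔤 ⊗[ℂ] (𝔤 ⊗[ℂ] 𝔤))) : app₃ B (app₃ A p) = p := by
  induction p using FormalFun.tens_induction with
  | add f g hf hg => simp only [map_add, hf, hg]
  | smul c f hf => simp only [map_smul, hf]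
  | tens u q =>
  induction q using FormalFun.tens_induction with
  | add f g hf hg => simp only [map_add, hf, hg]
  | smul c f hf => simp only [map_smul, hf]
  | tens v w => simp only [app_tensHom, h.left_inv]

theorem app₂_act (u : FormalFun d 𝔤) (s : FormalFun d (𝔤 ⊗[ℂ] 𝔤)) :
    app₂ A (act u s) = act (app A u) (app₂ A s) := by
  induction s using FormalFun.tens_induction with
  | add f g hf hg => simp only [map_add, hf, hg]
  | smul c f hf => simp only [map_smul, hf]
  | tens u v => simp only [app_tensHom, act_tens, map_add, h.app_br]

theorem app₃_cybBilin (p q : FormalFun d (𝔤 ⊗[ℂ] 𝔤)) :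
    app₃ A (cybBilin p q) = cybBilin (app₂ A p) (app₂ A q) := by
  induction p using FormalFun.tens_induction with
  | add f g hf hg =>
    simp only [cybBilin, map_add, LinearMap.add_apply] at hf hg ⊢
    refine Eq.trans (Eq.trans ?_ (congrArg₂ (· + ·) hf hg)) ?_ <;> abel
  | smul c f hf =>
    simp only [cybBilin, map_smul, LinearMap.smul_apply, ← smul_add] at hf ⊢
    rw [hf]
  | tens u v =>
  induction q using FormalFun.tens_induction with
  | add f g hf hg =>
    simp only [cybBilin, map_add, LinearMap.add_apply] at hf hg ⊢
    refine Eq.trans (Eq.trans ?_ (congrArg₂ (· + ·) hf hg)) ?_ <;> abel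
  | smul c f hf =>
    simp only [cybBilin, map_smul, LinearMap.smul_apply, ← smul_add] at hf ⊢
    rw [hf]
  | tens w z =>
    simp only [cybBilin, bracket12_13_tens, bracket12_23_tens, bracket13_23_tens, app_tensHom,
      map_add, h.app_br]

theorem pderiv_app₂ (i : Fin d) (s : FormalFun d (𝔤 ⊗[ℂ] 𝔤)) :
    pderiv i (app₂ A s) = app₂ A (pderiv i s + act (η i) s) := by
  induction s using FormalFun.tens_induction with
  | add f g hf hg => simp only [map_add, pderiv_add, hf, hg]; abel
  | smul c f hf =>
    simp only [map_smul, pderiv_powerSeries_smul, hf, map_add, smul_add]; abel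
  | tens u v =>
    simp only [app_tensHom, act_tens, map_add, h.pderiv_app, pderiv_bilin, LinearMap.add_apply]
    abel

/-- The connection term contracts to the action of By - y, and A ⊗ A intertwines the action of By
with that of y. Thus the equivariance defect of the image is the image of the defect. -/
theorem coadDeriv_app₂ (y : 𝔩) (s : FormalFun d (𝔤 ⊗[ℂ] 𝔤)) :
    coadDeriv b y (app₂ A s) =
      act (cst d y) (app₂ A s) + app₂ A (coadDeriv b y s - act (cst d y) s) := by
  rw [coadDeriv_eq, coadDeriv_eq]
  simp only [h.pderiv_app₂, ← map_smul (app₂ A), ← map_sum (app₂ A), smul_add, Finset.sum_add_distrib]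
  simp only [smul_bilin, sum_bilin]
  rw [h.sum_linFun_smul, map_sub, LinearMap.sub_apply,
    map_add, map_sub, h.app₂_act, h.right_inv, map_sub]
  abel

theorem isEquivariant_app₂_iff (s : FormalFun d (𝔤 ⊗[ℂ] 𝔤)) :
    IsEquivariant b (app₂ A s) ↔ IsEquivariant b s := by
  rw [isEquivariant_iff, isEquivariant_iff]
  refine forall_congr' fun y => ?_
  rw [h.coadDeriv_app₂, add_eq_left]
  constructor
  · intro h1
    have h2 := h.app₂_inv (coadDeriv b y s - act (cst d y) s)
    rw [h1, map_zero] at h2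
    exact sub_eq_zero.1 h2.symm
  · intro h1
    rw [h1, sub_self, map_zero]

theorem isEquivariant_sub_sigma_iff (r : FormalFun d (𝔤 ⊗[ℂ] 𝔤)) :
    IsEquivariant b (r - sigma b η) ↔ IsEquivariant b r := by
  rw [isEquivariant_iff, isEquivariant_iff]
  refine forall_congr' fun y => ?_
  rw [coadDeriv_sub, h.coadDeriv_sigma, map_sub, sub_left_inj]

/-- Pulling A out of x_k ⊗ A₂(∂_k s + η_k · s) replaces x_k by Bx_k. Equivariance of s rewrites ∑
(Bx_k - x_k) ⊗ ∂_k s as -∑ η_i ⊗ x_i · s, and the two action terms together are the first closed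
form of σ acting on s. -/
theorem dbar_app₂ {s : FormalFun d (𝔤 ⊗[ℂ] 𝔤)} (hs : IsEquivariant b s) :
    dbar b (app₂ A s) = app₃ A (dbar b s + bilin d (secondAct 𝔤) (sigma b η) s) := by
  rw [isEquivariant_iff] at hs
  have h1 : ∑ k, tens (app B (cst d (b k)) - cst d (b k)) (pderiv k s)
      = - ∑ i, tens (η i) (act (cst d (b i)) s) := by
    simp only [← h.sum_linFun_smul, ← sum_bilin, ← smul_bilin]
    rw [Finset.sum_comm, ← Finset.sum_neg_distrib]
    refine Finset.sum_congr rfl fun i _ => ?_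
    rw [← hs, coadDeriv_eq, ← map_neg, ← Finset.sum_neg_distrib, map_sum]
    refine Finset.sum_congr rfl fun k _ => ?_
    rw [← map_smul, ← lie_skew (b i), map_neg, neg_smul]
  have h2 (k : Fin d) (q : FormalFun d (𝔤 ⊗[ℂ] 𝔤)) :
      tens (cst d (b k)) (app₂ A q) = app₃ A (tens (app B (cst d (b k))) q) := by
    rw [app_tensHom, h.right_inv]
  rw [dbar, dbar]
  simp only [h.pderiv_app₂, h2]
  rw [← map_sum]
  congr 1
  rw [h.sigma_eq]
  simp only [map_add, map_sum, LinearMap.sum_apply, map_sub, LinearMap.sub_apply, secondAct_tens,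
    Finset.sum_add_distrib, Finset.sum_sub_distrib] at h1 ⊢
  rw [sub_eq_iff_eq_add] at h1
  rw [h1]
  abel

theorem cdybe_app₂_iff {r : FormalFun d (𝔤 ⊗[ℂ] 𝔤)} (hr : IsEquivariant b r) :
    lin d (Alt 𝔤) (dbar b (app₂ A (r - sigma b η)))
        + cybBilin (app₂ A (r - sigma b η)) (app₂ A (r - sigma b η)) = 0 ↔
      lin d (Alt 𝔤) (dbar b r) + cybBilin r r = 0 := by
  -- With s = r - σ, the polarised terms complete CYB(s) to CYB(r) - CYB(σ), and the equation for σ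
  -- removes the rest.
  have h0 : lin d (Alt 𝔤) (dbar b (app₂ A (r - sigma b η)))
        + cybBilin (app₂ A (r - sigma b η)) (app₂ A (r - sigma b η))
      = app₃ A (lin d (Alt 𝔤) (dbar b r) + cybBilin r r) := by
    rw [h.dbar_app₂ ((h.isEquivariant_sub_sigma_iff r).2 hr), ← app₃_alt, ← h.app₃_cybBilin,
      ← map_add]
    congr 1
    rw [map_add, alt_secondAct_of_flip h.flip_sigma, ← sub_eq_zero,
      ← neg_eq_zero.2 h.cdybe_sigma, ← sub_eq_zero]
    simp only [dbar, cybBilin, pderiv_sub, map_sub, Finset.sum_sub_distrib, LinearMap.sub_apply]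
    abel
  rw [h0]
  constructor
  · intro h1
    rw [← h.app₃_inv (lin d (Alt 𝔤) (dbar b r) + cybBilin r r), h1, map_zero]
  · intro h1
    rw [h1, map_zero]

end GaugeData

theorem CDYBE_iff (b : Module.Basis (Fin d) ℂ 𝔩) (r : FormalFun d (𝔤 ⊗[ℂ] 𝔤)) :
    CDYBE b r ↔ lin d (Alt 𝔤) (dbar b r) + cybBilin r r = 0 := by
  have : FormalFun.map (Alt 𝔤 ∘ₗ inclTensor 𝔩 (𝔤 ⊗[ℂ] 𝔤)) (bar b (differential r))
      = lin d (Alt 𝔤) (dbar b r) := by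
    change lin d (Alt 𝔤) (lin d (inclTensor 𝔩 (𝔤 ⊗[ℂ] 𝔤)) (bar b (differential r))) = _
    congr 1
    rw [bar, map_sum, dbar]
    refine Finset.sum_congr rfl fun k _ => ?_
    rw [bilin_const_left]
    rfl
  rw [CDYBE, this, CYB_eq]

/-- Symmetry of r + r²¹ is automatic. Invariance under constants extends to all formal 𝔤-valued
functions by linearity; this is needed because A sends constants to nonconstant functions. -/
theorem isQuasiUnitary_iff (r : FormalFun d (𝔤 ⊗[ℂ] 𝔤)) :
    IsQuasiUnitary r ↔ ∀ u : FormalFun d 𝔤, act u (r + lin d (flip 𝔤) r) = 0 := by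
  constructor
  · rintro ⟨Ω, hΩ, h⟩ u
    have hΩ' : r + lin d (flip 𝔤) r = Ω := hΩ
    rw [hΩ']
    induction u using FormalFun.const_induction with
    | add f g hf hg => rw [map_add, LinearMap.add_apply, hf, hg, add_zero]
    | smul c f hf => rw [map_smul, LinearMap.smul_apply, hf, smul_zero]
    | const z =>
      rw [bilin_const_left]
      funext n
      exact (h n).2 z
  · intro h
    refine ⟨_, rfl, fun n => ⟨?_, fun z => ?_⟩⟩
    · have hff (x : 𝔤 ⊗[ℂ] 𝔤) : flip 𝔤 (flip 𝔤 x) = x := TensorProduct.comm_comm ..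
      simp only [Pi.add_apply, FormalFun.map, map_add, hff]
      exact add_comm _ _
    · have := congrFun (h (const z)) n
      rw [bilin_const_left] at this
      exact this

theorem GaugeData.isQuasiUnitary_iff (h : GaugeData b A B η) (r : FormalFun d (𝔤 ⊗[ℂ] 𝔤)) :
    IsQuasiUnitary (app₂ A (r - sigma b η)) ↔ IsQuasiUnitary r := by
  rw [DynR.isQuasiUnitary_iff, DynR.isQuasiUnitary_iff, ← app₂_flip, ← map_add]
  have h1 : r - sigma b η + lin d (flip 𝔤) (r - sigma b η) = r + lin d (flip 𝔤) r := by
    rw [map_sub, h.flip_sigma]; abel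
  rw [h1]
  constructor
  · intro h2 u
    rw [← h.app₂_inv (act u _), h.app₂_act, h2, map_zero]
  · intro h2 u
    rw [← h.right_inv u, ← h.app₂_act, h2, map_zero]

theorem gaugeOf_eq (b : Module.Basis (Fin d) ℂ 𝔩) (A : FormalFun d (𝔤 →ₗ[ℂ] 𝔤))
    (η : Fin d → FormalFun d 𝔤) (r : FormalFun d (𝔤 ⊗[ℂ] 𝔤)) :
    gaugeOf b A η r = app₂ A (r - sigma b η) := by
  have h1 : FormalFun.map (inclTensor 𝔩 𝔤) (bar b η) = ∑ i, tens (cst d (b i)) (η i) := by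
    change lin d (inclTensor 𝔩 𝔤) (bar b η) = _
    rw [bar, map_sum]
    refine Finset.sum_congr rfl fun k _ => ?_
    rw [bilin_const_left]
    rfl
  have h2 : FormalFun.map (flip 𝔤 ∘ₗ inclTensor 𝔩 𝔤) (bar b η) = ∑ i, tens (η i) (cst d (b i)) := by
    change lin d (flip 𝔤) (FormalFun.map (inclTensor 𝔩 𝔤) (bar b η)) = _
    rw [h1, map_sum]
    simp only [flip_tens]
  rw [gaugeOf, h1, h2, sigma]
  change app₂ A _ = _
  congr 1
  abel

/-- Gauge transformations preserve dynamical r-matrices. -/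
theorem GaugeData.isDynamicalRMatrix_iff (h : GaugeData b A B η) (r : FormalFun d (𝔤 ⊗[ℂ] 𝔤)) :
    IsDynamicalRMatrix b r ↔ IsDynamicalRMatrix b (gaugeOf b A η r) := by
  rw [gaugeOf_eq]
  have he : IsEquivariant b (app₂ A (r - sigma b η)) ↔ IsEquivariant b r := by
    rw [h.isEquivariant_app₂_iff, h.isEquivariant_sub_sigma_iff]
  constructor
  · rintro ⟨h1, h2, h3⟩
    rw [CDYBE_iff] at h2
    exact ⟨he.2 h1, (CDYBE_iff _ _).2 ((h.cdybe_app₂_iff h1).2 h2), (h.isQuasiUnitary_iff r).2 h3⟩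
  · rintro ⟨h1, h2, h3⟩
    rw [CDYBE_iff] at h2
    -- Equivariance of r has to be recovered first, since the comparison of the Yang-Baxter
    -- expressions depends on it.
    exact ⟨he.1 h1, (CDYBE_iff _ _).2 ((h.cdybe_app₂_iff (he.1 h1)).1 h2),
      (h.isQuasiUnitary_iff r).1 h3⟩

end Gauge

open Filter Topology

/-! ### Equality of formal functions up to a given order. -/

section EqUpTo

variable {d : ℕ} {U V W : Type*} [AddCommGroup U] [Module ℂ U] [AddCommGroup V] [Module ℂ V]
  [AddCommGroup W] [Module ℂ W]

/-- Equality of formal functions up to order `N`. -/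
def EqUpTo (N : ℕ) (f g : FormalFun d V) : Prop := ∀ n : Fin d →₀ ℕ, n.degree ≤ N → f n = g n

theorem eqUpTo_zero {f g : FormalFun d V} (h : f 0 = g 0) : EqUpTo 0 f g := by
  intro n hn
  rw [(Finsupp.degree_eq_zero_iff n).1 (Nat.le_zero.1 hn), h]

/-- A coefficient of positive degree is determined by some partial derivative, because n_i + 1 is
invertible in ℂ. This drives the inductions on the order below. -/
theorem eqUpTo_succ {N : ℕ} {f g : FormalFun d V} (h : f 0 = g 0)
    (h' : ∀ i, EqUpTo N (pderiv i f) (pderiv i g)) : EqUpTo (N + 1) f g := by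
  intro n hn
  by_cases hn0 : n = 0
  · rw [hn0, h]
  · obtain ⟨i, hi⟩ : ∃ i, n i ≠ 0 := by
      by_contra! hc
      exact hn0 (Finsupp.ext hc)
    have hle : Finsupp.single i 1 ≤ n := by simpa using Nat.one_le_iff_ne_zero.2 hi
    obtain ⟨m, rfl⟩ : ∃ m, n = m + Finsupp.single i 1 := ⟨_, (tsub_add_cancel_of_le hle).symm⟩
    have hm := h' i m (by simpa using hn)
    exact smul_right_injective V (Nat.cast_add_one_ne_zero (R := ℂ) (m i)) hm

theorem EqUpTo.pderiv {N : ℕ} {f g : FormalFun d V} (h : EqUpTo (N + 1) f g) (i : Fin d) :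
    EqUpTo N (pderiv i f) (pderiv i g) := by
  intro n hn
  rw [FormalFun.pderiv, FormalFun.pderiv, h _ (by simpa using hn)]

theorem EqUpTo.mono {N M : ℕ} (hM : M ≤ N) {f g : FormalFun d V} (h : EqUpTo N f g) :
    EqUpTo M f g :=
  fun n hn => h n (hn.trans hM)

theorem EqUpTo.map₂ {N : ℕ} (β : U →ₗ[ℂ] V →ₗ[ℂ] W) {f f' : FormalFun d U} {g g' : FormalFun d V}
    (hf : EqUpTo N f f') (hg : EqUpTo N g g') :
    EqUpTo N (FormalFun.map₂ β f g) (FormalFun.map₂ β f' g') := by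
  intro n hn
  refine Finset.sum_congr rfl fun p hp => ?_
  rw [Finset.HasAntidiagonal.mem_antidiagonal] at hp
  rw [← hp, map_add] at hn
  rw [hf _ (by omega), hg _ (by omega)]

end EqUpTo

/-! ### Taylor series of holomorphic germs. -/

section Taylor

variable {d : ℕ} {U V W : Type*} [NormedAddCommGroup U] [NormedSpace ℂ U]
  [NormedAddCommGroup V] [NormedSpace ℂ V] [NormedAddCommGroup W] [NormedSpace ℂ W]

/-- The partial derivative of a function of several complex variables. -/
def partialDeriv (i : Fin d) (F : (Fin d → ℂ) → V) : (Fin d → ℂ) → V :=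
  fun x => fderiv ℂ F x (Pi.single i 1)

theorem partialDeriv_congr {F F' : (Fin d → ℂ) → V} {x : Fin d → ℂ} (h : F =ᶠ[𝓝 x] F')
    (i : Fin d) : partialDeriv i F =ᶠ[𝓝 x] partialDeriv i F' := by
  filter_upwards [h.fderiv (𝕜 := ℂ)] with y hy
  rw [partialDeriv, partialDeriv, hy]

/-- The family of Taylor coefficients at `0`. -/
def taylor (F : (Fin d → ℂ) → V) : FormalFun d V := fun n => taylorCoeff F n

theorem taylor_congr {F F' : (Fin d → ℂ) → V} (h : F =ᶠ[𝓝 0] F') : taylor F = taylor F' := by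
  funext n
  rw [taylor, taylor, taylorCoeff, taylorCoeff, (h.iteratedFDeriv ℂ _).eq_of_nhds]

theorem taylor_apply_zero (F : (Fin d → ℂ) → V) : taylor F 0 = F 0 := by
  have hl : (Finsupp.toMultiset (0 : Fin d →₀ ℕ)).toList = [] := by simp
  rw [taylor, taylorCoeff]
  generalize (Finsupp.toMultiset (0 : Fin d →₀ ℕ)).toList = l at *
  subst hl
  simp

variable [CompleteSpace V]

theorem analyticAt_partialDeriv {F : (Fin d → ℂ) → V} {x : Fin d → ℂ} (h : AnalyticAt ℂ F x)
    (i : Fin d) : AnalyticAt ℂ (partialDeriv i F) x :=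
  ((ContinuousLinearMap.apply ℂ V (Pi.single i (1 : ℂ) : Fin d → ℂ)).analyticAt _).comp h.fderiv

theorem analyticAt_foldr_partialDeriv {F : (Fin d → ℂ) → V} {x : Fin d → ℂ}
    (h : AnalyticAt ℂ F x) (l : List (Fin d)) : AnalyticAt ℂ (l.foldr partialDeriv F) x := by
  induction l with
  | nil => exact h
  | cons i l ih => exact analyticAt_partialDeriv ih i

theorem partialDeriv_comm {F : (Fin d → ℂ) → V} {x : Fin d → ℂ} (h : AnalyticAt ℂ F x)
    (i j : Fin d) :
    partialDeriv i (partialDeriv j F) =ᶠ[𝓝 x] partialDeriv j (partialDeriv i F) := by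
  filter_upwards [h.eventually_analyticAt] with y hy
  have key (i j : Fin d) : partialDeriv i (partialDeriv j F) y
      = fderiv ℂ (fderiv ℂ F) y (Pi.single i 1) (Pi.single j 1) := by
    have : partialDeriv j F = fun z => fderiv ℂ F z (Pi.single j 1) := rfl
    rw [partialDeriv, this, fderiv_clm_apply hy.fderiv.differentiableAt (by fun_prop)]
    simp
  rw [key, key]
  exact (hy.contDiffAt (n := 2)).isSymmSndFDerivAt (by simp) _ _

theorem foldr_partialDeriv_perm {F : (Fin d → ℂ) → V} {x : Fin d → ℂ} (h : AnalyticAt ℂ F x)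
    {l l' : List (Fin d)} (hl : l.Perm l') :
    l.foldr partialDeriv F =ᶠ[𝓝 x] l'.foldr partialDeriv F := by
  induction hl with
  | nil => rfl
  | cons i _ ih => exact partialDeriv_congr ih i
  | swap i j l => exact partialDeriv_comm (analyticAt_foldr_partialDeriv h l) _ _
  | trans _ _ ih ih' => exact ih.trans ih'

theorem iteratedFDeriv_eq_foldr {F : (Fin d → ℂ) → V} (l : List (Fin d)) {x : Fin d → ℂ}
    (h : AnalyticAt ℂ F x) :
    iteratedFDeriv ℂ l.length F x (fun j => Pi.single (l.get j) (1 : ℂ)) =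
      l.foldr partialDeriv F x := by
  induction l generalizing x with
  | nil => simp
  | cons i l ih =>
    have h1 : (fun y => iteratedFDeriv ℂ l.length F y (fun j => Pi.single (l.get j) (1 : ℂ)))
        =ᶠ[𝓝 x] l.foldr partialDeriv F := by
      filter_upwards [h.eventually_analyticAt] with y hy using ih hy
    rw [List.foldr_cons, partialDeriv, ← h1.fderiv_eq]
    have h2 : DifferentiableAt ℂ (iteratedFDeriv ℂ l.length F) x :=
      (h.contDiffAt (n := ω)).differentiableAt_iteratedFDeriv (WithTop.coe_lt_top _)
    have h3 := (h2.hasFDerivAt.continuousMultilinear_apply_const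
      (fun j => Pi.single (l.get j) (1 : ℂ)))
    rw [h3.fderiv]
    change iteratedFDeriv ℂ (l.length + 1) F x _ = _
    rw [iteratedFDeriv_succ_apply_left]
    rfl

theorem taylor_eq_foldr {F : (Fin d → ℂ) → V} (h : AnalyticAt ℂ F 0) (n : Fin d →₀ ℕ) :
    taylor F n = (∏ i, ((n i).factorial : ℂ))⁻¹ •
      (Finsupp.toMultiset n).toList.foldr partialDeriv F 0 := by
  rw [taylor, taylorCoeff, iteratedFDeriv_eq_foldr _ h]

/-- Partial derivatives of an analytic function commute, and the extra factor in (n + e_i)! is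
exactly n_i + 1. -/
theorem pderiv_taylor {F : (Fin d → ℂ) → V} (h : AnalyticAt ℂ F 0) (i : Fin d) :
    pderiv i (taylor F) = taylor (partialDeriv i F) := by
  funext n
  rw [pderiv, taylor_eq_foldr h, taylor_eq_foldr (analyticAt_partialDeriv h i)]
  -- The list attached to a multi-index comes in an arbitrary order; placing i last makes the fold
  -- differentiate by x_i first.
  have hp : (Finsupp.toMultiset (n + Finsupp.single i 1)).toList.Perm
      ((Finsupp.toMultiset n).toList ++ [i]) := by
    rw [← Multiset.coe_eq_coe, ← Multiset.coe_add]
    simp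
  rw [(foldr_partialDeriv_perm h hp).eq_of_nhds, List.foldr_append, smul_smul]
  congr 1
  have : ∏ j, (((n + Finsupp.single i 1 : Fin d →₀ ℕ) j).factorial : ℂ)
      = (n i + 1) * ∏ j, ((n j).factorial : ℂ) := by
    rw [← Finset.mul_prod_erase _ _ (Finset.mem_univ i),
      ← Finset.mul_prod_erase Finset.univ (fun j => ((n j).factorial : ℂ)) (Finset.mem_univ i)]
    have h1 : ∏ j ∈ Finset.univ.erase i, (((n + Finsupp.single i 1 : Fin d →₀ ℕ) j).factorial : ℂ)
        = ∏ j ∈ Finset.univ.erase i, ((n j).factorial : ℂ) := by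
      refine Finset.prod_congr rfl fun j hj => ?_
      rw [Finset.mem_erase] at hj
      simp [Finsupp.single_eq_of_ne hj.1]
    rw [h1]
    simp [Nat.factorial_succ]
    ring
  rw [this, mul_inv, ← mul_assoc, mul_inv_cancel₀ (Nat.cast_add_one_ne_zero _), one_mul]

theorem taylor_add {F F' : (Fin d → ℂ) → V} (h : AnalyticAt ℂ F 0) (h' : AnalyticAt ℂ F' 0) :
    taylor (fun x => F x + F' x) = taylor F + taylor F' := by
  funext n
  rw [Pi.add_apply, taylor, taylor, taylor, taylorCoeff, taylorCoeff, taylorCoeff,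
    fun_iteratedFDeriv_add_apply h.contDiffAt h'.contDiffAt, add_apply,
    smul_add]

theorem taylor_clm (L : V →L[ℂ] W) {F : (Fin d → ℂ) → V} (h : AnalyticAt ℂ F 0) :
    taylor (fun x => L (F x)) = FormalFun.map L.toLinearMap (taylor F) := by
  funext n
  rw [taylor, taylorCoeff, FormalFun.map, taylor, taylorCoeff]
  have := L.iteratedFDeriv_comp_left (h.contDiffAt (n := ω))
    (i := (Finsupp.toMultiset n).toList.length) (by simp)
  change _ • iteratedFDeriv ℂ _ (L ∘ F) 0 _ = _
  rw [this]
  simp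

theorem taylor_const (v : V) : taylor (fun _ : Fin d → ℂ => v) = const v := by
  have (N : ℕ) : EqUpTo N (taylor (fun _ : Fin d → ℂ => v)) (const v) := by
    induction N generalizing v with
    | zero => exact eqUpTo_zero (by rw [taylor_apply_zero]; simp [const])
    | succ N ih =>
      refine eqUpTo_succ (by rw [taylor_apply_zero]; simp [const]) fun i => ?_
      rw [pderiv_taylor analyticAt_const, pderiv_const]
      have : partialDeriv i (fun _ : Fin d → ℂ => v) = fun _ => 0 := by
        funext x; simp [partialDeriv]
      rw [this, ← const_zero]
      exact ih 0
  funext n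
  exact this _ n le_rfl

theorem partialDeriv_bilin [CompleteSpace U] (β : U →L[ℂ] V →L[ℂ] W) {F : (Fin d → ℂ) → U}
    {F' : (Fin d → ℂ) → V} {x : Fin d → ℂ} (h : AnalyticAt ℂ F x) (h' : AnalyticAt ℂ F' x)
    (i : Fin d) :
    partialDeriv i (fun x => β (F x) (F' x)) =ᶠ[𝓝 x]
      fun x => β (partialDeriv i F x) (F' x) + β (F x) (partialDeriv i F' x) := by
  filter_upwards [h.eventually_analyticAt, h'.eventually_analyticAt] with y hy hy'
  rw [partialDeriv, β.fderiv_of_bilinear hy.differentiableAt hy'.differentiableAt, add_comm]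
  rfl

theorem analyticAt_bilin (β : U →L[ℂ] V →L[ℂ] W) {F : (Fin d → ℂ) → U}
    {F' : (Fin d → ℂ) → V} {x : Fin d → ℂ} (h : AnalyticAt ℂ F x) (h' : AnalyticAt ℂ F' x) :
    AnalyticAt ℂ (fun x => β (F x) (F' x)) x :=
  AnalyticAt.comp₂ (h := fun q : U × V => β q.1 q.2) (β.analyticAt_bilinear _) h h'

/-- Both sides have the same value at 0 and obey the same product rule, so induction on the order
applies, for all pairs of functions at once. -/
theorem taylor_bilin [CompleteSpace U] [CompleteSpace W] (β : U →L[ℂ] V →L[ℂ] W)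
    {F : (Fin d → ℂ) → U} {F' : (Fin d → ℂ) → V} (h : AnalyticAt ℂ F 0) (h' : AnalyticAt ℂ F' 0) :
    taylor (fun x => β (F x) (F' x)) = FormalFun.map₂ β.toLinearMap₁₂ (taylor F) (taylor F') := by
  have h0 (F : (Fin d → ℂ) → U) (F' : (Fin d → ℂ) → V) :
      taylor (fun x => β (F x) (F' x)) 0 = FormalFun.map₂ β.toLinearMap₁₂ (taylor F) (taylor F') 0 := by
    simp [taylor_apply_zero, FormalFun.map₂]
  have (N : ℕ) : EqUpTo N (taylor (fun x => β (F x) (F' x)))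
      (FormalFun.map₂ β.toLinearMap₁₂ (taylor F) (taylor F')) := by
    induction N generalizing F F' with
    | zero => exact eqUpTo_zero (h0 F F')
    | succ N ih =>
      refine eqUpTo_succ (h0 F F') fun i => ?_
      have hi := analyticAt_partialDeriv h i
      have hi' := analyticAt_partialDeriv h' i
      rw [pderiv_taylor (analyticAt_bilin β h h'), taylor_congr (partialDeriv_bilin β h h' i),
        taylor_add (analyticAt_bilin β hi h') (analyticAt_bilin β h hi'), pderiv_map₂,
        pderiv_taylor h, pderiv_taylor h']
      intro n hn
      rw [Pi.add_apply, Pi.add_apply, ih hi h' n hn, ih h hi' n hn]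
  funext n
  exact this _ n le_rfl

theorem partialDeriv_comp {Φ : U → V} {p : (Fin d → ℂ) → U} {x : Fin d → ℂ}
    (hΦ : AnalyticAt ℂ Φ (p x)) [CompleteSpace U] (hp : AnalyticAt ℂ p x) (i : Fin d) :
    partialDeriv i (fun x => Φ (p x)) =ᶠ[𝓝 x] fun x => fderiv ℂ Φ (p x) (partialDeriv i p x) := by
  filter_upwards [hp.eventually_analyticAt,
    hp.continuousAt.eventually hΦ.eventually_analyticAt] with y hy hy'
  rw [partialDeriv, fderiv_fun_comp y hy'.differentiableAt hy.differentiableAt]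
  rfl

end Taylor

/-- By the chain rule the derivative of Φ ∘ p is (DΦ ∘ p)(∂p), which lowers the order by one. The
induction must vary Φ and its target, since DΦ takes values in U →L V; this is why both spaces lie
in one universe. -/
theorem eqUpTo_taylor_comp.{u} {d : ℕ} {U V : Type u} [NormedAddCommGroup U] [NormedSpace ℂ U]
    [CompleteSpace U] [NormedAddCommGroup V] [NormedSpace ℂ V] [CompleteSpace V] (N : ℕ)
    {Φ : U → V} {p q : (Fin d → ℂ) → U} (hp : AnalyticAt ℂ p 0) (hq : AnalyticAt ℂ q 0)
    (hpq : EqUpTo N (taylor p) (taylor q)) (hΦ : AnalyticAt ℂ Φ (p 0)) :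
    EqUpTo N (taylor fun x => Φ (p x)) (taylor fun x => Φ (q x)) := by
  have h0 : p 0 = q 0 := by
    rw [← taylor_apply_zero p, ← taylor_apply_zero q]
    exact hpq 0 (by simp)
  have h1 {V : Type u} (Φ : U → V) [NormedAddCommGroup V] [NormedSpace ℂ V] :
      taylor (fun x => Φ (p x)) 0 = taylor (fun x => Φ (q x)) 0 := by
    rw [taylor_apply_zero, taylor_apply_zero, h0]
  induction N generalizing V with
  | zero => exact eqUpTo_zero (h1 Φ)
  | succ N ih =>
    refine eqUpTo_succ (h1 Φ) fun i => ?_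
    have hΦ' : AnalyticAt ℂ Φ (q 0) := h0 ▸ hΦ
    rw [pderiv_taylor (hΦ.comp' hp), pderiv_taylor (hΦ'.comp' hq),
      taylor_congr (partialDeriv_comp hΦ hp i), taylor_congr (partialDeriv_comp hΦ' hq i)]
    have e1 := taylor_bilin (ContinuousLinearMap.id ℂ (U →L[ℂ] V)) (hΦ.fderiv.comp hp)
      (analyticAt_partialDeriv hp i)
    have e2 := taylor_bilin (ContinuousLinearMap.id ℂ (U →L[ℂ] V)) (hΦ'.fderiv.comp hq)
      (analyticAt_partialDeriv hq i)
    refine Eq.subst (motive := fun a => EqUpTo N a _) e1.symm ?_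
    refine Eq.subst (motive := fun a => EqUpTo N _ a) e2.symm ?_
    refine EqUpTo.map₂ _ (ih (hpq.mono (Nat.le_succ N)) hΦ.fderiv) ?_
    rw [← pderiv_taylor hp, ← pderiv_taylor hq]
    exact hpq.pderiv i

/-! ### Taylor series of polynomial truncations. -/

section Polynomials

variable {d : ℕ} {V : Type*} [NormedAddCommGroup V] [NormedSpace ℂ V] [CompleteSpace V]

theorem taylor_sum {ι : Type*} (s : Finset ι) (F : ι → (Fin d → ℂ) → V)
    (h : ∀ j ∈ s, AnalyticAt ℂ (F j) 0) :
    taylor (fun x => ∑ j ∈ s, F j x) = ∑ j ∈ s, taylor (F j) := by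
  classical
  induction s using Finset.induction_on with
  | empty => simp [taylor_const, const_zero]
  | insert a s ha ih =>
    simp only [Finset.sum_insert ha]
    rw [taylor_add (h a (Finset.mem_insert_self a s)), ih]
    · exact fun j hj => h j (Finset.mem_insert_of_mem hj)
    · exact Finset.analyticAt_fun_sum _ fun j hj => h j (Finset.mem_insert_of_mem hj)

theorem taylor_coord (i : Fin d) :
    taylor (fun x : Fin d → ℂ => x i) = fun n => if n = Finsupp.single i 1 then 1 else 0 := by
  have ha : AnalyticAt ℂ (fun x : Fin d → ℂ => x i) 0 :=
    (ContinuousLinearMap.proj (R := ℂ) (φ := fun _ : Fin d => ℂ) i).analyticAt 0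
  have hX : (fun n => if n = Finsupp.single i 1 then 1 else 0 : FormalFun d ℂ) =
      mulX i (const 1) := by
    funext n
    simp only [mulX, const]
    by_cases h : n i = 0
    · have : n ≠ Finsupp.single i 1 := by rintro rfl; simp at h
      simp [h, this]
    · have hle : Finsupp.single i 1 ≤ n := by simpa using Nat.one_le_iff_ne_zero.2 h
      have : n - Finsupp.single i 1 = 0 ↔ n = Finsupp.single i 1 := by
        rw [tsub_eq_zero_iff_le]
        exact ⟨fun h' => le_antisymm h' hle, fun h' => h'.le⟩
      simp [h, this]
  have h0 : taylor (fun x : Fin d → ℂ => x i) 0 = mulX i (const 1) 0 := by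
    rw [taylor_apply_zero]; simp [mulX]
  have key (N : ℕ) : EqUpTo N (taylor (fun x : Fin d → ℂ => x i)) (mulX i (const 1)) := by
    -- No induction is needed: the derivatives of a coordinate are constants, whose Taylor series
    -- are already known exactly.
    refine EqUpTo.mono (Nat.le_succ N) (eqUpTo_succ h0 fun j => ?_)
    have hd : partialDeriv j (fun x : Fin d → ℂ => x i) = fun _ => if j = i then 1 else 0 := by
      funext x
      have := (ContinuousLinearMap.proj (R := ℂ) (φ := fun _ : Fin d => ℂ) i).hasFDerivAt (x := x)
      rw [partialDeriv]
      change fderiv ℂ (ContinuousLinearMap.proj (R := ℂ) (φ := fun _ : Fin d => ℂ) i) x _ = _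
      rw [this.fderiv]
      simp [Pi.single_apply, eq_comm]
    rw [pderiv_taylor ha, hd, taylor_const, pderiv_mulX, pderiv_const]
    intro n _
    split_ifs <;> simp [mulX, const_zero]
  rw [hX]
  funext n
  exact key _ n le_rfl

theorem analyticAt_coord (i : Fin d) (x : Fin d → ℂ) :
    AnalyticAt ℂ (fun x : Fin d → ℂ => x i) x :=
  (ContinuousLinearMap.proj (R := ℂ) (φ := fun _ : Fin d => ℂ) i).analyticAt x

theorem analyticAt_monomial (m : Fin d →₀ ℕ) (v : V) (x : Fin d → ℂ) :
    AnalyticAt ℂ (fun x : Fin d → ℂ => (∏ i, x i ^ m i) • v) x :=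
  (Finset.analyticAt_fun_prod _ fun i _ => (analyticAt_coord i x).pow _).smul analyticAt_const

theorem taylor_monomial (m : Fin d →₀ ℕ) (v : V) :
    taylor (fun x : Fin d → ℂ => (∏ i, x i ^ m i) • v) = fun n => if n = m then v else 0 := by
  induction hk : m.degree generalizing m with
  | zero =>
    rw [(Finsupp.degree_eq_zero_iff m).1 hk]
    have h1 : (fun x : Fin d → ℂ => (∏ i, x i ^ (0 : Fin d →₀ ℕ) i) • v) = fun _ => v := by
      funext x; simp
    rw [h1, taylor_const]
    rfl
  | succ k ih =>
    obtain ⟨i, hi⟩ : ∃ i, m i ≠ 0 := by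
      by_contra! hc
      rw [show m = 0 from Finsupp.ext hc] at hk
      simp at hk
    have hle : Finsupp.single i 1 ≤ m := by simpa using Nat.one_le_iff_ne_zero.2 hi
    obtain ⟨m, rfl⟩ : ∃ m', m = m' + Finsupp.single i 1 := ⟨_, (tsub_add_cancel_of_le hle).symm⟩
    have hm : (fun x : Fin d → ℂ => (∏ j, x j ^ (m + Finsupp.single i 1 : Fin d →₀ ℕ) j) • v) = fun x =>
        ContinuousLinearMap.lsmul ℂ ℂ (x i) ((∏ j, x j ^ m j) • v) := by
      funext x
      rw [ContinuousLinearMap.lsmul_apply, smul_smul]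
      congr 1
      simp only [Finsupp.add_apply, pow_add, Finset.prod_mul_distrib]
      rw [mul_comm]
      congr 1
      rw [Finset.prod_eq_single i]
      · simp
      · intro j _ hj; simp [Finsupp.single_eq_of_ne hj]
      · simp
    rw [hm, taylor_bilin _ (analyticAt_coord i 0) (analyticAt_monomial m v 0),
      ih m (by simpa using hk), taylor_coord]
    funext n
    rw [FormalFun.map₂]
    by_cases hn : n = m + Finsupp.single i 1
    · rw [if_pos hn, Finset.sum_eq_single (Finsupp.single i 1, m)]
      · simp
      · rintro ⟨a, c⟩ _ hne
        simp only [ne_eq, Prod.mk.injEq, not_and] at hne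
        by_cases ha : a = Finsupp.single i 1
        · simp [hne ha]
        · simp [ha]
      · intro h
        exact absurd (by rw [Finset.HasAntidiagonal.mem_antidiagonal, hn, add_comm]) h
    · rw [if_neg hn]
      refine Finset.sum_eq_zero ?_
      rintro ⟨a, c⟩ hac
      rw [Finset.HasAntidiagonal.mem_antidiagonal] at hac
      by_cases ha : a = Finsupp.single i 1
      · have : c ≠ m := by
          rintro rfl
          exact hn (by rw [← hac, ha, add_comm])
        simp [this]
      · simp [ha]

/-- The truncation of a formal function at degree `N`, as a polynomial function. -/
def truncation (c : FormalFun d V) (N : ℕ) (x : Fin d → ℂ) : V :=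
  ∑ k ∈ Finset.range (N + 1), ∑ m ∈ Finset.finsuppAntidiag (Finset.univ : Finset (Fin d)) k,
    (∏ i, x i ^ m i) • c m

theorem analyticAt_truncation (c : FormalFun d V) (N : ℕ) (x : Fin d → ℂ) :
    AnalyticAt ℂ (truncation c N) x :=
  Finset.analyticAt_fun_sum _ fun _ _ => Finset.analyticAt_fun_sum _ fun m _ =>
    analyticAt_monomial m _ x

theorem eqUpTo_taylor_truncation (c : FormalFun d V) (N : ℕ) :
    EqUpTo N (taylor (truncation c N)) c := by
  intro n hn
  have h1 : taylor (truncation c N) = ∑ k ∈ Finset.range (N + 1),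
      ∑ m ∈ Finset.finsuppAntidiag (Finset.univ : Finset (Fin d)) k,
        fun n => if n = m then c m else 0 := by
    have := taylor_sum (Finset.range (N + 1)) (fun k x =>
      ∑ m ∈ Finset.finsuppAntidiag (Finset.univ : Finset (Fin d)) k, (∏ i, x i ^ m i) • c m)
      (fun _ _ => Finset.analyticAt_fun_sum _ fun m _ => analyticAt_monomial m _ 0)
    refine this.trans (Finset.sum_congr rfl fun k _ => ?_)
    rw [taylor_sum _ _ fun m _ => analyticAt_monomial m _ 0]
    exact Finset.sum_congr rfl fun m _ => taylor_monomial m _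
  have hmem (m : Fin d →₀ ℕ) (k : ℕ) :
      m ∈ Finset.finsuppAntidiag (Finset.univ : Finset (Fin d)) k ↔ m.degree = k := by
    rw [Finset.mem_finsuppAntidiag, Finsupp.degree_eq_sum]
    simp
  rw [h1, Finset.sum_apply, Finset.sum_eq_single n.degree]
  · rw [Finset.sum_apply, Finset.sum_eq_single n]
    · simp
    · intro m _ hm
      simp [hm.symm]
    · intro h
      exact absurd ((hmem _ _).2 rfl) h
  · intro k _ hk
    rw [Finset.sum_apply]
    refine Finset.sum_eq_zero fun m hm => ?_
    have : n ≠ m := by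
      rintro rfl
      exact hk ((hmem _ _).1 hm).symm
    simp [this]
  · intro h
    exact absurd (Finset.mem_range.2 (by omega)) h

theorem truncation_zero (c : FormalFun d V) (N : ℕ) : truncation c N 0 = c 0 := by
  rw [← taylor_apply_zero (truncation c N), eqUpTo_taylor_truncation c N 0 (by simp)]

theorem eqUpTo_taylor_truncation_of_le (c : FormalFun d V) {k N M : ℕ} (hN : k ≤ N) (hM : k ≤ M) :
    EqUpTo k (taylor (truncation c N)) (taylor (truncation c M)) := fun n hn => by
  rw [eqUpTo_taylor_truncation c N n (hn.trans hN), eqUpTo_taylor_truncation c M n (hn.trans hM)]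

end Polynomials

/-! ### Calculus in the chart at the identity and the adjoint action. -/

section ChartAtOne

variable {E : Type*} [NormedAddCommGroup E] [NormedSpace ℂ E]
  {G : Type*} [TopologicalSpace G] [ChartedSpace E G]
  {W W' : Type*} [NormedAddCommGroup W] [NormedSpace ℂ W] [NormedAddCommGroup W'] [NormedSpace ℂ W']

variable (E) in
/-- Holomorphy at a point of a map from a normed space to the manifold `G`. -/
def HolAt (F : W → G) (w : W) : Prop := ContMDiffAt 𝓘(ℂ, W) 𝓘(ℂ, E) ω F w

theorem HolAt.comp {F : W → G} {p : W' → W} {w : W'} (hF : HolAt E F (p w))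
    (hp : ContDiffAt ℂ ω p w) : HolAt E (fun w => F (p w)) w :=
  ContMDiffAt.comp (I' := 𝓘(ℂ, W)) w hF (contMDiffAt_iff_contDiffAt.2 hp)

theorem HolAt.continuousAt {F : W → G} {w : W} (hF : HolAt E F w) : ContinuousAt F w :=
  ContMDiffAt.continuousAt hF

theorem holAt_const (h : G) (w : W) : HolAt E (fun _ => h) w := contMDiffAt_const

variable [Group G] [LieGroup 𝓘(ℂ, E) ω G]

theorem HolAt.mul {F F' : W → G} {w : W} (hF : HolAt E F w) (hF' : HolAt E F' w) :
    HolAt E (fun w => F w * F' w) w := ContMDiffAt.mul hF hF'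

theorem HolAt.inv {F : W → G} {w : W} (hF : HolAt E F w) : HolAt E (fun w => (F w)⁻¹) w :=
  ContMDiffAt.inv hF

theorem HolAt.eventually {F : W → G} {w : W} (hF : HolAt E F w) : ∀ᶠ x in 𝓝 w, HolAt E F x := by
  have : IsManifold 𝓘(ℂ, E) ω G := (inferInstance : LieGroup 𝓘(ℂ, E) ω G).toContMDiffMul.toIsManifold
  exact (contMDiffAt_iff_contMDiffAt_nhds (by simp)).1 hF

theorem holAt_extChartAt_symm (a : G) {u : E} (hu : u ∈ (extChartAt 𝓘(ℂ, E) a).target) :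
    HolAt E (extChartAt 𝓘(ℂ, E) a).symm u :=
  have : IsManifold 𝓘(ℂ, E) ω G := (inferInstance : LieGroup 𝓘(ℂ, E) ω G).toContMDiffMul.toIsManifold
  (contMDiffOn_extChartAt_symm a).contMDiffAt ((isOpen_extChartAt_target a).mem_nhds hu)

variable (E) in
/-- The preferred chart at `1`. -/
def lc (h : G) : E := extChartAt 𝓘(ℂ, E) (1 : G) h

variable (G) in
/-- The inverse of the preferred chart at `1`. -/
def ex (u : E) : G := (extChartAt 𝓘(ℂ, E) (1 : G)).symm u

omit [LieGroup 𝓘(ℂ, E) ω G] in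
theorem ex_lc_one : ex G (lc E (1 : G)) = 1 := extChartAt_to_inv (I := 𝓘(ℂ, E)) (1 : G)

theorem eventually_ex_lc : ∀ᶠ h in 𝓝 (1 : G), ex G (lc E h) = h := by
  filter_upwards [extChartAt_source_mem_nhds (I := 𝓘(ℂ, E)) (1 : G)] with h hh
  exact (extChartAt 𝓘(ℂ, E) (1 : G)).left_inv hh

theorem eventually_lc_ex : ∀ᶠ u in 𝓝 (lc E (1 : G)), lc E (ex G u) = u := by
  filter_upwards [extChartAt_target_mem_nhds (I := 𝓘(ℂ, E)) (1 : G)] with h hh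
  exact (extChartAt 𝓘(ℂ, E) (1 : G)).right_inv hh

theorem holAt_ex : HolAt E (ex G) (lc E (1 : G)) :=
  holAt_extChartAt_symm (1 : G) (mem_extChartAt_target 1)

theorem HolAt.contDiffAt_lc {F : W → G} {w : W} (hF : HolAt E F w) (h1 : F w = 1) :
    ContDiffAt ℂ ω (fun w => lc E (F w)) w := by
  have : IsManifold 𝓘(ℂ, E) ω G := (inferInstance : LieGroup 𝓘(ℂ, E) ω G).toContMDiffMul.toIsManifold
  have h2 : ContMDiffAt 𝓘(ℂ, E) 𝓘(ℂ, E) ω (lc E : G → E) (F w) := by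
    rw [h1]; exact contMDiffAt_extChartAt
  exact contMDiffAt_iff_contDiffAt.1 (ContMDiffAt.comp (I' := 𝓘(ℂ, E)) w h2 hF)

theorem HolAt.differentiableAt_lc {F : W → G} {w : W} (hF : HolAt E F w) (h1 : F w = 1) :
    DifferentiableAt ℂ (fun w => lc E (F w)) w :=
  (hF.contDiffAt_lc h1).differentiableAt (by simp)

variable (E) in
/-- The derivative in coordinates of a map to `G` at a point mapped to `1`. -/
def dlc (F : W → G) (w : W) : W →L[ℂ] E := fderiv ℂ (fun w => lc E (F w)) w

theorem dlc_ex : dlc E (ex G) (lc E (1 : G)) = ContinuousLinearMap.id ℂ E := by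
  rw [dlc, Filter.EventuallyEq.fderiv_eq (f := fun u => u) eventually_lc_ex, fderiv_fun_id]

theorem HolAt.eventually_ex_lc {F : W → G} {w : W} (hF : HolAt E F w) (h1 : F w = 1) :
    ∀ᶠ x in 𝓝 w, ex G (lc E (F x)) = F x :=
  hF.continuousAt.eventually (by rw [h1]; exact DynR.eventually_ex_lc (E := E))

omit [LieGroup 𝓘(ℂ, E) ω G] in
theorem dlc_congr {F F' : W → G} {w : W} (h : F =ᶠ[𝓝 w] F') : dlc E F w = dlc E F' w :=
  Filter.EventuallyEq.fderiv_eq (h.fun_comp (lc E))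

omit [LieGroup 𝓘(ℂ, E) ω G] in
theorem dlc_const (h : G) (w : W) : dlc E (fun _ : W => h) w = 0 := by
  rw [dlc, fderiv_fun_const]; rfl

theorem dlc_comp {F : W → G} {p : W' → W} {w : W'} (hF : HolAt E F (p w)) (h1 : F (p w) = 1)
    (hp : DifferentiableAt ℂ p w) :
    dlc E (fun w => F (p w)) w = (dlc E F (p w)).comp (fderiv ℂ p w) :=
  fderiv_fun_comp (g := fun x => lc E (F x)) w (hF.differentiableAt_lc h1) hp

/-- Chain rule for a map `Θ` fixing `1`. -/
theorem dlc_map {Θ : G → G} {F : W → G} {w : W}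
    (hΘ : HolAt E (fun u => Θ (ex G u)) (lc E (1 : G)))
    (hΘ1 : Θ 1 = 1) (hF : HolAt E F w) (h1 : F w = 1) :
    dlc E (fun x => Θ (F x)) w =
      (dlc E (fun u => Θ (ex G u)) (lc E (1 : G))).comp (dlc E F w) := by
  rw [← h1] at hΘ ⊢
  rw [dlc, dlc, dlc, ← fderiv_fun_comp (g := fun u => lc E (Θ (ex G u))) (f := fun w => lc E (F w)) w
    (hΘ.differentiableAt_lc (by rw [h1, ex_lc_one, hΘ1])) (hF.differentiableAt_lc h1)]
  refine Filter.EventuallyEq.fderiv_eq ?_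
  filter_upwards [hF.eventually_ex_lc h1] with x hx
  rw [hx]

variable (E G) in
/-- The multiplication, as a function of the coordinates of the two factors. -/
def mulEx (p : E × E) : G := ex G p.1 * ex G p.2

theorem holAt_mulEx : HolAt E (mulEx E G) (lc E (1 : G), lc E (1 : G)) :=
  (HolAt.comp (p := Prod.fst) holAt_ex contDiffAt_fst).mul
    (HolAt.comp (p := Prod.snd) holAt_ex contDiffAt_snd)

omit [LieGroup 𝓘(ℂ, E) ω G] in
theorem mulEx_one : mulEx E G (lc E (1 : G), lc E (1 : G)) = 1 := by
  simp [mulEx, ex_lc_one]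

/-- Restricting the multiplication to either factor, with the other at 1, gives back the inverse
chart, whose derivative in coordinates is the identity. -/
theorem dlc_mulEx : dlc E (mulEx E G) (lc E (1 : G), lc E (1 : G)) =
    ContinuousLinearMap.fst ℂ E E + ContinuousLinearMap.snd ℂ E E := by
  have h1 := dlc_comp (W' := E) (w := lc E (1 : G)) (p := fun u => (u, lc E (1 : G)))
    holAt_mulEx mulEx_one (by fun_prop)
  have h2 := dlc_comp (W' := E) (w := lc E (1 : G)) (p := fun u => (lc E (1 : G), u))
    holAt_mulEx mulEx_one (by fun_prop)
  rw [(hasFDerivAt_prodMk_left _ _).fderiv] at h1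
  rw [(hasFDerivAt_prodMk_right _ _).fderiv] at h2
  simp only [mulEx, ex_lc_one, mul_one, one_mul, dlc_ex] at h1 h2
  ext u
  · exact (by simpa using DFunLike.congr_fun h1.symm u)
  · exact (by simpa using DFunLike.congr_fun h2.symm u)

theorem dlc_mul {F F' : W → G} {w : W} (hF : HolAt E F w) (h1 : F w = 1)
    (hF' : HolAt E F' w) (h1' : F' w = 1) :
    dlc E (fun x => F x * F' x) w = dlc E F w + dlc E F' w := by
  have h := dlc_comp (F := mulEx E G) (w := w) (p := fun x => (lc E (F x), lc E (F' x)))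
    (by rw [h1, h1']; exact holAt_mulEx) (by rw [h1, h1']; exact mulEx_one)
    ((hF.differentiableAt_lc h1).prodMk (hF'.differentiableAt_lc h1'))
  rw [DifferentiableAt.fderiv_prodMk (hF.differentiableAt_lc h1) (hF'.differentiableAt_lc h1')] at h
  simp only [h1, h1', dlc_mulEx] at h
  rw [dlc_congr (F' := fun x => mulEx E G (lc E (F x), lc E (F' x))), h]
  · ext u; simp [dlc]
  · filter_upwards [hF.eventually_ex_lc h1, hF'.eventually_ex_lc h1'] with x hx hx'
    simp [mulEx, hx, hx']

theorem dlc_inv {F : W → G} {w : W} (hF : HolAt E F w) (h1 : F w = 1) :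
    dlc E (fun x => (F x)⁻¹) w = - dlc E F w := by
  have h := dlc_mul hF h1 hF.inv (by rw [h1, inv_one])
  simp only [mul_inv_cancel, dlc_const] at h
  exact (neg_eq_of_add_eq_zero_right h.symm).symm

/-! ### The adjoint action -/

/-- A bridge from manifold derivatives at 1 to ordinary ones: T_1 G is E, read through the preferred
chart at 1 on both sides. -/
theorem mfderiv_one_eq {Θ : G → G} (hΘ : ContMDiffAt 𝓘(ℂ, E) 𝓘(ℂ, E) ω Θ 1) (h1 : Θ 1 = 1) :
    (mfderiv 𝓘(ℂ, E) 𝓘(ℂ, E) Θ 1 : E →L[ℂ] E) = dlc E (fun u => Θ (ex G u)) (lc E (1 : G)) := by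
  have h2 := (hΘ.mdifferentiableAt (by simp)).mfderiv
  refine h2.trans ?_
  simp only [writtenInExtChartAt, h1]
  simp only [modelWithCornersSelf_coe, Set.range_id, fderivWithin_univ]
  rfl

theorem contMDiffAt_conj (h : G) : ContMDiffAt 𝓘(ℂ, E) 𝓘(ℂ, E) ω (fun x => h * x * h⁻¹) 1 :=
  (contMDiffAt_const.mul contMDiffAt_id).mul contMDiffAt_const

theorem ad_eq (h : G) : (Ad h : E →L[ℂ] E) =
    dlc E (fun u => h * ex G u * h⁻¹) (lc E (1 : G)) :=
  mfderiv_one_eq (contMDiffAt_conj h) (by simp)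

theorem dlc_conj (h : G) {F : W → G} {w : W} (hF : HolAt E F w) (h1 : F w = 1) :
    dlc E (fun x => h * F x * h⁻¹) w = (Ad h : E →L[ℂ] E).comp (dlc E F w) := by
  rw [ad_eq]
  exact dlc_map (Θ := fun x => h * x * h⁻¹)
    (((holAt_const h _).mul holAt_ex).mul (holAt_const h⁻¹ _)) (by simp) hF h1

theorem HolAt.conj (h : G) {F : W → G} {w : W} (hF : HolAt E F w) :
    HolAt E (fun x => h * F x * h⁻¹) w := ((holAt_const h _).mul hF).mul (holAt_const h⁻¹ _)

theorem ad_mul (h k : G) : (Ad (h * k) : E →L[ℂ] E) = (Ad h).comp (Ad k) := by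
  have h1 : k * ex G (lc E (1 : G)) * k⁻¹ = 1 := by simp [ex_lc_one]
  rw [ad_eq k, ← dlc_conj h (holAt_ex.conj k) h1, ad_eq]
  congr 1; funext u; group

theorem ad_one : (Ad (1 : G) : E →L[ℂ] E) = ContinuousLinearMap.id ℂ E := by
  rw [ad_eq, ← dlc_ex (G := G)]; congr 1; funext u; simp

theorem ad_inv_ad (h : G) (v : E) : (Ad h⁻¹ : E →L[ℂ] E) ((Ad h : E →L[ℂ] E) v) = v := by
  have := ad_mul (E := E) h⁻¹ h
  rw [inv_mul_cancel, ad_one] at this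
  exact (DFunLike.congr_fun this v).symm

theorem ad_ad_inv (h : G) (v : E) : (Ad h : E →L[ℂ] E) ((Ad h⁻¹ : E →L[ℂ] E) v) = v := by
  have := ad_mul (E := E) h h⁻¹
  rw [mul_inv_cancel, ad_one] at this
  exact (DFunLike.congr_fun this v).symm

/-- Regroup h⁻¹(x h x⁻¹) as (h⁻¹ x h) x⁻¹: near x = 1 this is a product of two maps through 1, so
the derivatives add. -/
theorem conjVelocity_eq (y : GroupLieAlgebra 𝓘(ℂ, E) G) (h : G) :
    conjVelocity y h = (Ad h⁻¹ : E →L[ℂ] E) y - (show E from y) := by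
  have hc : ContMDiffAt 𝓘(ℂ, E) 𝓘(ℂ, E) ω (fun x : G => h⁻¹ * (x * h * x⁻¹)) 1 :=
    contMDiffAt_const.mul ((contMDiffAt_id.mul contMDiffAt_const).mul contMDiffAt_id.inv)
  have h1 : h⁻¹ * ex G (lc E (1 : G)) * h⁻¹⁻¹ = 1 := by simp [ex_lc_one]
  have h2 : dlc E (fun u => h⁻¹ * (ex G u * h * (ex G u)⁻¹)) (lc E (1 : G)) =
      (Ad h⁻¹ : E →L[ℂ] E) - ContinuousLinearMap.id ℂ E := by
    rw [ad_eq, sub_eq_add_neg, ← dlc_ex (G := G), ← dlc_inv holAt_ex ex_lc_one,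
      ← dlc_mul (holAt_ex.conj h⁻¹) h1 holAt_ex.inv (by rw [ex_lc_one, inv_one])]
    congr 1; funext u; group
  have h3 := mfderiv_one_eq hc (by simp)
  rw [h2] at h3
  exact DFunLike.congr_fun h3 y

end ChartAtOne

/-! ### The Lie bracket as a mixed second derivative of the multiplication. -/

section Bracket

variable {E : Type*} [NormedAddCommGroup E] [NormedSpace ℂ E]
  {G : Type*} [TopologicalSpace G] [ChartedSpace E G] [Group G] [LieGroup 𝓘(ℂ, E) ω G]
  {W W' : Type*} [NormedAddCommGroup W] [NormedSpace ℂ W] [NormedAddCommGroup W'] [NormedSpace ℂ W']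

variable (E G) in
/-- The multiplication in the chart at `1`. -/
def mulChart (p : E × E) : E := lc E (mulEx E G p)

theorem contDiffAt_mulChart : ContDiffAt ℂ ω (mulChart E G) (lc E (1 : G), lc E (1 : G)) :=
  holAt_mulEx.contDiffAt_lc mulEx_one

variable (E G) in
/-- The second derivative of the multiplication with respect to both factors, at `1`. -/
def mulHess : E →L[ℂ] E →L[ℂ] E :=
  fderiv ℂ (fun u => fderiv ℂ (fun x => mulChart E G (u, x)) (lc E (1 : G))) (lc E (1 : G))

variable (E) in
/-- The Lie bracket of `T_1 G`. -/
def lieE (G : Type*) [TopologicalSpace G] [ChartedSpace E G] [Group G] (u v : E) : E :=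
  Bracket.bracket (L := GroupLieAlgebra 𝓘(ℂ, E) G) (M := GroupLieAlgebra 𝓘(ℂ, E) G) u v

theorem contDiffAt_fderiv_mulChart_right :
    ContDiffAt ℂ ω (fun u => fderiv ℂ (fun x => mulChart E G (u, x)) (lc E (1 : G)))
      (lc E (1 : G)) :=
  ContDiffAt.fderiv (f := fun u x => mulChart E G (u, x)) (g := fun _ => lc E (1 : G)) (n := ω)
    contDiffAt_mulChart contDiffAt_const (by simp)

theorem contDiffAt_fderiv_mulChart_left :
    ContDiffAt ℂ ω (fun u => fderiv ℂ (fun x => mulChart E G (x, u)) (lc E (1 : G)))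
      (lc E (1 : G)) :=
  ContDiffAt.fderiv (f := fun u x => mulChart E G (x, u)) (g := fun _ => lc E (1 : G)) (n := ω)
    (x₀ := lc E (1 : G))
    (ContDiffAt.comp (g := mulChart E G) (lc E (1 : G), lc E (1 : G)) contDiffAt_mulChart
      (contDiffAt_snd.prodMk contDiffAt_fst)) contDiffAt_const (by simp)

theorem fderiv_mulChart_one :
    fderiv ℂ (fun x => mulChart E G (lc E (1 : G), x)) (lc E (1 : G)) =
      ContinuousLinearMap.id ℂ E := by
  rw [← dlc_ex (G := G), dlc]
  simp [mulChart, mulEx, ex_lc_one]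

theorem fderiv_mulChart_one' :
    fderiv ℂ (fun x => mulChart E G (x, lc E (1 : G))) (lc E (1 : G)) =
      ContinuousLinearMap.id ℂ E := by
  rw [← dlc_ex (G := G), dlc]
  simp [mulChart, mulEx, ex_lc_one]

/-- Both sides are mixed entries of the second derivative of the multiplication at (1, 1), which is
symmetric. -/
theorem mulHess_swap (u v : E) :
    fderiv ℂ (fun u => fderiv ℂ (fun x => mulChart E G (x, u)) (lc E (1 : G))) (lc E (1 : G)) u v =
      mulHess E G v u := by
  set e := lc E (1 : G)
  have hm : ContDiffAt ℂ ω (mulChart E G) (e, e) := contDiffAt_mulChart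
  have hev : ∀ᶠ p in 𝓝 (e, e), DifferentiableAt ℂ (mulChart E G) p :=
    ((hm.eventually (by simp)).mono fun p hp => hp.differentiableAt (by simp))
  have hd : DifferentiableAt ℂ (fderiv ℂ (mulChart E G)) (e, e) :=
    (hm.fderiv_right (m := ω) (by simp)).differentiableAt (by simp)
  have h1 : (fun u => fderiv ℂ (fun x => mulChart E G (x, u)) e) =ᶠ[𝓝 e]
      fun u => (fderiv ℂ (mulChart E G) (e, u)).comp (ContinuousLinearMap.inl ℂ E E) := by
    have hc : Tendsto (fun u : E => (e, u)) (𝓝 e) (𝓝 (e, e)) :=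
      (Continuous.prodMk_right e).tendsto e
    filter_upwards [hc.eventually hev] with u hu
    rw [fderiv_fun_comp (g := mulChart E G) (f := fun x => (x, u)) e hu (by fun_prop),
      (hasFDerivAt_prodMk_left _ _).fderiv]
  have h2 : (fun u => fderiv ℂ (fun x => mulChart E G (u, x)) e) =ᶠ[𝓝 e]
      fun u => (fderiv ℂ (mulChart E G) (u, e)).comp (ContinuousLinearMap.inr ℂ E E) := by
    have hc : Tendsto (fun u : E => (u, e)) (𝓝 e) (𝓝 (e, e)) :=
      (Continuous.prodMk_left e).tendsto e
    filter_upwards [hc.eventually hev] with u hu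
    rw [fderiv_fun_comp (g := mulChart E G) (f := fun x => (u, x)) e hu (by fun_prop),
      (hasFDerivAt_prodMk_right _ _).fderiv]
  have h3 : HasFDerivAt (fun u => fderiv ℂ (mulChart E G) (e, u)) _ e :=
    HasFDerivAt.comp (g := fderiv ℂ (mulChart E G)) e hd.hasFDerivAt (hasFDerivAt_prodMk_right e e)
  have h4 : HasFDerivAt (fun u => fderiv ℂ (mulChart E G) (u, e)) _ e :=
    HasFDerivAt.comp (g := fderiv ℂ (mulChart E G)) e hd.hasFDerivAt (hasFDerivAt_prodMk_left e e)
  rw [mulHess, h1.fderiv_eq, h2.fderiv_eq,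
    (h3.clm_comp (hasFDerivAt_const (ContinuousLinearMap.inl ℂ E E) e)).fderiv,
    (h4.clm_comp (hasFDerivAt_const (ContinuousLinearMap.inr ℂ E E) e)).fderiv]
  have hs : IsSymmSndFDerivAt ℂ (mulChart E G) (e, e) := hm.isSymmSndFDerivAt (by simp)
  simpa using hs (0, u) (v, 0)

/-- In the chart, the left-invariant field of v is the derivative of the multiplication in its
second factor, applied to v. -/
theorem mpullbackWithin_mulInvariantVectorField (v : GroupLieAlgebra 𝓘(ℂ, E) G) {u : E}
    (hu : u ∈ (extChartAt 𝓘(ℂ, E) (1 : G)).target) :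
    VectorField.mpullbackWithin 𝓘(ℂ, E) 𝓘(ℂ, E) (extChartAt 𝓘(ℂ, E) (1 : G)).symm
      (mulInvariantVectorField v) (Set.range 𝓘(ℂ, E)) u =
      (fderiv ℂ (fun x => mulChart E G (u, x)) (lc E (1 : G)) v : E) := by
  have : IsManifold 𝓘(ℂ, E) ω G := (inferInstance : LieGroup 𝓘(ℂ, E) ω G).toContMDiffMul.toIsManifold
  have : IsManifold 𝓘(ℂ, E) 1 G := .of_le (n := ω) le_top
  rw [VectorField.mpullbackWithin_apply, ContinuousLinearMap.inverse_eq
    (mfderivWithin_extChartAt_symm_comp_mfderiv_extChartAt hu)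
    (mfderiv_extChartAt_comp_mfderivWithin_extChartAt_symm hu), mulInvariantVectorField]
  have hmul : MDifferentiableAt 𝓘(ℂ, E) 𝓘(ℂ, E) (fun g : G => ex G u * g) 1 :=
    (contMDiff_mul_left (I := 𝓘(ℂ, E)) (n := ω)).contMDiffAt.mdifferentiableAt (by simp)
  have hsrc : ex G u * 1 ∈ (chartAt E (1 : G)).source := by
    rw [mul_one, ← extChartAt_source 𝓘(ℂ, E)]
    exact (extChartAt 𝓘(ℂ, E) (1 : G)).map_target hu
  have hlc : MDifferentiableAt 𝓘(ℂ, E) 𝓘(ℂ, E) (extChartAt 𝓘(ℂ, E) (1 : G)) (ex G u * 1) :=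
    mdifferentiableAt_extChartAt hsrc
  have h1 := mfderiv_comp (I' := 𝓘(ℂ, E)) (1 : G) hlc hmul
  have h2 := (hlc.comp (1 : G) hmul).mfderiv
  rw [h1] at h2
  have h3 := DFunLike.congr_fun h2 v
  simp only [modelWithCornersSelf_coe, Set.range_id, fderivWithin_univ] at h3
  have key (z : G) (hz : z = ex G u * 1) :
      (mfderiv 𝓘(ℂ, E) 𝓘(ℂ, E) (extChartAt 𝓘(ℂ, E) (1 : G)) z : E →L[ℂ] E)
        (mfderiv 𝓘(ℂ, E) 𝓘(ℂ, E) (fun g : G => ex G u * g) 1 v : E) =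
      (fderiv ℂ (fun x => mulChart E G (u, x)) (lc E (1 : G)) v : E) := by
    subst hz
    exact h3
  exact key _ (mul_one _).symm

theorem lieE_eq (v w : E) : lieE E G v w = mulHess E G v w - mulHess E G w v := by
  have : IsManifold 𝓘(ℂ, E) ω G := (inferInstance : LieGroup 𝓘(ℂ, E) ω G).toContMDiffMul.toIsManifold
  have : IsManifold 𝓘(ℂ, E) 1 G := .of_le (n := ω) le_top
  -- The preferred chart has identity derivative at its centre, so the inverse derivative in the
  -- definition of the manifold bracket disappears.
  have hself : (mfderiv 𝓘(ℂ, E) 𝓘(ℂ, E) (extChartAt 𝓘(ℂ, E) (1 : G)) 1 : E →L[ℂ] E) =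
      ContinuousLinearMap.id ℂ E := mfderiv_extChartAt_self
  have hinv := (congrArg (ContinuousLinearMap.inverse (R := ℂ) (M := E) (M₂ := E)) hself).trans
    ContinuousLinearMap.inverse_id
  refine (VectorField.mlieBracketWithin_apply (s := Set.univ)).trans
    ((DFunLike.congr_fun hinv _).trans ?_)
  set e := lc E (1 : G)
  let P (v : E) : E → E := VectorField.mpullbackWithin 𝓘(ℂ, E) 𝓘(ℂ, E)
    (extChartAt 𝓘(ℂ, E) (1 : G)).symm (mulInvariantVectorField (G := G) v) (Set.range 𝓘(ℂ, E))
  have hpull (v : E) : P v =ᶠ[𝓝 e] fun u => fderiv ℂ (fun x => mulChart E G (u, x)) e v := by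
    filter_upwards [extChartAt_target_mem_nhds (I := 𝓘(ℂ, E)) (1 : G)] with u hu
    exact mpullbackWithin_mulInvariantVectorField _ hu
  have hd : DifferentiableAt ℂ (fun u => fderiv ℂ (fun x => mulChart E G (u, x)) e) e :=
    contDiffAt_fderiv_mulChart_right.differentiableAt (by simp)
  have hlie : VectorField.lieBracket ℂ (V := fun u => fderiv ℂ (fun x => mulChart E G (u, x)) e v)
      (W := fun u => fderiv ℂ (fun x => mulChart E G (u, x)) e w) e =
      mulHess E G v w - mulHess E G w v := by
    rw [VectorField.lieBracket_eq, mulHess]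
    simp only
    rw [fderiv_clm_apply hd (differentiableAt_const _), fderiv_clm_apply hd (differentiableAt_const _),
      fderiv_mulChart_one]
    simp [e]
  rw [← hlie, ← (hpull v).lieBracket_vectorField_eq (hpull w)]
  have huniv : VectorField.lieBracketWithin ℂ (P v) (P w)
      ((extChartAt 𝓘(ℂ, E) (1 : G)).symm ⁻¹' Set.univ ∩ Set.range 𝓘(ℂ, E)) e =
      VectorField.lieBracket ℂ (P v) (P w) e := by
    simp only [Set.preimage_univ, Set.univ_inter, modelWithCornersSelf_coe, Set.range_id,
      VectorField.lieBracketWithin_univ]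
  exact huniv

end Bracket

/-! ### Derivative of Ad and the Maurer-Cartan equation. -/

section AdDerivative

variable {E : Type*} [NormedAddCommGroup E] [NormedSpace ℂ E]
  {G : Type*} [TopologicalSpace G] [ChartedSpace E G] [Group G] [LieGroup 𝓘(ℂ, E) ω G]
  {W W' : Type*} [NormedAddCommGroup W] [NormedSpace ℂ W] [NormedAddCommGroup W'] [NormedSpace ℂ W']

theorem HolAt.contDiffAt_ad {f : W → G} {x : W} (hf : HolAt E f x) :
    ContDiffAt ℂ ω (fun x => (Ad (f x) : E →L[ℂ] E)) x := by
  simp only [ad_eq, dlc]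
  have h : HolAt E (fun p : W × E => f p.1 * ex G p.2 * (f p.1)⁻¹) (x, lc E (1 : G)) :=
    have h1 : HolAt E (fun p : W × E => f p.1) (x, lc E (1 : G)) :=
      HolAt.comp (p := Prod.fst) hf contDiffAt_fst
    (h1.mul (HolAt.comp (p := Prod.snd) holAt_ex contDiffAt_snd)).mul h1.inv
  exact ContDiffAt.fderiv (f := fun x u => lc E (f x * ex G u * (f x)⁻¹))
    (g := fun _ => lc E (1 : G)) (n := ω) (h.contDiffAt_lc (by simp [ex_lc_one]))
    contDiffAt_const (by simp)

variable (E) in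
/-- The left logarithmic derivative `f⁻¹ df`. -/
def logDeriv (f : W → G) (x : W) : W →L[ℂ] E := dlc E (fun z => (f x)⁻¹ * f z) x

theorem HolAt.contDiffAt_logDeriv {f : W → G} {x : W} (hf : HolAt E f x) :
    ContDiffAt ℂ ω (logDeriv E f) x := by
  have h : HolAt E (fun p : W × W => (f p.1)⁻¹ * f p.2) (x, x) :=
    (HolAt.comp (p := Prod.fst) hf contDiffAt_fst).inv.mul
      (HolAt.comp (p := Prod.snd) hf contDiffAt_snd)
  exact ContDiffAt.fderiv (f := fun x z => lc E ((f x)⁻¹ * f z))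
    (g := fun x => x) (n := ω) (h.contDiffAt_lc (by simp))
    contDiffAt_id (by simp)

theorem logDeriv_of_eq_one {f : W → G} {x : W} (h1 : f x = 1) :
    logDeriv E f x = dlc E f x := by
  simp [logDeriv, h1]

theorem logDeriv_comp {F : W → G} {p : W' → W} {w : W'} (hF : HolAt E F (p w))
    (hp : DifferentiableAt ℂ p w) :
    logDeriv E (fun w => F (p w)) w = (logDeriv E F (p w)).comp (fderiv ℂ p w) :=
  dlc_comp (F := fun z => (F (p w))⁻¹ * F z) ((holAt_const _ _).mul hF) (by simp) hp

/-- Differentiate (u x u⁻¹) u = u x in x at 1: the left-factor derivative of the multiplication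
composed with Ad u is its right-factor derivative. Differentiating this in u at 1 expresses d(Ad) as
the antisymmetrised mixed second derivative. -/
theorem fderiv_ad_ex (u v : E) :
    fderiv ℂ (fun u => (Ad (ex G u) : E →L[ℂ] E)) (lc E (1 : G)) u v = lieE E G u v := by
  set e := lc E (1 : G) with he
  have hQ : ∀ᶠ u in 𝓝 e, (fderiv ℂ (fun x => mulChart E G (x, u)) e).comp (Ad (ex G u) : E →L[ℂ] E) =
      fderiv ℂ (fun x => mulChart E G (u, x)) e := by
    have hc : Tendsto (fun u : E => (e, u)) (𝓝 e) (𝓝 (e, e)) :=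
      (Continuous.prodMk_right e).tendsto e
    have hev := hc.eventually (contDiffAt_mulChart (E := E) (G := G).eventually (by simp))
    filter_upwards [hev, holAt_ex.eventually] with u hu hu'
    have h1 : HolAt E (fun x => ex G u * ex G x * (ex G u)⁻¹) e :=
      ((holAt_const _ _).mul holAt_ex).mul (holAt_const _ _)
    have h2 : ex G u * ex G e * (ex G u)⁻¹ = 1 := by simp [e, ex_lc_one]
    rw [ad_eq, dlc]
    have h3 : DifferentiableAt ℂ (fun x => mulChart E G (x, u))
        (lc E (ex G u * ex G e * (ex G u)⁻¹)) := by
      rw [h2]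
      exact DifferentiableAt.comp (g := mulChart E G) _ (hu.differentiableAt (by simp))
        (by fun_prop)
    have h4 := fderiv_fun_comp (g := fun x => mulChart E G (x, u))
      (f := fun x => lc E (ex G u * ex G x * (ex G u)⁻¹)) e h3 (h1.differentiableAt_lc h2)
    rw [h2] at h4
    rw [← h4]
    refine Filter.EventuallyEq.fderiv_eq ?_
    filter_upwards [h1.eventually_ex_lc h2] with x hx
    simp [mulChart, mulEx, hx]
  have hQd : DifferentiableAt ℂ (fun u => fderiv ℂ (fun x => mulChart E G (x, u)) e) e :=
    contDiffAt_fderiv_mulChart_left.differentiableAt (by simp)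
  have hAd : DifferentiableAt ℂ (fun u => (Ad (ex G u) : E →L[ℂ] E)) e :=
    (holAt_ex.contDiffAt_ad).differentiableAt (by simp)
  have h5 := Filter.EventuallyEq.fderiv_eq (𝕜 := ℂ) hQ
  rw [fderiv_clm_comp hQd hAd] at h5
  have h6 := DFunLike.congr_fun (DFunLike.congr_fun h5 u) v
  have h7 := mulHess_swap (G := G) u v
  rw [lieE_eq, ← h7, eq_sub_iff_add_eq, mulHess]
  simpa [fderiv_mulChart_one', e, ex_lc_one, ad_one] using h6

/-- Writing Ad(f z) = Ad(f x) Ad(f(x)⁻¹ f(z)) reduces to the derivative of Ad at 1. -/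
theorem HolAt.fderiv_ad {f : W → G} {x : W} (hf : HolAt E f x) (w : W) (v : E) :
    fderiv ℂ (fun x => (Ad (f x) : E →L[ℂ] E)) x w v =
      (Ad (f x) : E →L[ℂ] E) (lieE E G (logDeriv E f x w) v) := by
  have hk : HolAt E (fun z => (f x)⁻¹ * f z) x := (holAt_const _ _).mul hf
  have h1 : (f x)⁻¹ * f x = 1 := inv_mul_cancel _
  have he : (fun z => (Ad (f z) : E →L[ℂ] E)) =ᶠ[𝓝 x] fun z =>
      (Ad (f x) : E →L[ℂ] E).comp (Ad (ex G (lc E ((f x)⁻¹ * f z)))) := by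
    filter_upwards [hk.eventually_ex_lc h1] with z hz
    rw [hz, ← ad_mul, mul_inv_cancel_left]
  have hAd : DifferentiableAt ℂ (fun u => (Ad (ex G u) : E →L[ℂ] E)) (lc E ((f x)⁻¹ * f x)) := by
    rw [h1]; exact (holAt_ex.contDiffAt_ad).differentiableAt (by simp)
  have hkd := hk.differentiableAt_lc h1
  have hcomp : DifferentiableAt ℂ (fun z => (Ad (ex G (lc E ((f x)⁻¹ * f z))) : E →L[ℂ] E)) x :=
    DifferentiableAt.comp (g := fun u => (Ad (ex G u) : E →L[ℂ] E)) x hAd hkd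
  have h4 := fderiv_fun_comp (g := fun u => (Ad (ex G u) : E →L[ℂ] E))
    (f := fun z => lc E ((f x)⁻¹ * f z)) x hAd hkd
  rw [he.fderiv_eq, fderiv_clm_comp (differentiableAt_const _) hcomp, h4, h1]
  simp [fderiv_ad_ex, logDeriv, dlc]

/-- Differentiate Ad(h x h⁻¹) = Ad h ∘ Ad x ∘ Ad h⁻¹ at x = 1 and evaluate at Ad h v. -/
theorem ad_lie (h : G) (u v : E) :
    (Ad h : E →L[ℂ] E) (lieE E G u v) = lieE E G ((Ad h : E →L[ℂ] E) u) ((Ad h : E →L[ℂ] E) v) := by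
  set e := lc E (1 : G) with he
  have hf : HolAt E (fun x => h * ex G x * h⁻¹) e := holAt_ex.conj h
  have h1 : h * ex G e * h⁻¹ = 1 := by simp [e, ex_lc_one]
  have h2 := hf.fderiv_ad u ((Ad h : E →L[ℂ] E) v)
  rw [logDeriv_of_eq_one (f := fun x => h * ex G x * h⁻¹) h1, he, ← ad_eq, ← he] at h2
  simp only [h1] at h2
  rw [ad_one (E := E), ContinuousLinearMap.id_apply] at h2
  rw [← h2]
  have hAd : DifferentiableAt ℂ (fun u => (Ad (ex G u) : E →L[ℂ] E)) e :=
    (holAt_ex.contDiffAt_ad).differentiableAt (by simp)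
  have h3 : (fun x : E => (Ad (h * ex G x * h⁻¹) : E →L[ℂ] E)) = fun x : E =>
      (Ad h : E →L[ℂ] E).comp ((Ad (ex G x) : E →L[ℂ] E).comp (Ad h⁻¹)) := by
    funext x; rw [ad_mul, ad_mul, ContinuousLinearMap.comp_assoc]
  rw [h3, fderiv_clm_comp (differentiableAt_const (Ad h : E →L[ℂ] E)) (hAd.clm_comp (differentiableAt_const (Ad h⁻¹ : E →L[ℂ] E))),
    fderiv_clm_comp hAd (differentiableAt_const (Ad h⁻¹ : E →L[ℂ] E))]
  simp [ad_inv_ad, e, fderiv_ad_ex]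

/-- The Maurer–Cartan equation. -/
theorem HolAt.maurerCartan {f : W → G} {x : W} (hf : HolAt E f x) (a c : W) :
    fderiv ℂ (logDeriv E f) x a c - fderiv ℂ (logDeriv E f) x c a +
      lieE E G (logDeriv E f x a) (logDeriv E f x c) = 0 := by
  set e := lc E (1 : G) with he
  have hk : HolAt E (fun z => (f x)⁻¹ * f z) x := (holAt_const _ _).mul hf
  have h1 : (f x)⁻¹ * f x = 1 := inv_mul_cancel _
  set K : W → E := fun z => lc E ((f x)⁻¹ * f z) with hK
  have hKx : K x = e := by simp [K, e]
  have hKc : ContDiffAt ℂ ω K x := hk.contDiffAt_lc h1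
  have hm : ∀ᶠ u in 𝓝 (K x), ContDiffAt ℂ ω (mulChart E G) (u, e) := by
    have hc : Tendsto (fun u : E => (u, e)) (𝓝 e) (𝓝 (e, e)) :=
      (Continuous.prodMk_left e).tendsto e
    rw [hKx]
    exact hc.eventually (contDiffAt_mulChart (E := E) (G := G).eventually (by simp))
  -- Factor f(x)⁻¹ f(z) as (f(x)⁻¹ f(y)) (f(y)⁻¹ f(z)) and differentiate in z at y.
  have hdK : fderiv ℂ K =ᶠ[𝓝 x] fun y =>
      (fderiv ℂ (fun z => mulChart E G (K y, z)) e).comp (logDeriv E f y) := by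
    filter_upwards [hf.eventually, hKc.continuousAt.eventually hm, hk.eventually_ex_lc h1]
      with y hy hmy hKy
    have hl : HolAt E (fun z => (f y)⁻¹ * f z) y := (holAt_const _ _).mul hy
    have hl1 : (f y)⁻¹ * f y = 1 := inv_mul_cancel _
    have h3 : DifferentiableAt ℂ (fun z => mulChart E G (K y, z)) (lc E ((f y)⁻¹ * f y)) := by
      rw [hl1]
      exact DifferentiableAt.comp (g := mulChart E G) _ (hmy.differentiableAt (by simp))
        (by fun_prop)
    have h4 := fderiv_fun_comp (g := fun z => mulChart E G (K y, z))
      (f := fun z => lc E ((f y)⁻¹ * f z)) y h3 (hl.differentiableAt_lc hl1)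
    rw [hl1] at h4
    rw [logDeriv, dlc, ← h4]
    refine Filter.EventuallyEq.fderiv_eq ?_
    filter_upwards [hl.eventually_ex_lc hl1] with z hz
    simp [mulChart, mulEx, hz, K, hKy, mul_assoc]
  have hP : DifferentiableAt ℂ (fun u => fderiv ℂ (fun z => mulChart E G (u, z)) e) (K x) := by
    rw [hKx]; exact contDiffAt_fderiv_mulChart_right.differentiableAt (by simp)
  have hKd : DifferentiableAt ℂ K x := hKc.differentiableAt (by simp)
  have hL : DifferentiableAt ℂ (logDeriv E f) x := hf.contDiffAt_logDeriv.differentiableAt (by simp)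
  have h5 := hdK.fderiv_eq (𝕜 := ℂ)
  have hPK : DifferentiableAt ℂ (fun y => fderiv ℂ (fun z => mulChart E G (K y, z)) e) x :=
    hP.comp x hKd
  rw [fderiv_clm_comp hPK hL,
    fderiv_fun_comp (g := fun u => fderiv ℂ (fun z => mulChart E G (u, z)) e) x hP hKd, hKx,
    fderiv_mulChart_one] at h5
  -- The second derivative of K at x is the derivative of the logarithmic derivative plus a
  -- `mulHess` term; its symmetry is the Maurer-Cartan equation.
  have hs : IsSymmSndFDerivAt ℂ K x := hKc.isSymmSndFDerivAt (by simp)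
  have h6 := hs a c
  have h7 : fderiv ℂ K x = logDeriv E f x := rfl
  rw [h5, h7] at h6
  simp only [add_apply, ContinuousLinearMap.comp_apply,
    ContinuousLinearMap.compL_apply, ContinuousLinearMap.flip_apply,
    ContinuousLinearMap.id_apply] at h6
  change _ + mulHess E G _ _ = _ + mulHess E G _ _ at h6
  rw [lieE_eq]
  rw [← sub_eq_zero] at h6
  rw [← h6]
  abel

end AdDerivative

/-! ### Gauge data checked on constants. -/

section OfConst

variable {𝔤 : Type*} [LieRing 𝔤] [LieAlgebra ℂ 𝔤] [FiniteDimensional ℂ 𝔤]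
  {𝔩 : LieSubalgebra ℂ 𝔤} {d : ℕ}
  {b : Module.Basis (Fin d) ℂ 𝔩} {A B : FormalFun d (𝔤 →ₗ[ℂ] 𝔤)} {η : Fin d → FormalFun d 𝔤}

theorem app_apply_const (v : 𝔤) : app A (const v) = fun n => A n v := bilin_const_right _ _ _

theorem GaugeData.of_const
    (left_inv : ∀ v, app B (app A (const v)) = const v)
    (right_inv : ∀ v, app A (app B (const v)) = const v)
    (app_br : ∀ v w, app A (br (const v) (const w)) = br (app A (const v)) (app A (const w)))
    (pderiv_app : ∀ i v, pderiv i (app A (const v)) = app A (br (η i) (const v)))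
    (flat : ∀ i j, pderiv i (η j) - pderiv j (η i) + br (η i) (η j) = 0)
    (contract : ∀ y : 𝔩, contractCoad b y η = app B (cst d y) - cst d y) :
    GaugeData b A B η where
  left_inv u := by induction u using FormalFun.const_induction <;> simp_all
  right_inv u := by induction u using FormalFun.const_induction <;> simp_all
  app_br u v := by
    induction u using FormalFun.const_induction with
    | add => simp_all
    | smul => simp_all
    | const u =>
    induction v using FormalFun.const_induction with
    | add => simp_all
    | smul => simp_all
    | const v => exact app_br u v
  pderiv_app i u := by
    -- The identity ∂_i A = A ∘ ad η_i is linear over power series and so extends from constants;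
    -- the product rule adds the derivative of u.
    have h (u : FormalFun d 𝔤) : app (pderiv i A) u = app A (br (η i) u) := by
      induction u using FormalFun.const_induction with
      | add => simp_all
      | smul => simp_all
      | const u => rw [← pderiv_app, app_apply_const, app_apply_const]; rfl
    rw [map_add, ← h, add_comm]
    exact pderiv_map₂ _ _ _ _
  flat := flat
  contract := contract

end OfConst

/-! ### The logarithmic derivative in manifold terms and in the chart at 1. -/

section LogDeriv

variable {E : Type*} [NormedAddCommGroup E] [NormedSpace ℂ E]
  {G : Type*} [TopologicalSpace G] [ChartedSpace E G] [Group G] [LieGroup 𝓘(ℂ, E) ω G] {d : ℕ}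

theorem HolAt.leftLogDeriv_eq {f : (Fin d → ℂ) → G} {x : Fin d → ℂ} (hf : HolAt E f x) (i : Fin d) :
    leftLogDeriv f i x = logDeriv E f x (Pi.single i 1) := by
  have h1 : MDifferentiableAt 𝓘(ℂ, Fin d → ℂ) 𝓘(ℂ, E) f x :=
    ContMDiffAt.mdifferentiableAt hf (by simp)
  have h2 : MDifferentiableAt 𝓘(ℂ, E) 𝓘(ℂ, E) (fun h : G => (f x)⁻¹ * h) (f x) :=
    (contMDiff_mul_left (I := 𝓘(ℂ, E)) (n := ω)).contMDiffAt.mdifferentiableAt (by simp)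
  have h3 := mfderiv_comp (I' := 𝓘(ℂ, E)) x h2 h1
  have h4 := (h2.comp x h1).mfderiv
  rw [h3] at h4
  refine (DFunLike.congr_fun h4 (Pi.single i (1 : ℂ) : Fin d → ℂ)).trans ?_
  simp only [writtenInExtChartAt, Function.comp_apply, inv_mul_cancel, modelWithCornersSelf_coe,
    Set.range_id, fderivWithin_univ]
  rfl

end LogDeriv

/-! ### Dependence on finite jets of the formal map. -/

section Jets

variable {E : Type*} [NormedAddCommGroup E] [NormedSpace ℂ E]
  {G : Type*} [TopologicalSpace G] [ChartedSpace E G] [Group G] [LieGroup 𝓘(ℂ, E) ω G] {d : ℕ}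
  (g : FormalMap d E G)

theorem FormalMap.holAt_chart_symm :
    HolAt E (extChartAt 𝓘(ℂ, E) g.base).symm (extChartAt 𝓘(ℂ, E) g.base g.base) :=
  holAt_extChartAt_symm _ (mem_extChartAt_target _)

variable [CompleteSpace E]

omit [Group G] [LieGroup 𝓘(ℂ, E) ω G] in
theorem truncation_coeff_zero (N : ℕ) :
    truncation g.coeff N 0 = extChartAt 𝓘(ℂ, E) g.base g.base := by
  rw [truncation_zero, g.coeff_zero]

theorem FormalMap.holAt_approx (N : ℕ) : HolAt E (g.approx N) 0 :=
  HolAt.comp (F := (extChartAt 𝓘(ℂ, E) g.base).symm) (p := truncation g.coeff N)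
    (by rw [truncation_coeff_zero]; exact g.holAt_chart_symm)
    (analyticAt_truncation _ _ _).contDiffAt

theorem HolAt.analyticAt_ad {f : (Fin d → ℂ) → G} {x : Fin d → ℂ} (hf : HolAt E f x) :
    AnalyticAt ℂ (fun x => (Ad (f x) : E →L[ℂ] E)) x := hf.contDiffAt_ad.analyticAt

theorem HolAt.leftLogDeriv_eventuallyEq {f : (Fin d → ℂ) → G} {x : Fin d → ℂ} (hf : HolAt E f x)
    (i : Fin d) : leftLogDeriv f i =ᶠ[𝓝 x] fun x => logDeriv E f x (Pi.single i 1) := by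
  filter_upwards [hf.eventually] with y hy
  exact hy.leftLogDeriv_eq i

theorem HolAt.analyticAt_leftLogDeriv {f : (Fin d → ℂ) → G} {x : Fin d → ℂ} (hf : HolAt E f x)
    (i : Fin d) : AnalyticAt ℂ (leftLogDeriv f i : (Fin d → ℂ) → E) x := by
  refine AnalyticAt.congr ?_ (hf.leftLogDeriv_eventuallyEq i).symm
  exact (hf.contDiffAt_logDeriv.clm_apply contDiffAt_const).analyticAt

theorem FormalMap.eqUpTo_taylor_comp_truncation {Φ : E → E →L[ℂ] E}
    (hΦ : AnalyticAt ℂ Φ (extChartAt 𝓘(ℂ, E) g.base g.base)) {k N M : ℕ}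
    (hN : k ≤ N) (hM : k ≤ M) :
    EqUpTo k (taylor fun x => Φ (truncation g.coeff N x))
      (taylor fun x => Φ (truncation g.coeff M x)) :=
  eqUpTo_taylor_comp k (analyticAt_truncation _ _ _) (analyticAt_truncation _ _ _)
    (eqUpTo_taylor_truncation_of_le g.coeff hN hM) (by rw [truncation_coeff_zero]; exact hΦ)

theorem FormalMap.eqUpTo_taylor_ad {k N M : ℕ} (hN : k ≤ N) (hM : k ≤ M) :
    EqUpTo k (taylor fun x => (Ad (g.approx N x) : E →L[ℂ] E))
      (taylor fun x => (Ad (g.approx M x) : E →L[ℂ] E)) :=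
  g.eqUpTo_taylor_comp_truncation g.holAt_chart_symm.contDiffAt_ad.analyticAt hN hM

theorem FormalMap.eqUpTo_taylor_ad_inv {k N M : ℕ} (hN : k ≤ N) (hM : k ≤ M) :
    EqUpTo k (taylor fun x => (Ad (g.approx N x)⁻¹ : E →L[ℂ] E))
      (taylor fun x => (Ad (g.approx M x)⁻¹ : E →L[ℂ] E)) :=
  g.eqUpTo_taylor_comp_truncation g.holAt_chart_symm.inv.contDiffAt_ad.analyticAt hN hM

/-- The chain rule isolates the truncation p: a fixed analytic function of p applied to ∂_i p. The
single derivative of p is why η at order k needs the jet of order k + 1. -/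
theorem FormalMap.taylor_leftLogDeriv_approx (N : ℕ) (i : Fin d) :
    taylor (leftLogDeriv (E := E) (g.approx N) i) =
      map₂ (ContinuousLinearMap.id ℂ (E →L[ℂ] E)).toLinearMap₁₂
        (taylor fun x => logDeriv E (extChartAt 𝓘(ℂ, E) g.base).symm (truncation g.coeff N x))
        (pderiv i (taylor (truncation g.coeff N))) := by
  have hp : AnalyticAt ℂ (truncation g.coeff N) 0 := analyticAt_truncation _ _ _
  have hσ : HolAt E (extChartAt 𝓘(ℂ, E) g.base).symm (truncation g.coeff N 0) := by
    rw [truncation_coeff_zero]; exact g.holAt_chart_symm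
  have hl : AnalyticAt ℂ (fun x => logDeriv E (extChartAt 𝓘(ℂ, E) g.base).symm
      (truncation g.coeff N x)) 0 :=
    AnalyticAt.comp (g := logDeriv E (extChartAt 𝓘(ℂ, E) g.base).symm)
      hσ.contDiffAt_logDeriv.analyticAt hp
  rw [pderiv_taylor hp, ← taylor_bilin _ hl (analyticAt_partialDeriv hp i)]
  refine taylor_congr (((g.holAt_approx N).leftLogDeriv_eventuallyEq i).trans ?_)
  filter_upwards [hp.continuousAt.eventually hσ.eventually] with x hx
  have := logDeriv_comp (F := (extChartAt 𝓘(ℂ, E) g.base).symm) hx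
    (analyticAt_truncation g.coeff N x).differentiableAt
  exact DFunLike.congr_fun this _

theorem FormalMap.eqUpTo_taylor_leftLogDeriv {k N M : ℕ} (hN : k + 1 ≤ N) (hM : k + 1 ≤ M)
    (i : Fin d) : EqUpTo k (taylor (leftLogDeriv (E := E) (g.approx N) i))
      (taylor (leftLogDeriv (E := E) (g.approx M) i)) := by
  rw [g.taylor_leftLogDeriv_approx, g.taylor_leftLogDeriv_approx]
  refine EqUpTo.map₂ _ ?_ ((eqUpTo_taylor_truncation_of_le g.coeff hN hM).pderiv i)
  exact g.eqUpTo_taylor_comp_truncation g.holAt_chart_symm.contDiffAt_logDeriv.analyticAt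
    (by omega) (by omega)

end Jets

theorem eq_of_eqUpTo {d : ℕ} {V : Type*} [AddCommGroup V] [Module ℂ V] {f g : FormalFun d V}
    (h : ∀ N, EqUpTo N f g) : f = g := funext fun n => h _ n le_rfl

/-! ### Formal identities obtained from holomorphic germs. -/

section FormalIdentities

variable {E : Type*} [NormedAddCommGroup E] [NormedSpace ℂ E]
  {G : Type*} [TopologicalSpace G] [ChartedSpace E G] [Group G]
  {d : ℕ} (g : FormalMap d E G)

/-- The formal function `Ad g`, with values in the continuous endomorphisms of `T_1 G`. -/
def FormalMap.adSeries : FormalFun d (E →L[ℂ] E) :=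
  fun n => taylorCoeff (fun x => (Ad (g.approx n.degree x) : E →L[ℂ] E)) n

/-- The formal function `Ad g⁻¹`, with values in the continuous endomorphisms of `T_1 G`. -/
def FormalMap.adInvSeries : FormalFun d (E →L[ℂ] E) :=
  fun n => taylorCoeff (fun x => (Ad (g.approx n.degree x)⁻¹ : E →L[ℂ] E)) n

/-- The components of the formal 1-form `g⁻¹ dg`, with values in the model space of `T_1 G`. -/
def FormalMap.logDerivSeries (i : Fin d) : FormalFun d E :=
  fun n => taylorCoeff (leftLogDeriv (E := E) (g.approx (n.degree + 1)) i) n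

variable (E) in
/-- The evaluation of continuous endomorphisms. -/
abbrev evalEnd : (E →L[ℂ] E) →ₗ[ℂ] E →ₗ[ℂ] E :=
  (ContinuousLinearMap.id ℂ (E →L[ℂ] E)).toLinearMap₁₂

variable (E G) in
/-- The Lie bracket of `T_1 G`, as a continuous bilinear map. -/
def lieCLM : E →L[ℂ] E →L[ℂ] E := mulHess E G - (mulHess E G).flip

variable [LieGroup 𝓘(ℂ, E) ω G]

theorem lieCLM_apply (u v : E) : lieCLM E G u v = lieE E G u v := by
  rw [lieE_eq]; rfl

variable [CompleteSpace E]

/-- The defining truncation varies with the degree of the coefficient; up to order N it can be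
replaced by one germ, to which identities of holomorphic maps apply. -/
theorem FormalMap.eqUpTo_adSeries (N : ℕ) :
    EqUpTo N g.adSeries (taylor fun x => (Ad (g.approx N x) : E →L[ℂ] E)) :=
  fun n hn => g.eqUpTo_taylor_ad le_rfl hn n le_rfl

theorem FormalMap.eqUpTo_adInvSeries (N : ℕ) :
    EqUpTo N g.adInvSeries (taylor fun x => (Ad (g.approx N x)⁻¹ : E →L[ℂ] E)) :=
  fun n hn => g.eqUpTo_taylor_ad_inv le_rfl hn n le_rfl

theorem FormalMap.eqUpTo_logDerivSeries (N : ℕ) (i : Fin d) :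
    EqUpTo N (g.logDerivSeries i) (taylor (leftLogDeriv (E := E) (g.approx (N + 1)) i)) :=
  fun n hn => g.eqUpTo_taylor_leftLogDeriv le_rfl (Nat.succ_le_succ hn) i n le_rfl

theorem taylor_clm_apply {F : (Fin d → ℂ) → E →L[ℂ] E} (hF : AnalyticAt ℂ F 0) (v : E) :
    taylor (fun x => F x v) = fun n => taylor F n v :=
  taylor_clm (ContinuousLinearMap.apply ℂ E v) hF

theorem analyticAt_clm_apply {F : (Fin d → ℂ) → E →L[ℂ] E} (hF : AnalyticAt ℂ F 0) (v : E) :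
    AnalyticAt ℂ (fun x => F x v) 0 :=
  ((ContinuousLinearMap.apply ℂ E v).analyticAt _).comp hF

theorem FormalMap.eqUpTo_adSeries_apply (N : ℕ) (v : E) :
    EqUpTo N (fun n => g.adSeries n v : FormalFun d E)
      (taylor fun x => (Ad (g.approx N x) : E →L[ℂ] E) v) := by
  rw [taylor_clm_apply (g.holAt_approx N).analyticAt_ad]
  intro n hn
  simp only [g.eqUpTo_adSeries N n hn]

theorem FormalMap.eqUpTo_adInvSeries_apply (N : ℕ) (v : E) :
    EqUpTo N (fun n => g.adInvSeries n v : FormalFun d E)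
      (taylor fun x => (Ad (g.approx N x)⁻¹ : E →L[ℂ] E) v) := by
  rw [taylor_clm_apply (g.holAt_approx N).inv.analyticAt_ad]
  intro n hn
  simp only [g.eqUpTo_adInvSeries N n hn]

theorem FormalMap.adInvSeries_adSeries (v : E) :
    map₂ (evalEnd E) g.adInvSeries (fun n => g.adSeries n v) = const v := by
  refine eq_of_eqUpTo fun N n hn => ?_
  rw [EqUpTo.map₂ (evalEnd E) (g.eqUpTo_adInvSeries N) (g.eqUpTo_adSeries_apply N v) n hn,
    ← taylor_bilin _ (g.holAt_approx N).inv.analyticAt_ad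
      (analyticAt_clm_apply (g.holAt_approx N).analyticAt_ad v)]
  simp only [ContinuousLinearMap.id_apply, ad_inv_ad, taylor_const]

theorem FormalMap.adSeries_adInvSeries (v : E) :
    map₂ (evalEnd E) g.adSeries (fun n => g.adInvSeries n v) = const v := by
  refine eq_of_eqUpTo fun N n hn => ?_
  rw [EqUpTo.map₂ (evalEnd E) (g.eqUpTo_adSeries N) (g.eqUpTo_adInvSeries_apply N v) n hn,
    ← taylor_bilin _ (g.holAt_approx N).analyticAt_ad
      (analyticAt_clm_apply (g.holAt_approx N).inv.analyticAt_ad v)]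
  simp only [ContinuousLinearMap.id_apply, ad_ad_inv, taylor_const]

theorem FormalMap.adSeries_lie (v w : E) :
    (fun n => g.adSeries n (lieE E G v w) : FormalFun d E) =
      map₂ (lieCLM E G).toLinearMap₁₂ (fun n => g.adSeries n v) (fun n => g.adSeries n w) := by
  refine eq_of_eqUpTo fun N n hn => ?_
  have h := (g.holAt_approx N).analyticAt_ad
  rw [EqUpTo.map₂ _ (g.eqUpTo_adSeries_apply N v) (g.eqUpTo_adSeries_apply N w) n hn,
    show g.adSeries n (lieE E G v w) = _ from g.eqUpTo_adSeries_apply N _ n hn,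
    ← taylor_bilin _ (analyticAt_clm_apply h v) (analyticAt_clm_apply h w)]
  simp only [lieCLM_apply, ad_lie]

theorem FormalMap.pderiv_adSeries (i : Fin d) (v : E) :
    pderiv i (fun n => g.adSeries n v : FormalFun d E) =
      map₂ (evalEnd E) g.adSeries
        (map₂ (lieCLM E G).toLinearMap₁₂ (g.logDerivSeries i) (const v)) := by
  refine eq_of_eqUpTo fun N n hn => ?_
  -- One order beyond N, both for the partial derivative of Ad g and for η.
  have hf := g.holAt_approx (N + 1)
  have h := hf.analyticAt_ad
  have hl := hf.analyticAt_leftLogDeriv i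
  have h1 : EqUpTo N (map₂ (lieCLM E G).toLinearMap₁₂ (g.logDerivSeries i) (const v))
      (taylor fun x => lieCLM E G (leftLogDeriv (g.approx (N + 1)) i x) v) := by
    rw [taylor_bilin (lieCLM E G) hl analyticAt_const, taylor_const]
    exact EqUpTo.map₂ _ (g.eqUpTo_logDerivSeries N i) fun _ _ => rfl
  rw [(g.eqUpTo_adSeries_apply (N + 1) v).pderiv i n hn, pderiv_taylor (analyticAt_clm_apply h v),
    EqUpTo.map₂ (evalEnd E) ((g.eqUpTo_adSeries (N + 1)).mono (Nat.le_succ N)) h1 n hn,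
    ← taylor_bilin _ h (analyticAt_bilin (lieCLM E G) hl analyticAt_const)]
  refine congrFun (taylor_congr ?_) n
  filter_upwards [hf.eventually] with x hx
  rw [hx.leftLogDeriv_eq, ContinuousLinearMap.id_apply, lieCLM_apply, ← hx.fderiv_ad, partialDeriv,
    fderiv_clm_apply (hx.contDiffAt_ad.differentiableAt (by simp)) (differentiableAt_const _)]
  simp

theorem FormalMap.logDerivSeries_flat (i j : Fin d) :
    pderiv i (g.logDerivSeries j) - pderiv j (g.logDerivSeries i) +
      map₂ (lieCLM E G).toLinearMap₁₂ (g.logDerivSeries i) (g.logDerivSeries j) = 0 := by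
  refine eq_of_eqUpTo fun N n hn => ?_
  -- One extra order is spent in forming η from g, and another in differentiating η.
  have hf := g.holAt_approx (N + 2)
  have hl (i : Fin d) := hf.analyticAt_leftLogDeriv i
  have h (i : Fin d) := (g.eqUpTo_logDerivSeries (N + 1) i)
  have hd (i : Fin d) {x : Fin d → ℂ} (hx : HolAt E (g.approx (N + 2)) x) (j : Fin d) :
      partialDeriv i (leftLogDeriv (g.approx (N + 2)) j) x =
        fderiv ℂ (logDeriv E (g.approx (N + 2))) x (Pi.single i 1) (Pi.single j 1) := by
    rw [partialDeriv, (hx.leftLogDeriv_eventuallyEq j).fderiv_eq,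
      fderiv_clm_apply (hx.contDiffAt_logDeriv.differentiableAt (by simp))
        (differentiableAt_const _)]
    simp
  have key : taylor (partialDeriv i (leftLogDeriv (g.approx (N + 2)) j)) -
      taylor (partialDeriv j (leftLogDeriv (g.approx (N + 2)) i)) +
      taylor (fun x => lieCLM E G (leftLogDeriv (g.approx (N + 2)) i x)
        (leftLogDeriv (g.approx (N + 2)) j x)) = 0 := by
    have hs : taylor (fun x => - partialDeriv j (leftLogDeriv (g.approx (N + 2)) i) x) =
        - taylor (partialDeriv j (leftLogDeriv (E := E) (g.approx (N + 2)) i)) := by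
      have := taylor_clm (-ContinuousLinearMap.id ℂ E) (analyticAt_partialDeriv (hl i) j)
      refine this.trans ?_
      funext n; simp [FormalFun.map]
    rw [sub_eq_add_neg, ← hs, ← taylor_add (analyticAt_partialDeriv (hl j) i)
      (analyticAt_partialDeriv (hl i) j).fun_neg, ← taylor_add
      ((analyticAt_partialDeriv (hl j) i).fun_add (analyticAt_partialDeriv (hl i) j).fun_neg)
      (analyticAt_bilin _ (hl i) (hl j))]
    have h0 : (0 : FormalFun d E) = taylor (fun _ => (0 : E)) := by rw [taylor_const, const_zero]
    rw [h0]
    refine taylor_congr ?_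
    filter_upwards [hf.eventually] with x hx
    rw [hd i hx, hd j hx, hx.leftLogDeriv_eq, hx.leftLogDeriv_eq, lieCLM_apply, ← sub_eq_add_neg,
      hx.maurerCartan]
  rw [Pi.add_apply, Pi.sub_apply, (h j).pderiv i n hn, (h i).pderiv j n hn,
    EqUpTo.map₂ _ ((h i).mono (Nat.le_succ N)) ((h j).mono (Nat.le_succ N)) n hn,
    pderiv_taylor (hl j), pderiv_taylor (hl i), ← taylor_bilin _ (hl i) (hl j)]
  exact congrFun key n

theorem FormalMap.formalConjVelocity_eq (y : E) :
    (g.formalConjVelocity y : FormalFun d E) =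
      (fun n => g.adInvSeries n y) - const y := by
  funext n
  have h := (g.holAt_approx n.degree).inv.analyticAt_ad
  have h1 : (fun x => (conjVelocity (G := G) y (g.approx n.degree x) : E)) = fun x =>
      (Ad (g.approx n.degree x)⁻¹ : E →L[ℂ] E) y + -y := by
    funext x
    rw [← sub_eq_add_neg]
    exact conjVelocity_eq y _
  have h2 := taylor_add (analyticAt_clm_apply h y) (analyticAt_const (v := -y))
  have h3 : g.formalConjVelocity y n = taylor (fun x =>
      (Ad (g.approx n.degree x)⁻¹ : E →L[ℂ] E) y + -y) n := by
    rw [← h1]; rfl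
  rw [h2, Pi.add_apply, taylor_const, taylor_clm_apply h] at h3
  refine h3.trans ?_
  rw [const_neg, Pi.neg_apply, ← sub_eq_add_neg]
  rfl

end FormalIdentities

/-! ### Gauge data of an equivariant formal map. -/

section Main

variable {E : Type*} [NormedAddCommGroup E] [NormedSpace ℂ E] [CompleteSpace E]
  [FiniteDimensional ℂ E]
  {G : Type*} [TopologicalSpace G] [ChartedSpace E G] [Group G] [LieGroup 𝓘(ℂ, E) ω G]
  {𝔩 : LieSubalgebra ℂ (GroupLieAlgebra 𝓘(ℂ, E) G)} {d : ℕ} (b : Module.Basis (Fin d) ℂ 𝔩)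
  (g : FormalMap d E G)

instance : FiniteDimensional ℂ (GroupLieAlgebra 𝓘(ℂ, E) G) :=
  inferInstanceAs (FiniteDimensional ℂ E)

/-- The formal function `Ad g⁻¹ : D → End 𝔤`. -/
def FormalMap.formalAdInv :
    FormalFun d (GroupLieAlgebra 𝓘(ℂ, E) G →ₗ[ℂ] GroupLieAlgebra 𝓘(ℂ, E) G) :=
  fun n => (taylorCoeff (fun x => (Ad (g.approx n.degree x)⁻¹ : E →L[ℂ] E)) n).toLinearMap

theorem map₂_lieCLM (u v : FormalFun d E) :
    map₂ (lieCLM E G).toLinearMap₁₂ u v =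
      (br (𝔤 := GroupLieAlgebra 𝓘(ℂ, E) G) u v : FormalFun d (GroupLieAlgebra 𝓘(ℂ, E) G)) := by
  funext n
  exact Finset.sum_congr rfl fun p _ => lieCLM_apply _ _

/-- The identities for Ad g and η are read in 𝔤 instead of its model space E. Equivariance of g
enters only in the contraction property. -/
theorem FormalMap.gaugeData (hg : g.IsEquivariant b) :
    GaugeData b g.formalAd g.formalAdInv g.eta := by
  refine .of_const (fun v => ?_) (fun v => ?_) (fun v w => ?_) (fun i v => ?_) (fun i j => ?_)
    (fun y => ?_)
  · rw [app_apply_const]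
    exact g.adInvSeries_adSeries v
  · rw [app_apply_const]
    exact g.adSeries_adInvSeries v
  · rw [bilin_const, app_apply_const, app_apply_const, app_apply_const]
    refine (g.adSeries_lie v w).trans ?_
    exact map₂_lieCLM _ _
  · rw [app_apply_const]
    refine (g.pderiv_adSeries i v).trans ?_
    rw [map₂_lieCLM]
    rfl
  · have := g.logDerivSeries_flat i j
    rw [map₂_lieCLM] at this
    exact this
  · rw [hg y, app_apply_const]
    exact g.formalConjVelocity_eq (y : GroupLieAlgebra 𝓘(ℂ, E) G)

end Main

end DynR

end

theorem mainTheorem5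
    {E : Type*} [NormedAddCommGroup E] [NormedSpace ℂ E] [FiniteDimensional ℂ E] [CompleteSpace E]
    {G : Type*} [TopologicalSpace G] [ChartedSpace E G] [Group G] [LieGroup 𝓘(ℂ, E) ω G]
    [SimplyConnectedSpace G]
    (𝔩 : LieSubalgebra ℂ (GroupLieAlgebra 𝓘(ℂ, E) G))
    {d : ℕ} (b : Module.Basis (Fin d) ℂ 𝔩)
    (g : DynR.FormalMap d E G) (hg : g.IsEquivariant b)
    (r : DynR.FormalFun d (GroupLieAlgebra 𝓘(ℂ, E) G ⊗[ℂ] GroupLieAlgebra 𝓘(ℂ, E) G)) :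
    DynR.IsDynamicalRMatrix b r ↔ DynR.IsDynamicalRMatrix b (DynR.gauge b g r) :=
  (g.gaugeData b hg).isDynamicalRMatrix_iff r
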